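/- \textbf{Setting.} Let $d\in\{2,3\}$, let $\Omega\subset\mathbb{R}^d$ be bounded and open, $\mathbb{S}=\{\mu\in\mathbb{R}^d:|\mu|_2=1\}$, $\mathbb{E}=[E_{\min},E_{\max}]$ with $0\le E_{\min}<E_{\max}<\infty$, and $\mathcal D=\Omega\times\mathbb S\times\mathbb E$. Let $\mathcal T_\Omega$ be a finite family of pairwise disjoint open polytopes $\kappa_x\subset\Omega$ (not necessarily convex) with $\overline\Omega=\bigcup\overline{\kappa_x}$; let $\mathcal T_{\mathbb S}$ be a cube-sphere mesh, i.e. the image under $y\mapsto y/|y|_2$ of a mesh of the surface of the cube $[-1,1]^d$ by axis-parallel rectangles with disjoint interiors; let $\mathcal T_{\mathbb E}$ consist of the groups $(E_g,E_{g-1})$, $1\le g\le N$, with $E_{\max}=E_0>\dots>E_N=E_{\min}$. Put $\mathcal T=\mathcal T_\Omega\times\mathcal T_{\mathbb S}\times\mathcal T_{\mathbb E}$. Let $\mathbb V=\mathbb V_\Omega\otimes\mathbb V_{\mathbb S}\otimes\mathbb V_{\mathbb E}$, where $\mathbb V_\Omega$ consists of the piecewise polynomials of total degree at most $p$ on $\mathcal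 T_\Omega$, $\mathbb V_{\mathbb S}$ of the functions on $\mathbb S$ whose pull-back to each rectangle is a polynomial of degree at most $q$ in each coordinate, and $\mathbb V_{\mathbb E}$ of the piecewise polynomials of degree at most $r$ on $\mathcal T_{\mathbb E}$. The data are an absorption cross-section $\alpha(x,E)\ge0$, a scattering kernel $\theta(x,\mu'\cdot\mu,E'\to E)\ge0$ that vanishes for $E'<E$, a source $f$ on $\mathcal D$ and inflow data $g_D$. Set $$\beta(x,E)=\int_{\mathbb E}\int_{\mathbb S}\theta(x,\mu\cdot\mu',E\to E')\,d\mu'\,dE',\qquad \gamma(x,E)=\int_{\mathbb E}\int_{\mathbb S}\theta(x,\mu'\cdot\mu,E'\to E)\,d\mu'\,dE',$$ $$\overline\alpha=\alpha+\tfrac12(\beta-\gamma),\qquad S[u](x,\mu,E)=\int_{\mathbb E}\int_{\mathbb S}\theta(x,\mu'\cdot\mu,E'\to E)\,u(x,\mu',E')\,d\mu'\,dE'.$$ Assume that $\overline\alpha\ge\alpha_0$ a.e. for some constant $\alpha_0>0$, that $\alpha,\beta,f$ are integrable over $\mathcal D$, and that $|\mu\cdot n|\,g_D$ is integrable over the inflow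 boundary. For an element $\kappa_x$, let $\partial\kappa_x$ be the union of its open $(d-1)$-dimensional faces, $n$ its outward unit normal, $\partial_-\kappa_x=\{\mu\cdot n<0\}$ and $\partial_+\kappa_x=\{\mu\cdot n\ge0\}$, and let $v^+$ and $v^-$ be the interior and exterior traces of $v$ on $\partial\kappa_x$. For $w,v\in\mathbb V$ let $$a(w,v)=\int_{\mathbb E}\int_{\mathbb S}\sum_{\kappa_x\in\mathcal T_\Omega}\Big[\int_{\kappa_x}\big(-w\,\mu\cdot\nabla_xv+(\alpha+\beta)wv\big)dx+\int_{\partial_+\kappa_x}|\mu\cdot n|\,w^+v^+ds-\int_{\partial_-\kappa_x\setminus\partial\Omega}|\mu\cdot n|\,w^-v^+ds\Big]d\mu\,dE,$$ $$s(w,v)=\int_{\mathcal D}S[w]\,v,\qquad \ell(v)=\int_{\mathbb E}\int_{\mathbb S}\sum_{\kappa_x\in\mathcal T_\Omega}\Big[\int_{\kappa_x}fv\,dx+\int_{\partial_-\kappa_x\cap\partial\Omega}|\mu\cdot n|\,g_D\,v^+ds\Big]d\mu\,dE,$$ $$|||v|||_{DG}^2=\|\sqrt{\overline\alpha}\,v\|_{L_2(\mathcal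 D)}^2+\frac12\int_{\mathbb E}\int_{\mathbb S}\sum_{\kappa_x\in\mathcal T_\Omega}\Big[\int_{\partial_-\kappa_x\setminus\partial\Omega}|\mu\cdot n|(v^+-v^-)^2ds+\int_{\partial\kappa_x\cap\partial\Omega}|\mu\cdot n|(v^+)^2ds\Big]d\mu\,dE.$$ \textbf{Theorem.} Let $u_h\in\mathbb V$ satisfy $a(u_h,v_h)=s(u_h,v_h)+\ell(v_h)$ for all $v_h\in\mathbb V$, and let $\hat u_h\in\mathbb V$ be arbitrary. Then there is a unique $r_h=r_h(\hat u_h)\in\mathbb V$ with $$(\overline\alpha\,r_h,v_h)_{L_2(\mathcal D)}=\ell(v_h)-\big[a(\hat u_h,v_h)-s(\hat u_h,v_h)\big]\qquad\text{for all }v_h\in\mathbb V,$$ $\sqrt{\overline\alpha}\,r_h$ belongs to $L_2(\mathcal D)$, and, with $\eta_\kappa(\hat u_h)=\|\sqrt{\overline\alpha}\,r_h(\hat u_h)\|_{L_2(\kappa)}$ for $\kappa\in\mathcal T$, $$|||u_h-\hat u_h|||_{DG}\le\Big(\sum_{\kappa\in\mathcal T}\eta_\kappa(\hat u_h)^2\Big)^{1/2}=\|\sqrt{\overline\alpha}\,r_h(\hat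 u_h)\|_{L_2(\mathcal D)}.$$ The same holds in the mono-energetic setting, in which the energy variable, its integrals and the factor $\mathbb V_{\mathbb E}$ are omitted throughout. -/

import Mathlib

open MeasureTheory Set Topology
open scoped BigOperators RealInnerProductSpace

namespace LBTE

/-! ### Phase space -/

/-- The ambient space `ℝᵈ` with the Euclidean norm. -/
abbrev Space (d : ℕ) := EuclideanSpace ℝ (Fin d)

/-- The angular domain: the Euclidean unit sphere of `ℝᵈ`. -/
abbrev Direction (d : ℕ) := Metric.sphere (0 : Space d) 1

/-- Points `z = (x, μ, E)`. -/
abbrev Phase (d : ℕ) := Space d × Direction d × ℝ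

/-- The surface measure of the unit sphere. -/
noncomputable def sphereMeasure (d : ℕ) : Measure (Direction d) :=
  (volume : Measure (Space d)).toSphere

/-! ### Polytopic spatial elements -/

/-- An open (not necessarily convex) polytope: a nonempty bounded regular open set whose boundary
lies in finitely many hyperplanes `⟪h.1, x⟫ = h.2`. -/
structure IsOpenPolytope {d : ℕ} (K : Set (Space d)) : Prop where
  isOpen : IsOpen K
  nonempty : K.Nonempty
  bounded : Bornology.IsBounded K
  regular : interior (closure K) = K
  piecewise_flat : ∃ H : Finset (Space d × ℝ), (∀ h ∈ H, h.1 ≠ 0) ∧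
    frontier K ⊆ ⋃ h ∈ H, {x | ⟪h.1, x⟫ = h.2}

/-- `n` is the outward unit normal to `K` at a point `x` of an open `(d-1)`-dimensional face:
near `x`, the set `K` is the open half-space through `x` with outward unit normal `n`. -/
def IsOutwardNormal {d : ℕ} (K : Set (Space d)) (x n : Space d) : Prop :=
  ‖n‖ = 1 ∧ ∀ᶠ y in 𝓝 x, (y ∈ K ↔ ⟪n, y - x⟫ < 0)

/-- The union `∂K` of the open `(d-1)`-dimensional faces of `K`. -/
def faces {d : ℕ} (K : Set (Space d)) : Set (Space d) :=
  {x | ∃ n, IsOutwardNormal K x n}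

open Classical in
/-- The outward unit normal to `K` on `faces K` (and `0` elsewhere). -/
noncomputable def normal {d : ℕ} (K : Set (Space d)) (x : Space d) : Space d :=
  if h : ∃ n, IsOutwardNormal K x n then h.choose else 0

/-! ### Cube-sphere angular elements -/

/-- A tensor-product element of the surface of the cube `[-1,1]ᵈ`: the rectangle
`{y | y_axis = sign, lo_j ≤ y_j ≤ hi_j for j ≠ axis}` in the face `y_axis = sign`. -/
structure CubeCell (d : ℕ) where
  axis : Fin d
  sign : ℝ
  sign_eq : sign = 1 ∨ sign = -1
  lo : Fin d → ℝ
  hi : Fin d → ℝ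
  bounds : ∀ j, j ≠ axis → -1 ≤ lo j ∧ lo j < hi j ∧ hi j ≤ 1

/-- The closed rectangle. -/
def CubeCell.closed {d : ℕ} (c : CubeCell d) : Set (Space d) :=
  {y | y c.axis = c.sign ∧ ∀ j, j ≠ c.axis → y j ∈ Icc (c.lo j) (c.hi j)}

/-- The relatively open rectangle. -/
def CubeCell.interior {d : ℕ} (c : CubeCell d) : Set (Space d) :=
  {y | y c.axis = c.sign ∧ ∀ j, j ≠ c.axis → y j ∈ Ioo (c.lo j) (c.hi j)}

/-- The surface of the cube `[-1,1]ᵈ`. -/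
def cubeSurface (d : ℕ) : Set (Space d) :=
  {y | (∀ j, |y j| ≤ 1) ∧ ∃ j, |y j| = 1}

/-- The curved (relatively open) element of the sphere obtained from a rectangle through
the radial projection `y ↦ y / |y|`. -/
def CubeCell.curved {d : ℕ} (c : CubeCell d) : Set (Direction d) :=
  {ω | ∃ y ∈ c.interior, (ω : Space d) = ‖y‖⁻¹ • y}

/-! ### Energy -/

/-- Energy discretisation. `poly N node r`: energy domain `[node N, node 0]`, groups
`(node (g+1), node g)`, piecewise polynomials of degree at most `r`. `mono`: the mono-energetic
setting, in which there is no energy variable; it is encoded by a dummy energy variable that takes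
only the value `0`, with unit mass. -/
inductive EnergyMesh where
  | mono : EnergyMesh
  | poly (N : ℕ) (hN : 1 ≤ N) (node : Fin (N + 1) → ℝ) (hnode : StrictAnti node)
      (hmin : 0 ≤ node (Fin.last N)) (r : ℕ) : EnergyMesh

namespace EnergyMesh

/-- The energy domain. -/
def domain : EnergyMesh → Set ℝ
  | mono => {0}
  | poly N _ node _ _ _ => Icc (node (Fin.last N)) (node 0)

/-- Integration over the energy domain. -/
noncomputable def measure : EnergyMesh → Measure ℝ
  | mono => Measure.dirac 0
  | poly N _ node _ _ _ => volume.restrict (Icc (node (Fin.last N)) (node 0))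

/-- The number of energy groups. -/
def numGroups : EnergyMesh → ℕ
  | mono => 1
  | poly N _ _ _ _ _ => N

/-- The energy groups. -/
def group : (T : EnergyMesh) → Fin T.numGroups → Set ℝ
  | mono, _ => {0}
  | poly _ _ node _ _ _, g => Ioo (node (Fin.succ g)) (node (Fin.castSucc g))

/-- The polynomial degree in energy. -/
def degree : EnergyMesh → ℕ
  | mono => 0
  | poly _ _ _ _ _ r => r

end EnergyMesh

/-! ### The space-angle-energy mesh -/

/-- A bounded open spatial domain `Ω`, a spatial mesh of disjoint open polytopes, a cube-sphere
angular mesh, an energy mesh, and polynomial degrees `p` (space) and `q` (angle). -/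
structure Mesh (d : ℕ) where
  Ω : Set (Space d)
  isOpen_Ω : IsOpen Ω
  bounded_Ω : Bornology.IsBounded Ω
  numSpace : ℕ
  elem : Fin numSpace → Set (Space d)
  elem_polytope : ∀ k, IsOpenPolytope (elem k)
  elem_subset : ∀ k, elem k ⊆ Ω
  elem_disjoint : ∀ k l, k ≠ l → Disjoint (elem k) (elem l)
  elem_cover : closure Ω = ⋃ k, closure (elem k)
  p : ℕ
  numAngle : ℕ
  cell : Fin numAngle → CubeCell d
  cell_disjoint : ∀ k l, k ≠ l → Disjoint (cell k).interior (cell l).interior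
  cell_cover : cubeSurface d = ⋃ k, (cell k).closed
  q : ℕ
  energy : EnergyMesh

namespace Mesh

variable {d : ℕ}

/-- The indices of the space-angle-energy elements. -/
abbrev Index (T : Mesh d) := Fin T.numSpace × Fin T.numAngle × Fin T.energy.numGroups

/-- The space-angle-energy element `κ = κ_x × κ_μ × κ_g`. -/
def element (T : Mesh d) (κ : T.Index) : Set (Phase d) :=
  T.elem κ.1 ×ˢ (T.cell κ.2.1).curved ×ˢ T.energy.group κ.2.2

/-- The phase domain `Ω × 𝕊 × 𝔼`. -/
def domain (T : Mesh d) : Set (Phase d) :=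
  T.Ω ×ˢ (univ : Set (Direction d)) ×ˢ T.energy.domain

/-- Integration over angle and energy. -/
noncomputable def angleEnergyMeasure (T : Mesh d) : Measure (Direction d × ℝ) :=
  (sphereMeasure d).prod T.energy.measure

/-- Integration over the phase domain `Ω × 𝕊 × 𝔼`. -/
noncomputable def phaseMeasure (T : Mesh d) : Measure (Phase d) :=
  (volume.restrict T.Ω).prod T.angleEnergyMeasure

/-- Integration `ds dμ dE` over `∂κ_x × 𝕊 × 𝔼`, where `ds` is the surface measure, that is, the
`(d-1)`-dimensional Hausdorff measure in the Euclidean normalisation. -/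
noncomputable def faceMeasure (T : Mesh d) (k : Fin T.numSpace) : Measure (Phase d) :=
  (((μHE[d - 1] : Measure (Space d))).restrict (faces (T.elem k))).prod T.angleEnergyMeasure

/-! ### Finite element spaces

A finite element function is represented by the representative that is piecewise polynomial on
the open elements and vanishes off them; this identifies the space with a space of
(classes of) `L²` functions, the mesh skeleton being a null set. -/

/-- Piecewise polynomials of total degree at most `p` in space. -/
def IsSpaceFE (T : Mesh d) (φ : Space d → ℝ) : Prop :=
  (∀ k, ∃ P : MvPolynomial (Fin d) ℝ, P.totalDegree ≤ T.p ∧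
    ∀ x ∈ T.elem k, φ x = MvPolynomial.eval (fun i => x i) P) ∧
  ∀ x, (∀ k, x ∉ T.elem k) → φ x = 0

/-- Functions that, pulled back to each rectangle of the cube surface, are polynomials of degree
at most `q` in each coordinate (the coordinate `axis` is constant on the rectangle). -/
def IsAngleFE (T : Mesh d) (ψ : Direction d → ℝ) : Prop :=
  (∀ k, ∃ P : MvPolynomial (Fin d) ℝ, (∀ j, P.degreeOf j ≤ T.q) ∧
    ∀ y ∈ (T.cell k).interior, ∀ ω : Direction d, (ω : Space d) = ‖y‖⁻¹ • y →
      ψ ω = MvPolynomial.eval (fun i => y i) P) ∧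
  ∀ ω, (∀ k, ω ∉ (T.cell k).curved) → ψ ω = 0

/-- Piecewise polynomials of degree at most `r` in energy. -/
def IsEnergyFE (T : Mesh d) (χ : ℝ → ℝ) : Prop :=
  (∀ g, ∃ P : Polynomial ℝ, P.natDegree ≤ T.energy.degree ∧
    ∀ E ∈ T.energy.group g, χ E = P.eval E) ∧
  ∀ E, (∀ g, E ∉ T.energy.group g) → χ E = 0

/-- The finite element space: the tensor product of the three spaces above. -/
noncomputable def FESpace (T : Mesh d) : Submodule ℝ (Phase d → ℝ) :=
  Submodule.span ℝ {v | ∃ φ ψ χ, T.IsSpaceFE φ ∧ T.IsAngleFE ψ ∧ T.IsEnergyFE χ ∧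
    v = fun z => φ z.1 * ψ z.2.1 * χ z.2.2}

/-! ### Traces and inflow / outflow boundaries -/

/-- The interior trace `v⁺` on `∂κ_x`: the limit of `v(·, μ, E)` from inside the element. -/
noncomputable def traceInt (T : Mesh d) (k : Fin T.numSpace) (v : Phase d → ℝ)
    (z : Phase d) : ℝ :=
  extendFrom (T.elem k) (fun x => v (x, z.2)) z.1

/-- The exterior trace `v⁻` on `∂κ_x`: the limit of `v(·, μ, E)` from the other elements. -/
noncomputable def traceExt (T : Mesh d) (k : Fin T.numSpace) (v : Phase d → ℝ)
    (z : Phase d) : ℝ :=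
  extendFrom (⋃ l ∈ {l | l ≠ k}, T.elem l) (fun x => v (x, z.2)) z.1

/-- `μ · n` on `∂κ_x`. -/
noncomputable def flux (T : Mesh d) (k : Fin T.numSpace) (z : Phase d) : ℝ :=
  ⟪(z.2.1 : Space d), normal (T.elem k) z.1⟫

/-- The inflow boundary `{x ∈ ∂κ_x, μ · n(x) < 0}` (over all `μ` and `E`). -/
def inflow (T : Mesh d) (k : Fin T.numSpace) : Set (Phase d) :=
  {z | z.1 ∈ faces (T.elem k) ∧ T.flux k z < 0}

/-- The outflow boundary `{x ∈ ∂κ_x, μ · n(x) ≥ 0}` (over all `μ` and `E`). -/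
def outflow (T : Mesh d) (k : Fin T.numSpace) : Set (Phase d) :=
  {z | z.1 ∈ faces (T.elem k) ∧ 0 ≤ T.flux k z}

/-- The points over the boundary `∂Ω`. -/
def boundary (T : Mesh d) : Set (Phase d) :=
  {z | z.1 ∈ frontier T.Ω}

/-- The `L²` norm over a set `A` of phase space. -/
noncomputable def l2Norm (T : Mesh d) (A : Set (Phase d)) (v : Phase d → ℝ) : ℝ :=
  √(∫ z in A, v z ^ 2 ∂T.phaseMeasure)

end Mesh

/-! ### Problem data -/

/-- Data of the transport problem: the absorption cross-section `α(x, E)`, the scattering kernel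
`θ x t E' E = θ(x, t, E' → E)` with `t = μ' · μ`, the source `f`, and the inflow data `gD`. -/
structure Data (d : ℕ) where
  α : Space d → ℝ → ℝ
  θ : Space d → ℝ → ℝ → ℝ → ℝ
  f : Phase d → ℝ
  gD : Phase d → ℝ

namespace Data

variable {d : ℕ}

/-- The macroscopic scattering cross-section
`β = ∫∫ θ(x, μ·μ', E → E') dμ' dE'` (its value does not depend on `μ`, by rotation invariance). -/
noncomputable def β (D : Data d) (T : Mesh d) (z : Phase d) : ℝ :=
  ∫ y, D.θ z.1 ⟪(z.2.1 : Space d), (y.1 : Space d)⟫ z.2.2 y.2 ∂T.angleEnergyMeasure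

/-- `γ = ∫∫ θ(x, μ'·μ, E' → E) dμ' dE'` (its value does not depend on `μ` either). -/
noncomputable def γ (D : Data d) (T : Mesh d) (z : Phase d) : ℝ :=
  ∫ y, D.θ z.1 ⟪(y.1 : Space d), (z.2.1 : Space d)⟫ y.2 z.2.2 ∂T.angleEnergyMeasure

/-- `ᾱ = α + (β - γ) / 2`. -/
noncomputable def αbar (D : Data d) (T : Mesh d) (z : Phase d) : ℝ :=
  D.α z.1 z.2.2 + (1 / 2) * (D.β T z - D.γ T z)

/-- The scattering operator `S[u] = ∫∫ θ(x, μ'·μ, E' → E) u(x, μ', E') dμ' dE'`. -/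
noncomputable def scatter (D : Data d) (T : Mesh d) (u : Phase d → ℝ) (z : Phase d) : ℝ :=
  ∫ y, D.θ z.1 ⟪(y.1 : Space d), (z.2.1 : Space d)⟫ y.2 z.2.2 * u (z.1, y)
    ∂T.angleEnergyMeasure

/-- The standing assumptions on the data. The integrability assumptions only say that the
coefficients `α`, `β`, the source `f` and the inflow data `|μ·n| gD` are of class `L¹`. -/
structure IsAdmissible (D : Data d) (T : Mesh d) : Prop where
  α_nonneg : ∀ x ∈ T.Ω, ∀ E ∈ T.energy.domain, 0 ≤ D.α x E
  α_integrable : Integrable (fun z : Phase d => D.α z.1 z.2.2) T.phaseMeasure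
  θ_nonneg : ∀ x ∈ T.Ω, ∀ t ∈ Icc (-1 : ℝ) 1, ∀ E' ∈ T.energy.domain, ∀ E ∈ T.energy.domain,
    0 ≤ D.θ x t E' E
  θ_downscatter : ∀ x ∈ T.Ω, ∀ t ∈ Icc (-1 : ℝ) 1, ∀ E' ∈ T.energy.domain,
    ∀ E ∈ T.energy.domain, E' < E → D.θ x t E' E = 0
  θ_integrable : Integrable (fun w : Phase d × (Direction d × ℝ) =>
    D.θ w.1.1 ⟪(w.1.2.1 : Space d), (w.2.1 : Space d)⟫ w.1.2.2 w.2.2)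
    (T.phaseMeasure.prod T.angleEnergyMeasure)
  f_integrable : Integrable D.f T.phaseMeasure
  gD_integrable : ∀ k, IntegrableOn (fun z => |T.flux k z| * D.gD z)
    (T.inflow k ∩ T.boundary) (T.faceMeasure k)
  αbar_pos : ∃ α₀ : ℝ, 0 < α₀ ∧ ∀ᵐ z ∂T.phaseMeasure, α₀ ≤ D.αbar T z

/-! ### The discontinuous Galerkin method -/

/-- The transport bilinear form `a(w, v)`. -/
noncomputable def a (D : Data d) (T : Mesh d) (w v : Phase d → ℝ) : ℝ :=
  ∑ k : Fin T.numSpace,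
    ((∫ z in {z : Phase d | z.1 ∈ T.elem k},
        (-(w z * fderiv ℝ (fun x => v (x, z.2)) z.1 (z.2.1 : Space d))
          + (D.α z.1 z.2.2 + D.β T z) * w z * v z) ∂T.phaseMeasure)
      + (∫ z in T.outflow k,
          |T.flux k z| * T.traceInt k w z * T.traceInt k v z ∂T.faceMeasure k)
      - (∫ z in T.inflow k \ T.boundary,
          |T.flux k z| * T.traceExt k w z * T.traceInt k v z ∂T.faceMeasure k))

/-- The scattering bilinear form `s(w, v)`. -/
noncomputable def s (D : Data d) (T : Mesh d) (w v : Phase d → ℝ) : ℝ :=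
  ∫ z, D.scatter T w z * v z ∂T.phaseMeasure

/-- The right-hand side `ℓ(v)`. -/
noncomputable def ℓ (D : Data d) (T : Mesh d) (v : Phase d → ℝ) : ℝ :=
  ∑ k : Fin T.numSpace,
    ((∫ z in {z : Phase d | z.1 ∈ T.elem k}, D.f z * v z ∂T.phaseMeasure)
      + (∫ z in T.inflow k ∩ T.boundary,
          |T.flux k z| * D.gD z * T.traceInt k v z ∂T.faceMeasure k))

/-- `u` is a solution of the DGFEM scheme. -/
def IsDGSolution (D : Data d) (T : Mesh d) (u : Phase d → ℝ) : Prop :=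
  u ∈ T.FESpace ∧ ∀ v ∈ T.FESpace, D.a T u v = D.s T u v + D.ℓ T v

/-- The DGFEM-energy norm. -/
noncomputable def dgNorm (D : Data d) (T : Mesh d) (v : Phase d → ℝ) : ℝ :=
  √(T.l2Norm T.domain (fun z => √(D.αbar T z) * v z) ^ 2
    + (1 / 2) * ∑ k : Fin T.numSpace,
      ((∫ z in T.inflow k \ T.boundary,
          |T.flux k z| * (T.traceInt k v z - T.traceExt k v z) ^ 2 ∂T.faceMeasure k)
        + (∫ z in {z : Phase d | z.1 ∈ faces (T.elem k)} ∩ T.boundary,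
          |T.flux k z| * T.traceInt k v z ^ 2 ∂T.faceMeasure k)))

/-- The residual functional `R[w](v) = ℓ(v) - (a(w, v) - s(w, v))`. -/
noncomputable def residual (D : Data d) (T : Mesh d) (w v : Phase d → ℝ) : ℝ :=
  D.ℓ T v - (D.a T w v - D.s T w v)

/-- `r` solves the variational problem `(ᾱ r, v) = R[w](v)` for all `v` in the
finite element space. -/
def IsResidualRep (D : Data d) (T : Mesh d) (w r : Phase d → ℝ) : Prop :=
  r ∈ T.FESpace ∧ ∀ v ∈ T.FESpace,
    ∫ z in T.domain, D.αbar T z * r z * v z ∂T.phaseMeasure = D.residual T w v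

/-- The local indicator `η_κ = ‖√ᾱ r‖_{L²(κ)}`. -/
noncomputable def η (D : Data d) (T : Mesh d) (r : Phase d → ℝ) (κ : T.Index) : ℝ :=
  T.l2Norm (T.element κ) (fun z => √(D.αbar T z) * r z)

end Data

end LBTE

/-!
The bound is the standard stability argument for a coercive problem. Write `e = u - û`. Galerkin
orthogonality gives `(ᾱ r, e) = R[û](e) = a(e, e) - s(e, e)`, and if the form `a - s` is coercive,
`|||e|||² ≤ a(e, e) - s(e, e)`, then `|||e|||² ≤ (ᾱ r, e)` and Young's inequality bounds `|||e|||`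
by `‖√ᾱ r‖` (`dgNorm_error_le`). The function `r` exists and is unique because `(ᾱ ·, ·)` is
definite on the finite-dimensional space `𝕍` (`FESpace_fg`, `FE_eq_zero_of_ae`) and the residual is
linear on it (`existsUnique_isResidualRep`).

The work is in coercivity (`coercive`), which has two parts.

*Transport.* On the diagonal, `-v μ·∇v = -μ·∇(v²) / 2` turns into a surface integral on each
spatial element. On an interior face the contributions of the two adjacent elements combine into
half the squared jump, and on `∂Ω` half the squared trace remains (`surface_identity`, `a_self`).
This uses that almost every point of an interior face belongs to a face of exactly one other
element (`ae_exists_neighbour`, `notMem_faces_third`), with the opposite normal.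

*Scattering.* By `v v' ≤ (v² + v'²) / 2` and Fubini, `s(v, v) ≤ ∫ (β + γ) v² / 2`
(`integral_scatter_self_le`), and `α + β - (β + γ) / 2 = ᾱ`.

The divergence theorem for a polytope with respect to the Hausdorff measure on its faces
(`integral_fderiv_eq_integral_faces`) is proved one coordinate direction `i` at a time. Almost every
line in direction `i` meets the hyperplanes that carry the boundary in distinct points, off which
membership in the polytope is locally constant, so that the fundamental theorem of calculus on a
finite union of intervals applies (`integral_deriv_eq_sum_jump`, `integral_line`). By the local
structure of a polytope at such a point (`local_structure`), the jump there is `nᵢ` times the area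
factor of the hyperplane as a graph over the remaining coordinates, so that integration over the
lines produces the surface measure (`restrict_plane_eq_map`).

Finite element functions are handled through extensions of their restrictions to the spatial
elements (`IsRep`), which replace the traces by jointly measurable functions.
-/

namespace LBTE

/-! ### The fundamental theorem of calculus on a finite union of intervals -/

/-- A function on the line that is constant on a punctured neighbourhood of every point takes a
single value at all points at which it is locally constant. -/
theorem exists_const_of_eventually_punctured {D : ℝ → ℝ}
    (h : ∀ t, ∃ c, ∀ᶠ u in 𝓝[≠] t, D u = c) :
    ∃ C, ∀ t, (∀ᶠ u in 𝓝 t, D u = D t) → D t = C := by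
  choose c hc using h
  have hloc : IsLocallyConstant c := by
    rw [IsLocallyConstant.iff_eventually_eq]
    intro t
    have h1 := (eventually_eventually_nhdsWithin (a := t) (s := {t}ᶜ)).2 (hc t)
    have h2 : ∀ᶠ u in 𝓝[≠] t, c u = c t := by
      filter_upwards [h1, self_mem_nhdsWithin] with u hu hut
      have h3 : ∀ᶠ w in 𝓝[≠] u, D w = c t := by
        rw [isOpen_compl_singleton.nhdsWithin_eq hut] at hu
        exact hu.filter_mono nhdsWithin_le_nhds
      obtain ⟨w, hw1, hw2⟩ := (h3.and (hc u)).exists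
      rw [← hw1, ← hw2]
    rw [eventually_nhdsWithin_iff] at h2
    filter_upwards [h2] with u hu
    by_cases hut : u = t
    · rw [hut]
    · exact hu hut
  refine ⟨c 0, fun t ht => ?_⟩
  obtain ⟨u, hu1, hu2⟩ := ((ht.filter_mono nhdsWithin_le_nhds).and (hc t)).exists
  rw [← hu1, hu2]
  exact hloc.apply_eq_of_isPreconnected isPreconnected_univ (mem_univ _) (mem_univ _)

/-- **Fundamental theorem of calculus on a union of intervals.** If `U` is a bounded set of reals
whose indicator is locally constant off the points `τ h`, and drops by `J h` when `τ h` is crossed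
from left to right, then `∫_U g' = ∑ₕ J h * g (τ h)`. -/
theorem integral_deriv_eq_sum_jump {ι : Type*} (s : Finset ι) (τ J : ι → ℝ)
    (hτ : InjOn τ s) {U : Set ℝ} (hUm : MeasurableSet U) (hUb : Bornology.IsBounded U)
    (hoff : ∀ t, (∀ h ∈ s, t ≠ τ h) → ∀ᶠ u in 𝓝 t, (u ∈ U ↔ t ∈ U))
    (hon : ∀ h ∈ s, ∃ l r : ℝ, J h = l - r ∧
      (∀ᶠ u in 𝓝[<] τ h, U.indicator (fun _ => (1 : ℝ)) u = l) ∧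
      ∀ᶠ u in 𝓝[>] τ h, U.indicator (fun _ => (1 : ℝ)) u = r)
    {g g' : ℝ → ℝ} (hg : ∀ t, HasDerivAt g (g' t) t) (hg' : Continuous g') :
    ∫ t in U, g' t = ∑ h ∈ s, J h * g (τ h) := by
  classical
  set D : ℝ → ℝ := fun u =>
    U.indicator (fun _ => (1 : ℝ)) u + ∑ h ∈ s, J h * (Ioi (τ h)).indicator (fun _ => (1 : ℝ)) u
    with hD
  have hstep : ∀ a t : ℝ, t ≠ a → ∀ᶠ u in 𝓝 t,
      (Ioi a).indicator (fun _ => (1 : ℝ)) u = (Ioi a).indicator (fun _ => (1 : ℝ)) t := by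
    intro a t hta
    rcases lt_or_gt_of_ne hta with h | h
    · filter_upwards [Iio_mem_nhds h] with u hu
      simp [indicator, not_lt.2 (le_of_lt h), not_lt.2 (le_of_lt (mem_Iio.1 hu))]
    · filter_upwards [Ioi_mem_nhds h] with u hu
      simp [indicator, h, mem_Ioi.1 hu]
  have hind : ∀ t, (∀ h ∈ s, t ≠ τ h) → ∀ᶠ u in 𝓝 t,
      U.indicator (fun _ => (1 : ℝ)) u = U.indicator (fun _ => (1 : ℝ)) t := by
    intro t ht
    filter_upwards [hoff t ht] with u hu
    simp only [indicator, hu]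
  have hDoff : ∀ t, (∀ h ∈ s, t ≠ τ h) → ∀ᶠ u in 𝓝 t, D u = D t := by
    intro t ht
    have h1 : ∀ᶠ u in 𝓝 t, ∀ h ∈ s,
        (Ioi (τ h)).indicator (fun _ => (1 : ℝ)) u = (Ioi (τ h)).indicator (fun _ => (1 : ℝ)) t :=
      (Finset.eventually_all s).2 fun h hh => hstep _ _ (ht h hh)
    filter_upwards [h1, hind t ht] with u h1 h2
    simp only [hD, h2]
    congr 1
    exact Finset.sum_congr rfl fun h hh => by rw [h1 h hh]
  have hpunct : ∀ t, ∃ c, ∀ᶠ u in 𝓝[≠] t, D u = c := by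
    intro t
    by_cases ht : ∀ h ∈ s, t ≠ τ h
    · exact ⟨D t, (hDoff t ht).filter_mono nhdsWithin_le_nhds⟩
    push Not at ht
    obtain ⟨k, hk, rfl⟩ := ht
    obtain ⟨l, r, hJ, hl, hr⟩ := hon k hk
    set R : ℝ := ∑ h ∈ s.erase k, J h * (Ioi (τ h)).indicator (fun _ => (1 : ℝ)) (τ k) with hR
    have hrest : ∀ᶠ u in 𝓝 (τ k), ∑ h ∈ s.erase k,
        J h * (Ioi (τ h)).indicator (fun _ => (1 : ℝ)) u = R := by
      have h1 : ∀ᶠ u in 𝓝 (τ k), ∀ h ∈ s.erase k, (Ioi (τ h)).indicator (fun _ => (1 : ℝ)) u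
          = (Ioi (τ h)).indicator (fun _ => (1 : ℝ)) (τ k) :=
        (Finset.eventually_all _).2 fun h hh => hstep _ _ fun he =>
          (Finset.mem_erase.1 hh).1 (hτ (Finset.mem_erase.1 hh).2 hk he.symm)
      filter_upwards [h1] with u h1
      exact Finset.sum_congr rfl fun h hh => by rw [h1 h hh]
    have hDsplit : ∀ u, D u = U.indicator (fun _ => (1 : ℝ)) u
        + (J k * (Ioi (τ k)).indicator (fun _ => (1 : ℝ)) u
          + ∑ h ∈ s.erase k, J h * (Ioi (τ h)).indicator (fun _ => (1 : ℝ)) u) := by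
      intro u
      rw [Finset.add_sum_erase s
        (fun h => J h * (Ioi (τ h)).indicator (fun _ => (1 : ℝ)) u) hk]
    refine ⟨l + R, ?_⟩
    rw [← Iio_union_Ioi, nhdsWithin_union, Filter.eventually_sup]
    constructor
    · filter_upwards [hl, hrest.filter_mono nhdsWithin_le_nhds, self_mem_nhdsWithin]
        with u h1 h2 h3
      rw [hDsplit, h1, h2, indicator_of_notMem (by simpa using le_of_lt (mem_Iio.1 h3))]
      ring
    · filter_upwards [hr, hrest.filter_mono nhdsWithin_le_nhds, self_mem_nhdsWithin]
        with u h1 h2 h3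
      rw [hDsplit, h1, h2, indicator_of_mem h3, hJ]
      ring
  obtain ⟨C, hC⟩ := exists_const_of_eventually_punctured hpunct
  -- Choose `R` beyond the set `U` and all the points `τ h`.
  obtain ⟨R, hR⟩ : ∃ R : ℝ, U ∪ τ '' s ⊆ Ioo (-R) R := by
    obtain ⟨R, hR⟩ := ((hUb.union (s.finite_toSet.image τ).isBounded)).subset_ball 0
    exact ⟨R, by simpa [Real.ball_eq_Ioo] using hR⟩
  have hUR : ∀ t ∈ U, -R < t ∧ t < R := fun t ht => hR (Or.inl ht)
  have hτR : ∀ h ∈ s, -R < τ h ∧ τ h < R := fun h hh => hR (Or.inr ⟨h, hh, rfl⟩)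
  have hRpos : ∀ h ∈ s, -R < R := fun h hh => (hτR h hh).1.trans (hτR h hh).2
  rcases s.eq_empty_or_nonempty with rfl | ⟨h₀, hh₀⟩
  · have hU : U = ∅ := by
      by_contra hne
      obtain ⟨t, ht⟩ := nonempty_iff_ne_empty.2 hne
      have h1 := hC t (hDoff t (by simp))
      have h2 := hC R (hDoff R (by simp))
      have h3 : R ∉ U := fun h => lt_irrefl _ (hUR R h).2
      simp [hD, ht] at h1
      simp [hD, h3] at h2
      linarith
    simp [hU]
  have hRR := hRpos h₀ hh₀
  have hDL : D (-R) = 0 := by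
    have h3 : -R ∉ U := fun h => lt_irrefl _ (hUR _ h).1
    simp only [hD, indicator_of_notMem h3, zero_add]
    refine Finset.sum_eq_zero fun h hh => ?_
    rw [indicator_of_notMem (by simpa using (hτR h hh).1.le), mul_zero]
  have hC0 : C = 0 := by
    rw [← hC (-R) (hDoff _ fun h hh => (hτR h hh).1.ne), hDL]
  have hDR : ∑ h ∈ s, J h = 0 := by
    have h2 := hC R (hDoff R fun h hh => (hτR h hh).2.ne')
    have h3 : R ∉ U := fun h => lt_irrefl _ (hUR R h).2
    simp only [hD, indicator_of_notMem h3, zero_add, hC0] at h2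
    rw [← h2]
    refine Finset.sum_congr rfl fun h hh => ?_
    rw [indicator_of_mem (by exact (hτR h hh).2), mul_one]
  have hae : ∀ᵐ t : ℝ, D t = 0 := by
    have hfin : volume (τ '' s) = 0 := (s.finite_toSet.image τ).measure_zero _
    filter_upwards [measure_eq_zero_iff_ae_notMem.1 hfin] with t ht
    rw [hC t (hDoff t fun h hh he => ht ⟨h, hh, he.symm⟩), hC0]
  have hint : ∀ a b : ℝ, ∫ t in Ioc a b, g' t = if a ≤ b then g b - g a else 0 := by
    intro a b
    split_ifs with hab
    · rw [← intervalIntegral.integral_of_le hab]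
      exact intervalIntegral.integral_eq_sub_of_hasDerivAt (fun t _ => hg t)
        (hg'.intervalIntegrable _ _)
    · rw [Ioc_eq_empty (by simpa using le_of_lt (not_le.1 hab))]; simp
  have hintg : ∀ a b : ℝ, IntegrableOn g' (Ioc a b) := fun a b =>
    (hg'.integrableOn_Icc (a := a) (b := b)).mono_set Ioc_subset_Icc_self
  calc ∫ t in U, g' t = ∫ t in Ioc (-R) R, U.indicator (fun _ => (1 : ℝ)) t * g' t := by
        have : ∀ t, U.indicator (fun _ => (1 : ℝ)) t * g' t = U.indicator g' t := by
          intro t; by_cases ht : t ∈ U <;> simp [ht]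
        simp only [this]
        rw [setIntegral_indicator hUm, inter_eq_self_of_subset_right]
        exact fun t ht => ⟨(hUR t ht).1, (hUR t ht).2.le⟩
    _ = ∫ t in Ioc (-R) R, ∑ h ∈ s, -J h * (Ioi (τ h)).indicator g' t := by
        refine integral_congr_ae ?_
        filter_upwards [ae_restrict_of_ae hae] with t ht
        have h1 : U.indicator (fun _ => (1 : ℝ)) t
            = -∑ h ∈ s, J h * (Ioi (τ h)).indicator (fun _ => (1 : ℝ)) t := by
          simp only [hD] at ht; linarith
        rw [h1, neg_mul, Finset.sum_mul, ← Finset.sum_neg_distrib]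
        refine Finset.sum_congr rfl fun h _ => ?_
        by_cases hth : t ∈ Ioi (τ h)
        · simp only [indicator_of_mem hth]; ring
        · simp only [indicator_of_notMem hth]; ring
    _ = ∑ h ∈ s, -J h * (g R - g (τ h)) := by
        rw [integral_finsetSum _ fun h _ =>
          ((hintg _ _).indicator measurableSet_Ioi).const_mul _]
        refine Finset.sum_congr rfl fun h hh => ?_
        rw [integral_const_mul, setIntegral_indicator measurableSet_Ioi]
        have : Ioc (-R) R ∩ Ioi (τ h) = Ioc (τ h) R := by
          ext t; simp only [mem_inter_iff, mem_Ioc, mem_Ioi]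
          have := hτR h hh
          constructor
          · rintro ⟨⟨_, h1⟩, h2⟩; exact ⟨h2, h1⟩
          · rintro ⟨h1, h2⟩; exact ⟨⟨this.1.trans h1, h2⟩, h1⟩
        rw [this, hint, if_pos (hτR h hh).2.le]
    _ = ∑ h ∈ s, J h * g (τ h) := by
        have : ∀ h ∈ s, -J h * (g R - g (τ h)) = J h * g (τ h) - J h * g R := fun h _ => by ring
        rw [Finset.sum_congr rfl this, Finset.sum_sub_distrib, ← Finset.sum_mul, hDR]
        ring

/-! ### Hyperplanes as graphs over coordinate hyperplanes -/

/-- The hyperplane `⟪h.1, x⟫ = h.2`. -/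
def plane {d : ℕ} (h : Space d × ℝ) : Set (Space d) := {x | ⟪h.1, x⟫ = h.2}

/-- The point with `i`-th coordinate `t` and remaining coordinates `y`. -/
noncomputable def insCoord {m : ℕ} (i : Fin (m + 1)) (t : ℝ) (y : Fin m → ℝ) : Space (m + 1) :=
  WithLp.toLp 2 (i.insertNth t y)

/-- The `i`-th coordinate of the point of the hyperplane `h` over `y`. It is meaningful only if
`h.1 i ≠ 0`. -/
noncomputable def height {m : ℕ} (i : Fin (m + 1)) (h : Space (m + 1) × ℝ) (y : Fin m → ℝ) : ℝ :=
  (h.2 - ∑ j, h.1 (i.succAbove j) * y j) / h.1 i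

/-- The parametrisation of the hyperplane `h` by the coordinates other than the `i`-th. -/
noncomputable def graphMap {m : ℕ} (i : Fin (m + 1)) (h : Space (m + 1) × ℝ) (y : Fin m → ℝ) :
    Space (m + 1) := insCoord i (height i h y) y

section Graph

variable {m : ℕ} (i : Fin (m + 1))

theorem isClosed_plane {d : ℕ} (h : Space d × ℝ) : IsClosed (plane h) :=
  isClosed_eq (by fun_prop) continuous_const

theorem measurableSet_plane {d : ℕ} (h : Space d × ℝ) : MeasurableSet (plane h) :=
  (isClosed_plane h).measurableSet

@[simp] theorem insCoord_same (t : ℝ) (y : Fin m → ℝ) : insCoord i t y i = t := by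
  simp [insCoord]

@[simp] theorem insCoord_succAbove (t : ℝ) (y : Fin m → ℝ) (j : Fin m) :
    insCoord i t y (i.succAbove j) = y j := by
  simp [insCoord]

theorem inner_eq_sum_succAbove (a x : Space (m + 1)) :
    ⟪a, x⟫ = a i * x i + ∑ j, a (i.succAbove j) * x (i.succAbove j) := by
  rw [PiLp.inner_apply, Fin.sum_univ_succAbove _ i]
  simp [mul_comm]

theorem inner_insCoord (a : Space (m + 1)) (t : ℝ) (y : Fin m → ℝ) :
    ⟪a, insCoord i t y⟫ = a i * t + ∑ j, a (i.succAbove j) * y j := by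
  simp [inner_eq_sum_succAbove i]

theorem insCoord_eta (x : Space (m + 1)) : insCoord i (x i) (fun j => x (i.succAbove j)) = x := by
  ext k
  rcases Fin.eq_self_or_eq_succAbove i k with rfl | ⟨j, rfl⟩ <;> simp

theorem continuous_insCoord : Continuous fun q : ℝ × (Fin m → ℝ) => insCoord i q.1 q.2 := by
  refine (PiLp.continuous_toLp 2 _).comp ?_
  exact Continuous.finInsertNth i continuous_fst continuous_snd

theorem continuous_height (h : Space (m + 1) × ℝ) : Continuous (height i h) := by
  unfold height; fun_prop

theorem continuous_graphMap (h : Space (m + 1) × ℝ) : Continuous (graphMap i h) :=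
  (continuous_insCoord i).comp ((continuous_height i h).prodMk continuous_id)

theorem insCoord_mem_plane_iff {h : Space (m + 1) × ℝ} (hi : h.1 i ≠ 0) (t : ℝ) (y : Fin m → ℝ) :
    insCoord i t y ∈ plane h ↔ t = height i h y := by
  simp only [plane, mem_ofPred_eq, inner_insCoord, height]
  rw [eq_div_iff hi, eq_sub_iff_add_eq, mul_comm]

theorem graphMap_mem_plane {h : Space (m + 1) × ℝ} (hi : h.1 i ≠ 0) (y : Fin m → ℝ) :
    graphMap i h y ∈ plane h := (insCoord_mem_plane_iff i hi _ _).2 rfl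

theorem graphMap_of_mem_plane {h : Space (m + 1) × ℝ} (hi : h.1 i ≠ 0) {x : Space (m + 1)}
    (hx : x ∈ plane h) : graphMap i h (fun j => x (i.succAbove j)) = x := by
  have h1 : x i = height i h (fun j => x (i.succAbove j)) := by
    rw [← insCoord_mem_plane_iff i hi, insCoord_eta]; exact hx
  rw [graphMap, ← h1, insCoord_eta]

/-- The linear part of `graphMap`. -/
noncomputable def graphLin (a : Space (m + 1)) : EuclideanSpace ℝ (Fin m) →ₗ[ℝ] Space (m + 1) where
  toFun y := graphMap i (a, 0) y
  map_add' x y := by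
    ext k
    rcases Fin.eq_self_or_eq_succAbove i k with rfl | ⟨j, rfl⟩
    · simp [graphMap, height, mul_add, Finset.sum_add_distrib]; ring
    · simp [graphMap]
  map_smul' c x := by
    ext k
    rcases Fin.eq_self_or_eq_succAbove i k with rfl | ⟨j, rfl⟩
    · simp only [graphMap, insCoord_same, height, PiLp.smul_apply, smul_eq_mul, RingHom.id_apply,
        mul_left_comm _ c, ← Finset.mul_sum]
      ring
    · simp [graphMap]

/-- The Gram matrix of the graph map is the identity plus a rank one matrix. -/
theorem normDet_graphLin {a : Space (m + 1)} (hi : a i ≠ 0) :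
    (graphLin i a).normDet = ‖a‖ / |a i| := by
  have h1 := (graphLin i a).normDet_sq_eq_det_gram (EuclideanSpace.basisFun (Fin m) ℝ)
  set c : Fin m → ℝ := fun j => -(a (i.succAbove j) / a i) with hc
  have h2 : Matrix.gram ℝ (fun j => graphLin i a (EuclideanSpace.basisFun (Fin m) ℝ j))
      = 1 + Matrix.replicateCol Unit c * Matrix.replicateRow Unit c := by
    ext j k
    have h3 : ∀ j, graphLin i a (EuclideanSpace.basisFun (Fin m) ℝ j)
        = insCoord i (c j) (Pi.single j 1) := by
      intro j
      show graphMap i (a, 0) _ = _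
      have : ((EuclideanSpace.basisFun (Fin m) ℝ j : EuclideanSpace ℝ (Fin m)) : Fin m → ℝ)
          = Pi.single j 1 := by ext; simp [Pi.single_apply]
      rw [this, graphMap]
      congr 1
      simp [height, hc, Pi.single_apply, neg_div]
    rw [Matrix.gram_apply, h3, h3, inner_insCoord]
    simp [Matrix.mul_apply, Matrix.one_apply, Pi.single_apply, add_comm, eq_comm]
  rw [h2, Matrix.det_one_add_mul_comm] at h1
  have h4 : (1 + Matrix.replicateRow Unit c * Matrix.replicateCol Unit c).det
      = (‖a‖ / |a i|) ^ 2 := by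
    simp only [Matrix.det_unique, Matrix.add_apply, Matrix.one_apply_eq, Matrix.mul_apply,
      Matrix.replicateRow_apply, Matrix.replicateCol_apply]
    rw [div_pow, sq_abs, ← real_inner_self_eq_norm_sq, inner_eq_sum_succAbove i, add_div,
      Finset.sum_div]
    congr 1
    · field_simp
    · refine Finset.sum_congr rfl fun j _ => ?_
      simp only [hc]; field_simp
  rw [h4] at h1
  exact (sq_eq_sq₀ (LinearMap.normDet_nonneg _) (by positivity)).1 (by exact_mod_cast h1)

/-- **Area formula for a hyperplane**: the surface measure on a hyperplane with normal `a` is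
`|a| / |aᵢ|` times the Lebesgue measure in the coordinates other than the `i`-th. -/
theorem restrict_plane_eq_map {h : Space (m + 1) × ℝ} (hi : h.1 i ≠ 0) :
    (μHE[m] : Measure (Space (m + 1))).restrict (plane h)
      = ENNReal.ofReal (‖h.1‖ / |h.1 i|) • (volume : Measure (Fin m → ℝ)).map (graphMap i h) := by
  ext s hs
  rw [Measure.restrict_apply hs, Measure.smul_apply,
    Measure.map_apply (continuous_graphMap i h).measurable hs]
  set p : Space (m + 1) := insCoord i (h.2 / h.1 i) 0 with hp
  have hG : ∀ y : EuclideanSpace ℝ (Fin m), graphMap i h y = p + graphLin i h.1 y := by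
    intro y
    ext k
    show _ = _ + graphMap i (h.1, 0) y k
    rcases Fin.eq_self_or_eq_succAbove i k with rfl | ⟨j, rfl⟩
    · simp [graphMap, height, hp]; ring
    · simp [graphMap, hp]
  have himg : s ∩ plane h = (fun x => p + x) '' (graphLin i h.1 ''
      (WithLp.ofLp ⁻¹' (graphMap i h ⁻¹' s))) := by
    ext x
    simp only [mem_inter_iff, mem_image, mem_preimage, exists_exists_and_eq_and, ← hG]
    constructor
    · rintro ⟨hx, hxp⟩
      refine ⟨WithLp.toLp 2 (fun j => x (i.succAbove j)), ?_, ?_⟩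
      · simpa [graphMap_of_mem_plane i hi hxp] using hx
      · exact graphMap_of_mem_plane i hi hxp
    · rintro ⟨y, hy, rfl⟩
      exact ⟨hy, graphMap_mem_plane i hi _⟩
  have hadd : Isometry (fun x : Space (m + 1) => p + x) := isometry_add_left p
  rw [himg, hadd.euclideanHausdorffMeasure_image]
  have h1 := (graphLin i h.1).euclideanHausdorffMeasure_image_eq_normDet_mul_volume
    (WithLp.ofLp ⁻¹' (graphMap i h ⁻¹' s))
  rw [finrank_euclideanSpace_fin] at h1
  rw [h1, normDet_graphLin i hi, smul_eq_mul,
    (PiLp.volume_preserving_ofLp (Fin m)).measure_preimage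
      ((continuous_graphMap i h).measurable hs).nullMeasurableSet]

/-- A non-constant affine function vanishes only on a null set. -/
theorem volume_affine_zero {a : Fin m → ℝ} {c : ℝ} (h : ∃ y : Fin m → ℝ, ∑ j, a j * y j ≠ c) :
    volume {y : Fin m → ℝ | ∑ j, a j * y j = c} = 0 := by
  obtain ⟨y₀, hy₀⟩ := h
  by_cases hne : ∃ p : Fin m → ℝ, ∑ j, a j * p j = c
  · obtain ⟨p, hp⟩ := hne
    let φ : (Fin m → ℝ) →ₗ[ℝ] ℝ := Fintype.linearCombination ℝ a
    have hφ : ∀ y, φ y = ∑ j, a j * y j := fun y => by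
      simp [φ, Fintype.linearCombination_apply, mul_comm]
    have h1 := Measure.addHaar_affineSubspace (volume : Measure (Fin m → ℝ))
      (AffineSubspace.mk' p (LinearMap.ker φ)) (fun htop => hy₀ <| by
        have : y₀ ∈ AffineSubspace.mk' p (LinearMap.ker φ) := by rw [htop]; trivial
        rw [AffineSubspace.mem_mk', LinearMap.mem_ker, vsub_eq_sub, map_sub, hφ, hφ, hp] at this
        linarith)
    refine measure_mono_null (fun y hy => ?_) h1
    show y ∈ AffineSubspace.mk' p (LinearMap.ker φ)
    rw [AffineSubspace.mem_mk', LinearMap.mem_ker, vsub_eq_sub, map_sub, hφ, hφ, hp]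
    rw [mem_ofPred_eq] at hy
    rw [hy, sub_self]
  · push Not at hne
    rw [show {y : Fin m → ℝ | ∑ j, a j * y j = c} = ∅ from eq_empty_of_forall_notMem hne,
      measure_empty]

/-- A hyperplane contained in another one coincides with it. -/
theorem plane_eq_of_subset {h k : Space (m + 1) × ℝ} (hh : h.1 ≠ 0) (hk : k.1 ≠ 0)
    (hsub : plane h ⊆ plane k) : plane h = plane k := by
  have hpos : ⟪h.1, h.1⟫ ≠ 0 := by simpa using hh
  set x₀ : Space (m + 1) := (h.2 / ⟪h.1, h.1⟫) • h.1 with hx₀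
  have hx₀h : x₀ ∈ plane h := by
    simp only [plane, mem_ofPred_eq, hx₀, inner_smul_right]; field_simp
  have hx₀k : ⟪k.1, x₀⟫ = k.2 := hsub hx₀h
  have hort : ∀ v, ⟪h.1, v⟫ = 0 → ⟪k.1, v⟫ = 0 := by
    intro v hv
    have h1 : x₀ + v ∈ plane h := by
      show ⟪h.1, x₀ + v⟫ = h.2
      rw [inner_add_right, hv, add_zero]; exact hx₀h
    have h2 : ⟪k.1, x₀ + v⟫ = k.2 := hsub h1
    rw [inner_add_right, hx₀k] at h2
    linarith
  set lam : ℝ := ⟪h.1, k.1⟫ / ⟪h.1, h.1⟫ with hlam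
  have hkl : k.1 = lam • h.1 := by
    have h1 : ⟪h.1, k.1 - lam • h.1⟫ = 0 := by
      rw [inner_sub_right, inner_smul_right, hlam]; field_simp; ring
    have h2 := hort _ h1
    have h3 : ⟪k.1 - lam • h.1, k.1 - lam • h.1⟫ = 0 := by
      rw [inner_sub_left, inner_smul_left, h1, h2]; simp
    exact sub_eq_zero.1 (inner_self_eq_zero.1 h3)
  have hl0 : lam ≠ 0 := fun h0 => hk (by rw [hkl, h0, zero_smul])
  refine hsub.antisymm fun x hx => ?_
  have h1 : ⟪k.1, x⟫ = k.2 := hx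
  rw [← hx₀k, hkl, inner_smul_left, inner_smul_left] at h1
  have h2 : ⟪h.1, x⟫ = ⟪h.1, x₀⟫ := mul_left_cancel₀ (by simpa using hl0) h1
  show ⟪h.1, x⟫ = h.2
  rw [h2]; exact hx₀h

/-- The points over which a hyperplane transversal to the `i`-th direction meets a different
hyperplane form a null set. -/
theorem volume_graphMap_mem_plane {h k : Space (m + 1) × ℝ} (hi : h.1 i ≠ 0) (hk : k.1 ≠ 0)
    (hne : plane h ≠ plane k) : volume {y : Fin m → ℝ | graphMap i h y ∈ plane k} = 0 := by
  have hh : h.1 ≠ 0 := fun h0 => hi (by simp [h0])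
  have h1 : ∀ y, graphMap i h y ∈ plane k ↔
      ∑ j, (k.1 (i.succAbove j) - k.1 i * h.1 (i.succAbove j) / h.1 i) * y j
        = k.2 - k.1 i * h.2 / h.1 i := by
    intro y
    have : ∑ j, (k.1 (i.succAbove j) - k.1 i * h.1 (i.succAbove j) / h.1 i) * y j
        = ∑ j, k.1 (i.succAbove j) * y j
          - k.1 i / h.1 i * ∑ j, h.1 (i.succAbove j) * y j := by
      rw [Finset.mul_sum, ← Finset.sum_sub_distrib]
      exact Finset.sum_congr rfl fun j _ => by ring
    rw [this]
    simp only [plane, mem_ofPred_eq, graphMap, inner_insCoord, height]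
    constructor <;> intro H
    · rw [← H]; ring
    · linear_combination H
  simp only [h1]
  refine volume_affine_zero ?_
  by_contra! hall
  refine hne (plane_eq_of_subset hh hk fun x hx => ?_)
  rw [← graphMap_of_mem_plane i hi hx, h1]
  exact hall _

theorem exists_coord_ne_zero {d : ℕ} {a : Space d} (ha : a ≠ 0) : ∃ i, a i ≠ 0 := by
  by_contra! h
  exact ha (by ext i; simpa using h i)

/-- Distinct hyperplanes meet in a set of vanishing surface measure. -/
theorem measure_plane_inter_plane {h k : Space (m + 1) × ℝ} (hh : h.1 ≠ 0) (hk : k.1 ≠ 0)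
    (hne : plane h ≠ plane k) :
    (μHE[m] : Measure (Space (m + 1))) (plane h ∩ plane k) = 0 := by
  obtain ⟨i, hi⟩ := exists_coord_ne_zero hh
  rw [inter_comm, ← Measure.restrict_apply (measurableSet_plane k), restrict_plane_eq_map i hi,
    Measure.smul_apply, Measure.map_apply (continuous_graphMap i h).measurable
    (measurableSet_plane k)]
  have := volume_graphMap_mem_plane i hi hk hne
  rw [show graphMap i h ⁻¹' plane k = {y | graphMap i h y ∈ plane k} from rfl, this, smul_zero]

/-- Bounded pieces of hyperplanes have finite surface measure. -/
theorem measure_plane_inter_lt_top {h : Space (m + 1) × ℝ} (hh : h.1 ≠ 0)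
    {B : Set (Space (m + 1))} (hB : Bornology.IsBounded B) :
    (μHE[m] : Measure (Space (m + 1))) (B ∩ plane h) < ⊤ := by
  obtain ⟨i, hi⟩ := exists_coord_ne_zero hh
  obtain ⟨R, hR⟩ := hB.subset_closedBall 0
  refine (measure_mono (inter_subset_inter_left _ hR)).trans_lt ?_
  rw [← Measure.restrict_apply Metric.isClosed_closedBall.measurableSet,
    restrict_plane_eq_map i hi, Measure.smul_apply, smul_eq_mul,
    Measure.map_apply (continuous_graphMap i h).measurable
      Metric.isClosed_closedBall.measurableSet]
  refine ENNReal.mul_lt_top ENNReal.ofReal_lt_top ?_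
  refine (measure_mono (t := Metric.closedBall 0 R) fun y hy => ?_).trans_lt measure_closedBall_lt_top
  rw [mem_preimage, mem_closedBall_zero_iff] at hy
  rw [mem_closedBall_zero_iff]
  refine (pi_norm_le_iff_of_nonneg ((norm_nonneg _).trans hy)).2 fun j => ?_
  have := PiLp.norm_apply_le (graphMap i h y) (i.succAbove j)
  simp only [graphMap, insCoord_succAbove] at this
  exact this.trans hy

end Graph

/-! ### Faces and normals -/

section Faces

variable {d : ℕ} {K : Set (Space d)} {x n : Space d}

theorem IsOutwardNormal.unique {n' : Space d} (h : IsOutwardNormal K x n)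
    (h' : IsOutwardNormal K x n') : n = n' := by
  by_contra hne
  have hlt : ⟪n, n'⟫ < 1 := (inner_lt_one_iff_real_of_norm_eq_one h.1 h'.1).2 hne
  have h1 : ∀ᶠ y in 𝓝 x, (⟪n, y - x⟫ < 0 ↔ ⟪n', y - x⟫ < 0) := by
    filter_upwards [h.2, h'.2] with y h1 h2
    rw [← h1, h2]
  have hc : Filter.Tendsto (fun ε : ℝ => x + ε • (n' - n)) (𝓝[>] 0) (𝓝 x) := by
    have : Continuous fun ε : ℝ => x + ε • (n' - n) := by fun_prop
    simpa using (this.tendsto 0).mono_left nhdsWithin_le_nhds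
  obtain ⟨ε, h2, hε⟩ := ((hc.eventually h1).and self_mem_nhdsWithin).exists
  have hε : 0 < ε := hε
  simp only [add_sub_cancel_left, inner_smul_right, inner_sub_right,
    real_inner_self_eq_norm_sq, h.1, h'.1] at h2
  rw [real_inner_comm n n'] at h2
  have h3 := h2.1 (by nlinarith)
  nlinarith

theorem normal_eq (h : IsOutwardNormal K x n) : normal K x = n := by
  have hex : ∃ n, IsOutwardNormal K x n := ⟨n, h⟩
  rw [normal, dif_pos hex]
  exact hex.choose_spec.unique h

theorem isOutwardNormal_normal (h : x ∈ faces K) : IsOutwardNormal K x (normal K x) := by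
  obtain ⟨n, hn⟩ := h
  rwa [normal_eq hn]

theorem normal_of_notMem_faces (h : x ∉ faces K) : normal K x = 0 := dif_neg h

theorem norm_normal_le_one (K : Set (Space d)) (x : Space d) : ‖normal K x‖ ≤ 1 := by
  by_cases h : x ∈ faces K
  · exact (isOutwardNormal_normal h).1.le
  · simp [normal_of_notMem_faces h]

theorem IsOutwardNormal.notMem (h : IsOutwardNormal K x n) : x ∉ K := by
  have := h.2.self_of_nhds
  simpa using this

theorem IsOutwardNormal.mem_closure (h : IsOutwardNormal K x n) : x ∈ closure K := by
  have hc : Filter.Tendsto (fun ε : ℝ => x - ε • n) (𝓝[>] 0) (𝓝 x) := by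
    have : Continuous fun ε : ℝ => x - ε • n := by fun_prop
    simpa using (this.tendsto 0).mono_left nhdsWithin_le_nhds
  refine mem_closure_of_tendsto hc ?_
  filter_upwards [hc.eventually h.2, self_mem_nhdsWithin] with ε h1 hε
  rw [h1]
  simp only [sub_sub_cancel_left, inner_neg_right, inner_smul_right, real_inner_self_eq_norm_sq,
    h.1]
  have hε : 0 < ε := hε
  linarith

theorem faces_subset_frontier (hK : IsOpen K) : faces K ⊆ frontier K := by
  rintro x ⟨n, hn⟩
  rw [hK.frontier_eq]
  exact ⟨hn.mem_closure, hn.notMem⟩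

/-- The frontier points near a face point belong to the face and have the same normal. -/
theorem IsOutwardNormal.eventually_frontier (hK : IsOpen K) (h : IsOutwardNormal K x n) :
    ∀ᶠ y in 𝓝 x, y ∈ frontier K → IsOutwardNormal K y n := by
  filter_upwards [h.2.eventually_nhds] with y hy hyf
  rw [hK.frontier_eq] at hyf
  have h1 : ¬ ⟪n, y - x⟫ < 0 := by
    rw [← hy.self_of_nhds]; exact hyf.2
  have h2 : ⟪n, y - x⟫ ≤ 0 := by
    by_contra! h2
    have hev : ∀ᶠ w in 𝓝 y, 0 < ⟪n, w - x⟫ :=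
      (by fun_prop : Continuous fun w => ⟪n, w - x⟫).continuousAt.eventually (lt_mem_nhds h2)
    obtain ⟨w, hw, hw1, hw2⟩ :=
      ((mem_closure_iff_frequently.1 hyf.1).and_eventually (hy.and hev)).exists
    exact absurd (hw1.1 hw) (not_lt.2 hw2.le)
  have h3 : ⟪n, y - x⟫ = 0 := le_antisymm h2 (not_lt.1 h1)
  refine ⟨h.1, ?_⟩
  filter_upwards [hy] with w hw
  rw [hw, show w - y = (w - x) - (y - x) by abel, inner_sub_right n (w - x), h3, sub_zero]

theorem continuousOn_normal (hK : IsOpen K) : ContinuousOn (normal K) (faces K) := by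
  intro x hx
  have h := isOutwardNormal_normal hx
  refine (continuousWithinAt_const (b := normal K x)).congr_of_eventuallyEq ?_ rfl
  filter_upwards [(h.eventually_frontier hK).filter_mono nhdsWithin_le_nhds,
    self_mem_nhdsWithin] with y hy hyf
  exact normal_eq (hy (faces_subset_frontier hK hyf))

theorem measurableSet_faces (hK : IsOpen K) : MeasurableSet (faces K) := by
  have h1 : faces K = {x | ∀ᶠ y in 𝓝 x, y ∈ frontier K → y ∈ faces K} ∩ frontier K := by
    ext x
    constructor
    · intro hx
      refine ⟨?_, faces_subset_frontier hK hx⟩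
      exact ((isOutwardNormal_normal hx).eventually_frontier hK).mono fun y hy hyf =>
        ⟨_, hy hyf⟩
    · rintro ⟨h1, h2⟩
      exact Filter.Eventually.self_of_nhds (p := fun y => y ∈ frontier K → y ∈ faces K) h1 h2
  rw [h1]
  refine (IsOpen.measurableSet ?_).inter isClosed_frontier.measurableSet
  exact isOpen_setOfPred_eventually_nhds

theorem measurable_normal (hK : IsOpen K) : Measurable (normal K) := by
  classical
  have h1 : normal K = (faces K).piecewise (normal K) (fun _ => 0) := by
    ext1 x
    by_cases hx : x ∈ faces K <;> simp [hx, normal_of_notMem_faces]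
  rw [h1]
  exact (continuousOn_normal hK).measurable_piecewise continuousOn_const (measurableSet_faces hK)

/-- Away from the frontier, membership is locally constant. -/
theorem eventually_mem_iff_of_notMem_frontier (hx : x ∉ frontier K) :
    ∀ᶠ y in 𝓝 x, (y ∈ K ↔ x ∈ K) := by
  by_cases h : x ∈ closure K
  · have h1 : x ∈ interior K := by
      by_contra h2; exact hx ⟨h, h2⟩
    filter_upwards [isOpen_interior.mem_nhds h1] with y hy
    exact iff_of_true (interior_subset hy) (interior_subset h1)
  · filter_upwards [isClosed_closure.isOpen_compl.mem_nhds h] with y hy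
    exact iff_of_false (fun h2 => hy (subset_closure h2)) (fun h2 => h (subset_closure h2))

/-- **Local structure of a polytope.** Near a point at which the frontier is contained in a single
hyperplane with normal `a`, a regular open set is empty, full, or a half-space. -/
theorem local_structure (hK : IsOpen K) (hreg : interior (closure K) = K) {a : Space d}
    (ha : a ≠ 0) (hfr : ∀ᶠ y in 𝓝 x, y ∈ frontier K → ⟪a, y - x⟫ = 0) :
    (∀ᶠ y in 𝓝 x, y ∉ K) ∨ (∀ᶠ y in 𝓝 x, y ∈ K) ∨ IsOutwardNormal K x (‖a‖⁻¹ • a) ∨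
      IsOutwardNormal K x (-(‖a‖⁻¹ • a)) := by
  obtain ⟨ε, hε, hball⟩ := Metric.eventually_nhds_iff_ball.1 hfr
  have hapos : 0 < ‖a‖ := norm_pos_iff.2 ha
  have hconst : ∀ s : Set (Space d), Convex ℝ s → s ⊆ Metric.ball x ε →
      (∀ y ∈ s, ⟪a, y - x⟫ ≠ 0) → s ⊆ K ∨ s ⊆ Kᶜ := by
    intro s hs hsb hs0
    have hsub : s ⊆ K ∪ (closure K)ᶜ := by
      intro y hy
      by_contra! hcon
      rw [mem_union, mem_compl_iff, not_or, not_not] at hcon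
      exact hs0 y hy (hball y (hsb hy) (by rw [hK.frontier_eq]; exact ⟨hcon.2, hcon.1⟩))
    exact (hs.isPreconnected.subset_or_subset hK isClosed_closure.isOpen_compl
      (disjoint_compl_right.mono_left subset_closure) hsub).imp id
      fun h => h.trans (compl_subset_compl.2 subset_closure)
  have hlin : IsLinearMap ℝ (fun y : Space d => ⟪a, y⟫) :=
    ⟨fun _ _ => inner_add_right _ _ _, fun _ _ => inner_smul_right _ _ _⟩
  have hneg := hconst (Metric.ball x ε ∩ {y | ⟪a, y⟫ < ⟪a, x⟫})
    ((convex_ball x ε).inter (convex_halfSpace_lt hlin _)) inter_subset_left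
    (fun y hy => by rw [inner_sub_right]; exact (sub_neg.2 hy.2).ne)
  have hpos := hconst (Metric.ball x ε ∩ {y | ⟪a, x⟫ < ⟪a, y⟫})
    ((convex_ball x ε).inter (convex_halfSpace_gt hlin _)) inter_subset_left
    (fun y hy => by rw [inner_sub_right]; exact (sub_pos.2 hy.2).ne')
  have hmem : ∀ᶠ y in 𝓝 x, y ∈ Metric.ball x ε := Metric.ball_mem_nhds x hε
  -- Points of the hyperplane are limits of points on either side.
  have hlim : ∀ (y : Space d) (s : ℝ),
      Filter.Tendsto (fun t : ℝ => y + (t * s) • a) (𝓝[>] 0) (𝓝 y) := by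
    intro y s
    have : Continuous fun t : ℝ => y + (t * s) • a := by fun_prop
    simpa using (this.tendsto 0).mono_left nhdsWithin_le_nhds
  have hinn : ∀ (y : Space d) (t s : ℝ), ⟪a, y + (t * s) • a⟫ = ⟪a, y⟫ + t * s * ‖a‖ ^ 2 := by
    intro y t s
    rw [inner_add_right, inner_smul_right, real_inner_self_eq_norm_sq]
  have hplane : (∀ y ∈ Metric.ball x ε, ⟪a, y⟫ < ⟪a, x⟫ → y ∉ K) ∨
      (∀ y ∈ Metric.ball x ε, ⟪a, x⟫ < ⟪a, y⟫ → y ∉ K) →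
      ∀ y ∈ Metric.ball x ε, ⟪a, y⟫ = ⟪a, x⟫ → y ∉ K := by
    rintro hside y hy hya hyK
    rcases hside with hside | hside
    · obtain ⟨t, ⟨h1, h2⟩, ht⟩ := (((hlim y (-1)).eventually
        (Filter.Eventually.and (hK.mem_nhds hyK) (Metric.isOpen_ball.mem_nhds hy))).and
        self_mem_nhdsWithin).exists
      have ht : 0 < t := ht
      refine hside _ h2 ?_ h1
      rw [hinn, hya]; nlinarith [pow_pos hapos 2, mul_pos ht (pow_pos hapos 2)]
    · obtain ⟨t, ⟨h1, h2⟩, ht⟩ := (((hlim y 1).eventually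
        (Filter.Eventually.and (hK.mem_nhds hyK) (Metric.isOpen_ball.mem_nhds hy))).and
        self_mem_nhdsWithin).exists
      have ht : 0 < t := ht
      refine hside _ h2 ?_ h1
      rw [hinn, hya]; nlinarith [pow_pos hapos 2, mul_pos ht (pow_pos hapos 2)]
  have hunit : ‖‖a‖⁻¹ • a‖ = 1 := by
    rw [norm_smul, norm_inv, norm_norm, inv_mul_cancel₀ hapos.ne']
  rcases hneg with hneg | hneg <;> rcases hpos with hpos | hpos
  · right; left
    have hcl : Metric.ball x ε ⊆ closure K := by
      intro y hy
      rcases lt_trichotomy ⟪a, y⟫ ⟪a, x⟫ with h | h | h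
      · exact subset_closure (hneg ⟨hy, h⟩)
      · refine mem_closure_of_tendsto (hlim y 1) ?_
        filter_upwards [(hlim y 1).eventually (Metric.isOpen_ball.mem_nhds hy),
          self_mem_nhdsWithin] with t h1 ht
        have ht : 0 < t := ht
        refine hpos ⟨h1, ?_⟩
        rw [mem_ofPred_eq, hinn, h]; nlinarith [mul_pos ht (pow_pos hapos 2)]
      · exact subset_closure (hpos ⟨hy, h⟩)
    filter_upwards [hmem] with y hy
    rw [← hreg]
    exact interior_maximal hcl Metric.isOpen_ball hy
  · right; right; left
    refine ⟨hunit, ?_⟩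
    filter_upwards [hmem] with y hy
    rw [inner_smul_left, inner_sub_right, map_inv₀, RCLike.conj_to_real,
      ← smul_eq_mul, smul_neg_iff_of_pos_left (inv_pos.2 hapos), sub_neg]
    refine ⟨fun hyK => ?_, fun h => hneg ⟨hy, h⟩⟩
    by_contra! h
    rcases h.eq_or_lt with h | h
    · exact hplane (Or.inr fun y hy h => hpos ⟨hy, h⟩) y hy h.symm hyK
    · exact hpos ⟨hy, h⟩ hyK
  · right; right; right
    refine ⟨by rw [norm_neg, hunit], ?_⟩
    filter_upwards [hmem] with y hy
    rw [inner_neg_left, inner_smul_left, inner_sub_right, map_inv₀, RCLike.conj_to_real,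
      neg_lt_zero, mul_pos_iff_of_pos_left (inv_pos.2 hapos), sub_pos]
    refine ⟨fun hyK => ?_, fun h => hpos ⟨hy, h⟩⟩
    by_contra! h
    rcases h.eq_or_lt with h | h
    · exact hplane (Or.inl fun y hy h => hneg ⟨hy, h⟩) y hy h hyK
    · exact hneg ⟨hy, h⟩ hyK
  · left
    filter_upwards [hmem] with y hy
    rcases lt_trichotomy ⟪a, y⟫ ⟪a, x⟫ with h | h | h
    · exact hneg ⟨hy, h⟩
    · exact hplane (Or.inl fun y hy h => hneg ⟨hy, h⟩) y hy h
    · exact hpos ⟨hy, h⟩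

end Faces

/-! ### The divergence theorem on a polytope -/

section Divergence

variable {m : ℕ}

theorem measurePreserving_insCoord (i : Fin (m + 1)) :
    MeasurePreserving (fun q : ℝ × (Fin m → ℝ) => insCoord i q.1 q.2) (volume.prod volume) volume :=
  (PiLp.volume_preserving_toLp (Fin (m + 1))).comp
    ((volume_preserving_piFinSuccAbove (fun _ : Fin (m + 1) => ℝ) i).symm _)

theorem measurableEmbedding_insCoord (i : Fin (m + 1)) :
    MeasurableEmbedding (fun q : ℝ × (Fin m → ℝ) => insCoord i q.1 q.2) :=
  (MeasurableEquiv.toLp 2 (Fin (m + 1) → ℝ)).measurableEmbedding.comp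
    (MeasurableEquiv.piFinSuccAbove (fun _ : Fin (m + 1) => ℝ) i).symm.measurableEmbedding

theorem hasDerivAt_insCoord (i : Fin (m + 1)) (y : Fin m → ℝ) (t : ℝ) :
    HasDerivAt (fun t => insCoord i t y) (EuclideanSpace.single i 1) t := by
  have h : (fun t => insCoord i t y)
      = fun t => insCoord i 0 y + t • (EuclideanSpace.single i (1 : ℝ) : Space (m + 1)) := by
    ext t k
    rcases Fin.eq_self_or_eq_succAbove i k with rfl | ⟨j, rfl⟩ <;> simp
  rw [h]
  simpa using ((hasDerivAt_id t).smul_const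
    (EuclideanSpace.single i (1 : ℝ) : Space (m + 1))).const_add (insCoord i 0 y)

theorem insCoord_sub (i : Fin (m + 1)) (y : Fin m → ℝ) (t u : ℝ) (a : Space (m + 1)) :
    ⟪a, insCoord i t y - insCoord i u y⟫ = a i * (t - u) := by
  rw [inner_sub_right, inner_insCoord, inner_insCoord]; ring

variable {K : Set (Space (m + 1))} {H : Finset (Space (m + 1) × ℝ)}

/-- Near a point at which the frontier of `K` lies in the single hyperplane `h`, the indicator of
`K` on the line in direction `i` is constant on either side of the hyperplane, and its drop is the
`i`-th component of the normal times the area factor `‖h.1‖ / |h.1 i|` of the graph map. Both are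
`0` if the point belongs to no face, the junk value of `normal` being the right one. -/
theorem exists_jump (hK : IsOpen K) (hreg : interior (closure K) = K) (i : Fin (m + 1))
    {h : Space (m + 1) × ℝ} (hi : h.1 i ≠ 0) (y : Fin m → ℝ)
    (hfr : ∀ᶠ x in 𝓝 (graphMap i h y), x ∈ frontier K → x ∈ plane h) :
    ∃ l r : ℝ, ‖h.1‖ / |h.1 i| * normal K (graphMap i h y) i = l - r ∧
      (∀ᶠ u in 𝓝[<] height i h y,
        {t | insCoord i t y ∈ K}.indicator (fun _ => (1 : ℝ)) u = l) ∧
      ∀ᶠ u in 𝓝[>] height i h y,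
        {t | insCoord i t y ∈ K}.indicator (fun _ => (1 : ℝ)) u = r := by
  have ha : h.1 ≠ 0 := fun h0 => hi (by simp [h0])
  have hapos : 0 < ‖h.1‖ := norm_pos_iff.2 ha
  set x := graphMap i h y with hx
  have hxp : x ∈ plane h := graphMap_mem_plane i hi y
  have hcont : Filter.Tendsto (fun u => insCoord i u y) (𝓝 (height i h y)) (𝓝 x) :=
    ((continuous_insCoord i).comp (continuous_id.prodMk continuous_const)).tendsto _
  have hcase := local_structure (x := x) hK hreg ha (hfr.mono fun z hz hzf => by
    have h1 : ⟪h.1, z⟫ = h.2 := hz hzf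
    have h2 : ⟪h.1, x⟫ = h.2 := hxp
    rw [inner_sub_right, h1, h2, sub_self])
  -- The two half-space cases differ only in the sign of the normal.
  have hhalf : ∀ n : Space (m + 1), IsOutwardNormal K x n → |n i| = |h.1 i| / ‖h.1‖ →
      ∃ l r : ℝ, ‖h.1‖ / |h.1 i| * normal K x i = l - r ∧
      (∀ᶠ u in 𝓝[<] height i h y,
        {t | insCoord i t y ∈ K}.indicator (fun _ => (1 : ℝ)) u = l) ∧
      ∀ᶠ u in 𝓝[>] height i h y,
        {t | insCoord i t y ∈ K}.indicator (fun _ => (1 : ℝ)) u = r := by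
    intro n hn hni
    have hev : ∀ᶠ u in 𝓝 (height i h y), (insCoord i u y ∈ K ↔ n i * (u - height i h y) < 0) := by
      filter_upwards [hcont.eventually hn.2] with u hu
      rw [hu, hx, graphMap, insCoord_sub]
    have hipos : 0 < |h.1 i| := abs_pos.2 hi
    rw [normal_eq hn]
    rcases lt_or_ge (n i) 0 with hneg | hnn
    · refine ⟨0, 1, ?_, ?_, ?_⟩
      · rw [abs_of_neg hneg] at hni
        rw [show n i = -(|h.1 i| / ‖h.1‖) by linarith]; field_simp; norm_num
      · filter_upwards [hev.filter_mono nhdsWithin_le_nhds, self_mem_nhdsWithin] with u hu hlt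
        refine indicator_of_notMem (fun hmem => ?_) _
        have h1 := hu.1 hmem
        nlinarith [mem_Iio.1 hlt]
      · filter_upwards [hev.filter_mono nhdsWithin_le_nhds, self_mem_nhdsWithin] with u hu hlt
        refine indicator_of_mem ?_ _
        refine hu.2 ?_
        nlinarith [mem_Ioi.1 hlt]
    · have hpos : 0 < n i := by
        rw [abs_of_nonneg hnn] at hni
        rw [hni]; positivity
      refine ⟨1, 0, ?_, ?_, ?_⟩
      · rw [abs_of_pos hpos] at hni
        rw [hni]; field_simp; norm_num
      · filter_upwards [hev.filter_mono nhdsWithin_le_nhds, self_mem_nhdsWithin] with u hu hlt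
        refine indicator_of_mem ?_ _
        refine hu.2 ?_
        nlinarith [mem_Iio.1 hlt]
      · filter_upwards [hev.filter_mono nhdsWithin_le_nhds, self_mem_nhdsWithin] with u hu hlt
        refine indicator_of_notMem (fun hmem => ?_) _
        have h1 := hu.1 hmem
        nlinarith [mem_Ioi.1 hlt]
  rcases hcase with hc | hc | hc | hc
  · have hnf : x ∉ faces K := fun hf => by
      obtain ⟨z, hz, hz'⟩ := ((mem_closure_iff_frequently.1
        (isOutwardNormal_normal hf).mem_closure).and_eventually hc).exists
      exact hz' hz
    refine ⟨0, 0, by simp [normal_of_notMem_faces hnf], ?_, ?_⟩ <;>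
    · filter_upwards [(hcont.eventually hc).filter_mono nhdsWithin_le_nhds] with u hu
      exact indicator_of_notMem (s := {t | insCoord i t y ∈ K}) hu _
  · have hnf : x ∉ faces K := fun hf => (isOutwardNormal_normal hf).notMem hc.self_of_nhds
    refine ⟨1, 1, by simp [normal_of_notMem_faces hnf], ?_, ?_⟩ <;>
    · filter_upwards [(hcont.eventually hc).filter_mono nhdsWithin_le_nhds] with u hu
      exact indicator_of_mem (s := {t | insCoord i t y ∈ K}) hu _
  · exact hhalf _ hc (by simp [abs_mul, div_eq_inv_mul])
  · exact hhalf _ hc (by simp [abs_mul, div_eq_inv_mul])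

/-- Away from the other hyperplanes of a finite arrangement, only one of them is near. -/
theorem eventually_mem_plane_of_notMem_others
    (hfr : frontier K ⊆ ⋃ h ∈ H, plane h) {h : Space (m + 1) × ℝ} {x : Space (m + 1)}
    (hx : ∀ k ∈ H, k ≠ h → x ∉ plane k) :
    ∀ᶠ z in 𝓝 x, z ∈ frontier K → z ∈ plane h := by
  have h1 : ∀ᶠ z in 𝓝 x, ∀ k ∈ H, k ≠ h → z ∉ plane k := by
    refine (Finset.eventually_all H).2 fun k hk => ?_
    by_cases hkh : k = h
    · exact Filter.Eventually.of_forall fun z hne => absurd hkh hne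
    · filter_upwards [(isClosed_plane k).isOpen_compl.mem_nhds (hx k hk hkh)] with z hz _
      exact hz
  filter_upwards [h1] with z hz hzf
  obtain ⟨k, hk, hzk⟩ := mem_iUnion₂.1 (hfr hzf)
  by_cases hkh : k = h
  · exact hkh ▸ hzk
  · exact absurd hzk (hz k hk hkh)

/-- The fundamental theorem of calculus on a line in direction `i` that lies in none of the
hyperplanes of the arrangement and meets those transversal to it in distinct points. -/
theorem integral_line (hK : IsOpen K) (hKb : Bornology.IsBounded K)
    (hreg : interior (closure K) = K) (hfr : frontier K ⊆ ⋃ h ∈ H, plane h)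
    (i : Fin (m + 1)) {y : Fin m → ℝ}
    (hpar : ∀ h ∈ H, h.1 i = 0 → ∀ t, insCoord i t y ∉ plane h)
    (htr : ∀ h ∈ H, h.1 i ≠ 0 → ∀ k ∈ H, k ≠ h → graphMap i h y ∉ plane k)
    {g : Space (m + 1) → ℝ} (hg : ContDiff ℝ 1 g) :
    ∫ t in {t | insCoord i t y ∈ K},
        fderiv ℝ g (insCoord i t y) (EuclideanSpace.single i 1)
      = ∑ h ∈ H with h.1 i ≠ 0,
        ‖h.1‖ / |h.1 i| * normal K (graphMap i h y) i * g (graphMap i h y) := by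
  have hcont : Continuous fun t => insCoord i t y :=
    (continuous_insCoord i).comp (continuous_id.prodMk continuous_const)
  refine integral_deriv_eq_sum_jump (Finset.filter (fun h => h.1 i ≠ 0) H)
    (fun h => height i h y) (fun h => ‖h.1‖ / |h.1 i| * normal K (graphMap i h y) i) ?_ ?_ ?_ ?_ ?_
    (g := fun t => g (insCoord i t y)) ?_ ?_
  · intro h hh k hk hhk
    by_contra hne
    obtain ⟨hhH, hhi⟩ := Finset.mem_filter.1 hh
    obtain ⟨hkH, hki⟩ := Finset.mem_filter.1 hk
    refine htr h hhH hhi k hkH (fun h' => hne h'.symm) ?_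
    exact (insCoord_mem_plane_iff i hki _ _).2 hhk
  · exact hcont.measurable hK.measurableSet
  · obtain ⟨R, hR⟩ := hKb.subset_closedBall 0
    refine (Metric.isBounded_closedBall (x := (0 : ℝ)) (r := R)).subset fun t ht => ?_
    have h1 := mem_closedBall_zero_iff.1 (hR ht)
    have h2 := PiLp.norm_apply_le (insCoord i t y) i
    rw [insCoord_same] at h2
    exact mem_closedBall_zero_iff.2 (h2.trans h1)
  · intro t ht
    have hnf : insCoord i t y ∉ frontier K := fun hf => by
      obtain ⟨h, hh, hm⟩ := mem_iUnion₂.1 (hfr hf)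
      by_cases hhi : h.1 i = 0
      · exact hpar h hh hhi t hm
      · exact ht h (Finset.mem_filter.2 ⟨hh, hhi⟩) ((insCoord_mem_plane_iff i hhi _ _).1 hm)
    exact (hcont.tendsto t).eventually (eventually_mem_iff_of_notMem_frontier hnf)
  · intro h hh
    obtain ⟨hhH, hhi⟩ := Finset.mem_filter.1 hh
    exact exists_jump hK hreg i hhi y
      (eventually_mem_plane_of_notMem_others hfr fun k hk hkh => htr h hhH hhi k hk hkh)
  · intro t
    exact (((hg.differentiable one_ne_zero) _).hasFDerivAt.comp_hasDerivAt t
      (hasDerivAt_insCoord i y t))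
  · exact ((hg.continuous_fderiv one_ne_zero).comp hcont).clm_apply continuous_const

theorem measure_faces_lt_top (hK : IsOpen K) (hKb : Bornology.IsBounded K)
    (hH : ∀ h ∈ H, h.1 ≠ 0) (hfr : frontier K ⊆ ⋃ h ∈ H, plane h) :
    (μHE[m] : Measure (Space (m + 1))) (faces K) < ⊤ := by
  have h1 : faces K ⊆ ⋃ h ∈ H, closure K ∩ plane h := by
    intro x hx
    obtain ⟨h, hh, hxh⟩ := mem_iUnion₂.1 (hfr (faces_subset_frontier hK hx))
    exact mem_iUnion₂.2 ⟨h, hh, frontier_subset_closure (faces_subset_frontier hK hx), hxh⟩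
  refine (measure_mono h1).trans_lt ?_
  refine (measure_biUnion_finset_le H _).trans_lt ?_
  exact ENNReal.sum_lt_top.2 fun h hh => measure_plane_inter_lt_top (hH h hh) hKb.closure

/-- Surface-almost every point of a hyperplane avoids the other hyperplanes of the arrangement. -/
theorem ae_notMem_others (hH : ∀ h ∈ H, h.1 ≠ 0)
    (hinj : InjOn plane (H : Set (Space (m + 1) × ℝ))) :
    ∀ᵐ x ∂(μHE[m] : Measure (Space (m + 1))), ∀ h ∈ H, x ∈ plane h →
      ∀ k ∈ H, k ≠ h → x ∉ plane k := by
  have hall : ∀ h ∈ H, ∀ k ∈ H, k ≠ h →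
      ∀ᵐ x ∂(μHE[m] : Measure (Space (m + 1))), x ∉ plane h ∩ plane k := fun h hh k hk hkh =>
    measure_eq_zero_iff_ae_notMem.1 (measure_plane_inter_plane (hH h hh) (hH k hk)
      fun he => hkh (hinj hh hk he).symm)
  have h2 : ∀ᵐ x ∂(μHE[m] : Measure (Space (m + 1))), ∀ h ∈ H, ∀ k ∈ H, k ≠ h →
      x ∉ plane h ∩ plane k := by
    refine (Filter.eventually_all_finset H).2 fun h hh =>
      (Filter.eventually_all_finset H).2 fun k hk => ?_
    by_cases hkh : k = h
    · exact Filter.Eventually.of_forall fun x hne => absurd hkh hne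
    · filter_upwards [hall h hh k hk hkh] with x hx _ using hx
  filter_upwards [h2] with x hx h hh hxh k hk hkh hxk
  exact hx h hh k hk hkh ⟨hxh, hxk⟩

/-- **Divergence theorem on a polytope**, one coordinate at a time. -/
theorem integral_fderiv_single_eq (hK : IsOpen K) (hKb : Bornology.IsBounded K)
    (hreg : interior (closure K) = K) (hH : ∀ h ∈ H, h.1 ≠ 0)
    (hinj : InjOn plane (H : Set (Space (m + 1) × ℝ)))
    (hfr : frontier K ⊆ ⋃ h ∈ H, plane h) (i : Fin (m + 1))
    {g : Space (m + 1) → ℝ} (hg : ContDiff ℝ 1 g) :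
    ∫ x in K, fderiv ℝ g x (EuclideanSpace.single i 1)
      = ∫ x in faces K, normal K x i * g x ∂μHE[m] := by
  classical
  set F : Space (m + 1) → ℝ := fun x => normal K x i * g x with hF
  have hnm : Measurable fun x => normal K x i :=
    (EuclideanSpace.proj i : Space (m + 1) →L[ℝ] ℝ).continuous.measurable.comp
      (measurable_normal hK)
  have hFm : Measurable F := hnm.mul hg.continuous.measurable
  have hF0 : ∀ x, x ∉ faces K → F x = 0 := fun x hx => by simp [hF, normal_of_notMem_faces hx]
  obtain ⟨C, hC⟩ := (hKb.isCompact_closure.exists_bound_of_continuousOn hg.continuous.continuousOn)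
  have hFint : Integrable F (μHE[m] : Measure (Space (m + 1))) := by
    rw [← integrableOn_iff_integrable_of_support_subset (s := faces K)
      (fun x hx => by by_contra h; exact hx (hF0 x h))]
    refine Measure.integrableOn_of_bounded (M := C)
      (measure_faces_lt_top hK hKb hH hfr).ne hFm.aestronglyMeasurable ?_
    refine (ae_restrict_iff' (measurableSet_faces hK)).2 (Filter.Eventually.of_forall fun x hx => ?_)
    have h1 := hC x (frontier_subset_closure (faces_subset_frontier hK hx))
    have h2 := (PiLp.norm_apply_le (normal K x) i).trans (norm_normal_le_one K x)
    rw [hF, norm_mul]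
    nlinarith [norm_nonneg (normal K x i), norm_nonneg (g x)]
  -- The surface integral splits over the hyperplanes.
  have hsplit : ∫ x in faces K, F x ∂μHE[m] = ∑ h ∈ H, ∫ x in plane h, F x ∂μHE[m] := by
    rw [setIntegral_eq_integral_of_forall_compl_eq_zero hF0]
    have h1 : ∫ x in ⋃ h : H, plane h.1, F x ∂μHE[m]
        = ∫ x, F x ∂(μHE[m] : Measure (Space (m + 1))) := by
      refine setIntegral_eq_integral_of_forall_compl_eq_zero fun x hx => hF0 x fun hxf => hx ?_
      obtain ⟨h, hh, hxh⟩ := mem_iUnion₂.1 (hfr (faces_subset_frontier hK hxf))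
      exact mem_iUnion.2 ⟨⟨h, hh⟩, hxh⟩
    have h2 : Pairwise fun h k : H =>
        AEDisjoint (μHE[m] : Measure (Space (m + 1))) (plane h.1) (plane k.1) := by
      intro h k hhk
      have hne : plane h.1 ≠ plane k.1 := fun he => hhk (Subtype.ext (hinj h.2 k.2 he))
      exact measure_plane_inter_plane (hH _ h.2) (hH _ k.2) hne
    have h3 : ∀ h : H, NullMeasurableSet (plane h.1) (μHE[m] : Measure (Space (m + 1))) :=
      fun h => (measurableSet_plane h.1).nullMeasurableSet
    rw [← h1, integral_iUnion_ae h3 h2 hFint.integrableOn, tsum_fintype]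
    exact Finset.sum_coe_sort H fun h => ∫ x in plane h, F x ∂μHE[m]
  -- Hyperplanes parallel to the direction `i` do not contribute.
  have hzero : ∀ h ∈ H, h.1 i = 0 → ∫ x in plane h, F x ∂μHE[m] = 0 := by
    intro h hh hi
    refine setIntegral_eq_zero_of_ae_eq_zero ?_
    filter_upwards [ae_notMem_others hH hinj] with x hx hxh
    by_cases hxf : x ∈ faces K
    · have hcase := local_structure (x := x) hK hreg (hH h hh)
        ((eventually_mem_plane_of_notMem_others hfr fun k hk hkh => hx h hh hxh k hk hkh).mono
        fun z hz hzf => by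
          have h1 : ⟪h.1, z⟫ = h.2 := hz hzf
          have h2 : ⟪h.1, x⟫ = h.2 := hxh
          rw [inner_sub_right, h1, h2, sub_self])
      have hn := isOutwardNormal_normal hxf
      rcases hcase with hc | hc | hc | hc
      · obtain ⟨z, hz, hz'⟩ := ((mem_closure_iff_frequently.1 hn.mem_closure).and_eventually
          hc).exists
        exact absurd hz hz'
      · exact absurd hc.self_of_nhds hn.notMem
      · simp [hF, normal_eq hc, hi]
      · simp [hF, normal_eq hc, hi]
    · exact hF0 x hxf
  have hpara : ∀ h ∈ H, h.1 i ≠ 0 → ∫ x in plane h, F x ∂μHE[m]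
      = ∫ y, ‖h.1‖ / |h.1 i| * normal K (graphMap i h y) i * g (graphMap i h y) := by
    intro h hh hi
    rw [restrict_plane_eq_map i hi, integral_smul_measure,
      integral_map (continuous_graphMap i h).aemeasurable hFm.aestronglyMeasurable,
      ENNReal.toReal_ofReal (by positivity), smul_eq_mul, ← integral_const_mul]
    exact integral_congr_ae (Filter.Eventually.of_forall fun y => by simp only [hF]; ring)
  have hparaInt : ∀ h ∈ H, h.1 i ≠ 0 → Integrable fun y =>
      ‖h.1‖ / |h.1 i| * normal K (graphMap i h y) i * g (graphMap i h y) := by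
    intro h hh hi
    have h1 : Integrable F ((μHE[m] : Measure (Space (m + 1))).restrict (plane h)) :=
      hFint.integrableOn
    have hpos : 0 < ‖h.1‖ / |h.1 i| := div_pos (norm_pos_iff.2 (hH h hh)) (abs_pos.2 hi)
    rw [restrict_plane_eq_map i hi, integrable_smul_measure (by simpa using hpos)
      ENNReal.ofReal_ne_top, integrable_map_measure hFm.aestronglyMeasurable
      (continuous_graphMap i h).aemeasurable] at h1
    refine (h1.const_mul (‖h.1‖ / |h.1 i|)).congr (Filter.Eventually.of_forall fun y => ?_)
    simp only [hF, Function.comp]; ring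
  -- Almost every line in direction `i` meets the hyperplanes transversally in distinct points.
  have hgen : ∀ᵐ y : Fin m → ℝ, (∀ h ∈ H, h.1 i = 0 → ∀ t, insCoord i t y ∉ plane h) ∧
      ∀ h ∈ H, h.1 i ≠ 0 → ∀ k ∈ H, k ≠ h → graphMap i h y ∉ plane k := by
    refine Filter.Eventually.and ?_ ?_
    · refine (Filter.eventually_all_finset H).2 fun h hh => ?_
      by_cases hi : h.1 i = 0
      · obtain ⟨j, hj⟩ := exists_coord_ne_zero (hH h hh)
        obtain ⟨j, rfl⟩ : ∃ j', j = i.succAbove j' := by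
          rcases Fin.eq_self_or_eq_succAbove i j with rfl | h'
          · exact absurd hi hj
          · exact h'
        have h1 := volume_affine_zero (a := fun j => h.1 (i.succAbove j)) (c := h.2)
          ⟨Pi.single j ((h.2 + 1) / h.1 (i.succAbove j)), by
            rw [Finset.sum_eq_single j] <;> simp +contextual
            field_simp; linarith⟩
        filter_upwards [measure_eq_zero_iff_ae_notMem.1 h1] with y hy _ t ht
        refine hy ?_
        have h2 : ⟪h.1, insCoord i t y⟫ = h.2 := ht
        rwa [inner_insCoord, hi, zero_mul, zero_add] at h2
      · exact Filter.Eventually.of_forall fun y h0 => absurd h0 hi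
    · refine (Filter.eventually_all_finset H).2 fun h hh => ?_
      by_cases hi : h.1 i = 0
      · exact Filter.Eventually.of_forall fun y h0 => absurd hi h0
      have : ∀ᵐ y : Fin m → ℝ, ∀ k ∈ H, k ≠ h → graphMap i h y ∉ plane k := by
        refine (Filter.eventually_all_finset H).2 fun k hk => ?_
        by_cases hkh : k = h
        · exact Filter.Eventually.of_forall fun y h0 => absurd hkh h0
        · filter_upwards [measure_eq_zero_iff_ae_notMem.1 (volume_graphMap_mem_plane i hi (hH k hk)
            fun he => hkh (hinj hh hk he).symm)] with y hy _ using hy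
      filter_upwards [this] with y hy _ using hy
  set e : ℝ × (Fin m → ℝ) → Space (m + 1) := fun q => insCoord i q.1 q.2 with he
  set G : Space (m + 1) → ℝ := fun x => fderiv ℝ g x (EuclideanSpace.single i 1) with hG
  have hGc : Continuous G := (hg.continuous_fderiv one_ne_zero).clm_apply continuous_const
  have hGint : IntegrableOn G K :=
    (hGc.continuousOn.integrableOn_compact hKb.isCompact_closure).mono_set subset_closure
  have hemp := measurePreserving_insCoord i
  have hemb := measurableEmbedding_insCoord i
  calc ∫ x in K, G x = ∫ q in e ⁻¹' K, G (e q) ∂(volume.prod volume) :=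
        (hemp.setIntegral_preimage_emb hemb G K).symm
    _ = ∫ q, (e ⁻¹' K).indicator (fun q => G (e q)) q ∂(volume.prod volume) :=
        (integral_indicator (hemb.measurable hK.measurableSet)).symm
    _ = ∫ y, ∫ t, (e ⁻¹' K).indicator (fun q => G (e q)) (t, y) := by
        refine integral_prod_symm _ ?_
        rw [integrable_indicator_iff (hemb.measurable hK.measurableSet)]
        exact (hemp.integrableOn_comp_preimage hemb).2 hGint
    _ = ∫ y, ∑ h ∈ H with h.1 i ≠ 0,
        ‖h.1‖ / |h.1 i| * normal K (graphMap i h y) i * g (graphMap i h y) := by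
        refine integral_congr_ae ?_
        filter_upwards [hgen] with y hy
        have hmeas : MeasurableSet {t | insCoord i t y ∈ K} :=
          ((continuous_insCoord i).comp (continuous_id.prodMk continuous_const)).measurable
            hK.measurableSet
        rw [← integral_line hK hKb hreg hfr i hy.1 hy.2 hg, ← integral_indicator hmeas]
        rfl
    _ = ∑ h ∈ H with h.1 i ≠ 0, ∫ x in plane h, F x ∂μHE[m] := by
        rw [integral_finsetSum _ fun h hh =>
          hparaInt h (Finset.mem_filter.1 hh).1 (Finset.mem_filter.1 hh).2]
        exact Finset.sum_congr rfl fun h hh =>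
          (hpara h (Finset.mem_filter.1 hh).1 (Finset.mem_filter.1 hh).2).symm
    _ = ∫ x in faces K, F x ∂μHE[m] := by
        rw [hsplit, Finset.sum_filter]
        refine Finset.sum_congr rfl fun h hh => ?_
        split_ifs with hi
        · rfl
        · exact (hzero h hh (not_not.1 hi)).symm

/-- **Divergence theorem on a polytope**, for the directional derivative in direction `ω`. -/
theorem integral_fderiv_eq_integral_faces (hK : IsOpen K) (hKb : Bornology.IsBounded K)
    (hreg : interior (closure K) = K) (hH : ∀ h ∈ H, h.1 ≠ 0)
    (hinj : InjOn plane (H : Set (Space (m + 1) × ℝ)))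
    (hfr : frontier K ⊆ ⋃ h ∈ H, plane h) (ω : Space (m + 1))
    {g : Space (m + 1) → ℝ} (hg : ContDiff ℝ 1 g) :
    ∫ x in K, fderiv ℝ g x ω = ∫ x in faces K, ⟪ω, normal K x⟫ * g x ∂μHE[m] := by
  have hω : ω = ∑ i, ω i • (EuclideanSpace.single i (1 : ℝ) : Space (m + 1)) := by
    ext j
    simp [Pi.single_apply]
  have hint1 : ∀ i, IntegrableOn (fun x => ω i * fderiv ℝ g x (EuclideanSpace.single i 1)) K :=
    fun i => (((hg.continuous_fderiv one_ne_zero).clm_apply continuous_const).continuousOn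
      |>.integrableOn_compact hKb.isCompact_closure |>.mono_set subset_closure).const_mul _
  obtain ⟨C, hC⟩ := (hKb.isCompact_closure.exists_bound_of_continuousOn hg.continuous.continuousOn)
  have hint2 : ∀ i, IntegrableOn (fun x => ω i * (normal K x i * g x)) (faces K)
      (μHE[m] : Measure (Space (m + 1))) := by
    intro i
    refine Integrable.const_mul ?_ _
    have hnm : Measurable fun x => normal K x i :=
      (EuclideanSpace.proj i : Space (m + 1) →L[ℝ] ℝ).continuous.measurable.comp
        (measurable_normal hK)
    refine Measure.integrableOn_of_bounded (M := C)
      (measure_faces_lt_top hK hKb hH hfr).ne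
      (hnm.mul hg.continuous.measurable).aestronglyMeasurable ?_
    refine (ae_restrict_iff' (measurableSet_faces hK)).2 (Filter.Eventually.of_forall fun x hx => ?_)
    have h1 := hC x (frontier_subset_closure (faces_subset_frontier hK hx))
    have h2 := (PiLp.norm_apply_le (normal K x) i).trans (norm_normal_le_one K x)
    rw [norm_mul]
    nlinarith [norm_nonneg (normal K x i), norm_nonneg (g x)]
  calc ∫ x in K, fderiv ℝ g x ω
      = ∫ x in K, ∑ i, ω i * fderiv ℝ g x (EuclideanSpace.single i 1) := by
        refine integral_congr_ae (Filter.Eventually.of_forall fun x => ?_)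
        show fderiv ℝ g x ω = _
        conv_lhs => rw [hω, map_sum]
        simp
    _ = ∑ i, ω i * ∫ x in faces K, normal K x i * g x ∂μHE[m] := by
        rw [integral_finsetSum _ fun i _ => hint1 i]
        refine Finset.sum_congr rfl fun i _ => ?_
        rw [integral_const_mul, integral_fderiv_single_eq hK hKb hreg hH hinj hfr i hg]
    _ = ∫ x in faces K, ⟪ω, normal K x⟫ * g x ∂μHE[m] := by
        have h1 : ∀ x, ⟪ω, normal K x⟫ * g x = ∑ i, ω i * (normal K x i * g x) := by
          intro x
          rw [PiLp.inner_apply, Finset.sum_mul]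
          exact Finset.sum_congr rfl fun i _ => by simp; ring
        simp only [h1]
        rw [integral_finsetSum _ fun i _ => hint2 i]
        exact Finset.sum_congr rfl fun i _ => (integral_const_mul _ _).symm

end Divergence

/-- The frontiers of finitely many polytopes lie in a finite arrangement of distinct
hyperplanes. -/
theorem exists_arrangement {d : ℕ} {ι : Type*} [Fintype ι] {K : ι → Set (Space d)}
    (hK : ∀ k, IsOpenPolytope (K k)) :
    ∃ H : Finset (Space d × ℝ), (∀ h ∈ H, h.1 ≠ 0) ∧
      InjOn plane (H : Set (Space d × ℝ)) ∧ ∀ k, frontier (K k) ⊆ ⋃ h ∈ H, plane h := by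
  classical
  choose H hH0 hHf using fun k => (hK k).piecewise_flat
  obtain ⟨H', hsub, hinj, himg⟩ := Finset.exists_subset_injOn_image_eq_of_surjOn (f := plane)
    (Finset.univ.biUnion H) ((Finset.univ.biUnion H).image plane)
    (by rw [Finset.coe_image]; exact surjOn_image _ _)
  refine ⟨H', fun h hh => ?_, hinj, fun k x hx => ?_⟩
  · obtain ⟨k, _, hk⟩ := Finset.mem_biUnion.1 (hsub hh)
    exact hH0 k h hk
  · obtain ⟨h, hh, hxh⟩ := mem_iUnion₂.1 (hHf k hx)
    have h1 : plane h ∈ (Finset.univ.biUnion H).image plane :=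
      Finset.mem_image_of_mem _ (Finset.mem_biUnion.2 ⟨k, Finset.mem_univ _, hh⟩)
    rw [← himg] at h1
    obtain ⟨h', hh', he⟩ := Finset.mem_image.1 h1
    exact mem_iUnion₂.2 ⟨h', hh', he ▸ hxh⟩

/-! ### Angular elements -/

section Angle

variable {d : ℕ}

/-- The radial projection of a direction to the cube face with the given axis. -/
noncomputable def cubePull (i : Fin d) (ω : Direction d) : Space d :=
  |(ω : Space d) i|⁻¹ • (ω : Space d)

theorem CubeCell.sign_abs (c : CubeCell d) : |c.sign| = 1 := by
  rcases c.sign_eq with h | h <;> simp [h]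

theorem cubePull_eq {c : CubeCell d} {y : Space d} (hy : y ∈ c.interior) {ω : Direction d}
    (hω : (ω : Space d) = ‖y‖⁻¹ • y) : cubePull c.axis ω = y := by
  have hy0 : y ≠ 0 := fun h => by
    have h1 := c.sign_abs
    rw [← hy.1, h] at h1
    simp at h1
  have hn : 0 < ‖y‖ := norm_pos_iff.2 hy0
  rw [cubePull, hω]
  simp only [PiLp.smul_apply, smul_eq_mul, abs_mul, hy.1, c.sign_abs, abs_inv, abs_norm, mul_one,
    inv_inv, smul_smul, mul_inv_cancel₀ hn.ne', one_smul]

theorem mem_curved_iff {c : CubeCell d} {ω : Direction d} :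
    ω ∈ c.curved ↔ cubePull c.axis ω ∈ c.interior := by
  constructor
  · rintro ⟨y, hy, hω⟩
    rwa [cubePull_eq hy hω]
  · intro h
    refine ⟨_, h, ?_⟩
    have h0 : |(ω : Space d) c.axis| ≠ 0 := fun h0 => by
      have h1 := c.sign_abs
      rw [← h.1] at h1
      simp [cubePull, h0] at h1
    have h1 : ‖(ω : Space d)‖ = 1 := by simp
    rw [cubePull, norm_smul, h1, smul_smul]
    simp [h0]

theorem measurable_cubePull (i : Fin d) : Measurable (cubePull i) := by
  unfold cubePull
  have h1 : Measurable fun ω : Direction d => (ω : Space d) := measurable_subtype_coe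
  have h2 : Measurable fun ω : Direction d => (ω : Space d) i :=
    (EuclideanSpace.proj i : Space d →L[ℝ] ℝ).continuous.measurable.comp h1
  exact (h2.abs.inv).smul h1

theorem CubeCell.abs_coord_ne_zero {c : CubeCell d} {ω : Direction d} (h : ω ∈ c.curved) :
    |(ω : Space d) c.axis| ≠ 0 := fun h0 => by
  have h1 := c.sign_abs
  rw [← (mem_curved_iff.1 h).1] at h1
  simp [cubePull, h0] at h1

theorem CubeCell.continuousAt_cubePull {c : CubeCell d} {ω : Direction d} (h : ω ∈ c.curved) :
    ContinuousAt (cubePull c.axis) ω := by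
  unfold cubePull
  have h1 : ContinuousAt (fun ω : Direction d => |(ω : Space d) c.axis|) ω := by fun_prop
  exact (h1.inv₀ (CubeCell.abs_coord_ne_zero h)).smul continuous_subtype_val.continuousAt

theorem CubeCell.isOpen_curved (c : CubeCell d) : IsOpen c.curved := by
  rw [isOpen_iff_mem_nhds]
  intro ω hω
  have hp := mem_curved_iff.1 hω
  have hc := c.continuousAt_cubePull hω
  have hcj : ∀ j, ContinuousAt (fun ω => cubePull c.axis ω j) ω := fun j =>
    (EuclideanSpace.proj j : Space d →L[ℝ] ℝ).continuous.continuousAt.comp hc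
  have h1 : ∀ᶠ ω' in 𝓝 ω, ∀ j, j ≠ c.axis →
      cubePull c.axis ω' j ∈ Ioo (c.lo j) (c.hi j) := by
    refine Filter.eventually_all.2 fun j => ?_
    by_cases hj : j = c.axis
    · exact Filter.Eventually.of_forall fun _ h => absurd hj h
    · filter_upwards [(hcj j).eventually (isOpen_Ioo.mem_nhds (hp.2 j hj))] with ω' h _ using h
  have hs : 0 < cubePull c.axis ω c.axis * c.sign := by
    rw [hp.1]; rcases c.sign_eq with h | h <;> simp [h]
  have h2 : ∀ᶠ ω' in 𝓝 ω, 0 < cubePull c.axis ω' c.axis * c.sign :=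
    ((hcj c.axis).mul continuousAt_const).eventually (lt_mem_nhds hs)
  filter_upwards [h1, h2] with ω' h1 h2
  refine mem_curved_iff.2 ⟨?_, h1⟩
  have h3 : cubePull c.axis ω' c.axis = |(ω' : Space d) c.axis|⁻¹ * (ω' : Space d) c.axis := by
    simp [cubePull]
  rw [h3] at h2 ⊢
  have h0 : (ω' : Space d) c.axis ≠ 0 := fun h0 => by simp [h0] at h2
  rcases lt_or_gt_of_ne h0 with h | h <;> rcases c.sign_eq with hs | hs
  · rw [abs_of_neg h, hs, inv_neg, neg_mul, inv_mul_cancel₀ h0] at h2; norm_num at h2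
  · rw [abs_of_neg h, hs, inv_neg, neg_mul, inv_mul_cancel₀ h0]
  · rw [abs_of_pos h, hs, inv_mul_cancel₀ h0]
  · rw [abs_of_pos h, hs, inv_mul_cancel₀ h0] at h2; norm_num at h2

theorem CubeCell.measurableSet_curved (c : CubeCell d) : MeasurableSet c.curved :=
  c.isOpen_curved.measurableSet

theorem CubeCell.abs_le_one {c : CubeCell d} {y : Space d} (hy : y ∈ c.interior) (j : Fin d) :
    |y j| ≤ 1 := by
  by_cases hj : j = c.axis
  · rw [hj, hy.1, c.sign_abs]
  · have h1 := hy.2 j hj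
    have h2 := c.bounds j hj
    exact abs_le.2 ⟨by linarith [h1.1], by linarith [h1.2]⟩

/-- The radial projection is injective on the surface of the cube. -/
theorem CubeCell.disjoint_curved {c c' : CubeCell d} (h : Disjoint c.interior c'.interior) :
    Disjoint c.curved c'.curved := by
  rw [Set.disjoint_left]
  rintro ω ⟨y, hy, hω⟩ ⟨y', hy', hω'⟩
  have hpos : ∀ {c : CubeCell d} {y : Space d}, y ∈ c.interior → 0 < ‖y‖ := by
    intro c y hy
    refine norm_pos_iff.2 fun h => ?_
    have h1 := c.sign_abs
    rw [← hy.1, h] at h1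
    simp at h1
  have hle : ∀ {c c' : CubeCell d} {y y' : Space d}, y ∈ c.interior → y' ∈ c'.interior →
      ‖y‖⁻¹ • y = ‖y'‖⁻¹ • y' → ‖y‖ ≤ ‖y'‖ := by
    intro c c' y y' hy hy' he
    have h1 : |‖y‖⁻¹ * y c'.axis| = |‖y'‖⁻¹ * y' c'.axis| := by
      have := congrArg (fun v : Space d => |v c'.axis|) he
      simpa using this
    rw [hy'.1, abs_mul, abs_mul, c'.sign_abs, abs_inv, abs_inv, abs_norm, abs_norm, mul_one] at h1
    have h2 := CubeCell.abs_le_one hy c'.axis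
    have h4 : ‖y'‖⁻¹ ≤ ‖y‖⁻¹ := by
      rw [← h1]; exact mul_le_of_le_one_right (by positivity) h2
    exact (inv_le_inv₀ (hpos hy') (hpos hy)).1 h4
  have hne : ‖y‖ = ‖y'‖ := le_antisymm (hle hy hy' (hω.symm.trans hω'))
    (hle hy' hy (hω'.symm.trans hω))
  have : y = y' := by
    have he := hω.symm.trans hω'
    rw [hne] at he
    exact smul_right_injective _ (inv_ne_zero (hpos hy').ne') he
  exact Set.disjoint_left.1 h hy (this ▸ hy')

end Angle

/-! ### Energy groups -/

namespace EnergyMesh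

instance (T : EnergyMesh) : IsFiniteMeasure T.measure := by
  cases T <;> (unfold EnergyMesh.measure; infer_instance)

theorem measurableSet_group (T : EnergyMesh) (g : Fin T.numGroups) : MeasurableSet (T.group g) := by
  cases T
  · exact measurableSet_singleton _
  · exact measurableSet_Ioo

theorem isBounded_group (T : EnergyMesh) (g : Fin T.numGroups) :
    Bornology.IsBounded (T.group g) := by
  cases T
  · exact Bornology.isBounded_singleton
  · exact Metric.isBounded_Ioo _ _

theorem disjoint_group (T : EnergyMesh) (g g' : Fin T.numGroups) (h : g ≠ g') :
    Disjoint (T.group g) (T.group g') := by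
  cases T with
  | mono => exact absurd (Subsingleton.elim (α := Fin 1) g g') h
  | poly N hN node hnode hmin r =>
    have key : ∀ a b : Fin N, a < b → Disjoint (Ioo (node a.succ) (node a.castSucc))
        (Ioo (node b.succ) (node b.castSucc)) := by
      intro a b hab
      rw [Set.disjoint_left]
      intro E h1 h2
      have : node b.castSucc ≤ node a.succ := hnode.antitone (by
        rw [Fin.le_def]; simpa using hab)
      linarith [h1.1, h2.2]
    rcases lt_or_gt_of_ne h with h | h
    · exact key _ _ h
    · exact (key _ _ h).symm

theorem group_subset_domain (T : EnergyMesh) (g : Fin T.numGroups) : T.group g ⊆ T.domain := by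
  cases T with
  | mono => exact subset_rfl
  | poly N hN node hnode hmin r =>
    intro E hE
    exact ⟨(hnode.antitone (Fin.le_last _)).trans hE.1.le,
      hE.2.le.trans (hnode.antitone (Fin.zero_le _))⟩

theorem ae_mem_domain (T : EnergyMesh) : ∀ᵐ E ∂T.measure, E ∈ T.domain := by
  cases T with
  | mono => simp [EnergyMesh.measure, EnergyMesh.domain, ae_dirac_eq]
  | poly N hN node hnode hmin r => exact ae_restrict_mem measurableSet_Icc

theorem measure_group_inter_pos (T : EnergyMesh) {g : Fin T.numGroups} {E : ℝ}
    (hE : E ∈ T.group g) {O : Set ℝ} (hO : O ∈ 𝓝 E) : 0 < T.measure (T.group g ∩ O) := by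
  cases T with
  | mono =>
    have h0 : E = 0 := hE
    have h1 : (0 : ℝ) ∈ ({0} ∩ O : Set ℝ) := ⟨rfl, h0 ▸ mem_of_mem_nhds hO⟩
    show 0 < Measure.dirac (0 : ℝ) ({0} ∩ O)
    rw [Measure.dirac_apply_of_mem h1]
    exact one_pos
  | poly N hN node hnode hmin r =>
    have hsub := (EnergyMesh.poly N hN node hnode hmin r).group_subset_domain g
    have h1 : (EnergyMesh.poly N hN node hnode hmin r).measure
        ((EnergyMesh.poly N hN node hnode hmin r).group g ∩ O) =
        volume ((EnergyMesh.poly N hN node hnode hmin r).group g ∩ O) :=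
      Measure.restrict_eq_self _ (inter_subset_left.trans hsub)
    rw [h1]
    exact Measure.measure_pos_of_mem_nhds _ (x := E) (Filter.inter_mem (isOpen_Ioo.mem_nhds hE) hO)

end EnergyMesh

/-! ### Finite element functions -/

/-- A function given piecewise on finitely many disjoint sets, and zero elsewhere. -/
theorem eq_sum_indicator {X ι : Type*} [Fintype ι] {S : ι → Set X}
    (hS : ∀ k l, k ≠ l → Disjoint (S k) (S l)) {f : X → ℝ} {g : ι → X → ℝ}
    (hf : ∀ k, ∀ x ∈ S k, f x = g k x) (h0 : ∀ x, (∀ k, x ∉ S k) → f x = 0) :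
    f = ∑ k, (S k).indicator (g k) := by
  classical
  ext x
  rw [Finset.sum_apply]
  by_cases hx : ∃ k, x ∈ S k
  · obtain ⟨k, hk⟩ := hx
    rw [Finset.sum_eq_single k, indicator_of_mem hk, hf k x hk]
    · intro l _ hl
      exact indicator_of_notMem (fun h => Set.disjoint_left.1 (hS l k hl) h hk) _
    · simp
  · push Not at hx
    rw [h0 x hx, Finset.sum_eq_zero]
    exact fun k _ => indicator_of_notMem (hx k) _

theorem continuous_mvPolynomial_eval {d : ℕ} (P : MvPolynomial (Fin d) ℝ) :
    Continuous fun x : Space d => MvPolynomial.eval (fun i => x i) P :=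
  (MvPolynomial.continuous_eval P).comp (PiLp.continuous_ofLp 2 _)

theorem contDiff_mvPolynomial_eval {d : ℕ} (P : MvPolynomial (Fin d) ℝ) :
    ContDiff ℝ 1 fun x : Space d => MvPolynomial.eval (fun i => x i) P := by
  induction P using MvPolynomial.induction_on with
  | C a => simpa using contDiff_const
  | add p q hp hq => simpa using hp.add hq
  | mul_X p i hp =>
    simp only [map_mul, MvPolynomial.eval_X]
    exact hp.mul (EuclideanSpace.proj i : Space d →L[ℝ] ℝ).contDiff

instance (d : ℕ) : IsFiniteMeasure (sphereMeasure d) := by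
  unfold sphereMeasure; infer_instance

instance (d : ℕ) : (sphereMeasure d).IsOpenPosMeasure := by
  unfold sphereMeasure; infer_instance

namespace Mesh

variable {d : ℕ} {T : Mesh d}

instance (T : Mesh d) : IsFiniteMeasure T.angleEnergyMeasure := by
  unfold angleEnergyMeasure; infer_instance

theorem disjoint_curved (T : Mesh d) (k l : Fin T.numAngle) (h : k ≠ l) :
    Disjoint (T.cell k).curved (T.cell l).curved :=
  CubeCell.disjoint_curved (T.cell_disjoint k l h)

theorem IsAngleFE.eq_sum {ψ : Direction d → ℝ} (h : T.IsAngleFE ψ) :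
    ∃ P : Fin T.numAngle → MvPolynomial (Fin d) ℝ, (∀ k j, (P k).degreeOf j ≤ T.q) ∧
      ψ = ∑ k, (T.cell k).curved.indicator
        (fun ω => MvPolynomial.eval (fun i => cubePull (T.cell k).axis ω i) (P k)) := by
  choose P hP hPψ using h.1
  refine ⟨P, hP, eq_sum_indicator T.disjoint_curved (fun k ω hω => ?_) h.2⟩
  obtain ⟨y, hy, hωy⟩ := hω
  rw [hPψ k y hy ω hωy, cubePull_eq hy hωy]

theorem IsAngleFE.measurable {ψ : Direction d → ℝ} (h : T.IsAngleFE ψ) : Measurable ψ := by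
  obtain ⟨P, -, rfl⟩ := h.eq_sum
  rw [Finset.sum_fn]
  refine Finset.measurable_sum _ fun k _ => Measurable.indicator ?_ (T.cell k).measurableSet_curved
  exact (continuous_mvPolynomial_eval (P k)).measurable.comp (measurable_cubePull _)

theorem IsAngleFE.bounded {ψ : Direction d → ℝ} (h : T.IsAngleFE ψ) : ∃ C, ∀ ω, |ψ ω| ≤ C := by
  obtain ⟨P, -, rfl⟩ := h.eq_sum
  have hk : ∀ k, ∃ C, ∀ ω ∈ (T.cell k).curved,
      |MvPolynomial.eval (fun i => cubePull (T.cell k).axis ω i) (P k)| ≤ C := by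
    intro k
    obtain ⟨C, hC⟩ := (isCompact_univ_pi fun _ : Fin d => isCompact_Icc (a := (-1 : ℝ)) (b := 1))
      |>.exists_bound_of_continuousOn (MvPolynomial.continuous_eval (P k)).continuousOn
    exact ⟨C, fun ω hω => hC _ fun i _ =>
      abs_le.1 (CubeCell.abs_le_one (mem_curved_iff.1 hω) i)⟩
  choose C hC using hk
  refine ⟨∑ k, |C k|, fun ω => ?_⟩
  rw [Finset.sum_apply]
  refine (Finset.abs_sum_le_sum_abs _ _).trans (Finset.sum_le_sum fun k _ => ?_)
  by_cases hω : ω ∈ (T.cell k).curved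
  · rw [indicator_of_mem hω]; exact (hC k ω hω).trans (le_abs_self _)
  · rw [indicator_of_notMem hω]; simp

theorem IsAngleFE.continuousOn {ψ : Direction d → ℝ} (h : T.IsAngleFE ψ) (k : Fin T.numAngle) :
    ContinuousOn ψ (T.cell k).curved := by
  obtain ⟨P, -, hP⟩ := h.1 k
  have h1 : ContinuousOn (fun ω => MvPolynomial.eval (fun i => cubePull (T.cell k).axis ω i) P)
      (T.cell k).curved := fun ω hω =>
    ((continuous_mvPolynomial_eval P).continuousAt.comp
      ((T.cell k).continuousAt_cubePull hω)).continuousWithinAt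
  refine h1.congr fun ω hω => ?_
  obtain ⟨y, hy, hωy⟩ := hω
  rw [hP y hy ω hωy]
  simp only [cubePull_eq hy hωy]

theorem IsEnergyFE.eq_sum {χ : ℝ → ℝ} (h : T.IsEnergyFE χ) :
    ∃ P : Fin T.energy.numGroups → Polynomial ℝ, (∀ g, (P g).natDegree ≤ T.energy.degree) ∧
      χ = ∑ g, (T.energy.group g).indicator (fun E => (P g).eval E) := by
  choose P hP hPχ using h.1
  exact ⟨P, hP, eq_sum_indicator T.energy.disjoint_group hPχ h.2⟩

theorem IsEnergyFE.measurable {χ : ℝ → ℝ} (h : T.IsEnergyFE χ) : Measurable χ := by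
  obtain ⟨P, -, rfl⟩ := h.eq_sum
  rw [Finset.sum_fn]
  exact Finset.measurable_sum _ fun g _ =>
    (P g).continuous.measurable.indicator (T.energy.measurableSet_group g)

theorem IsEnergyFE.bounded {χ : ℝ → ℝ} (h : T.IsEnergyFE χ) : ∃ C, ∀ E, |χ E| ≤ C := by
  obtain ⟨P, -, rfl⟩ := h.eq_sum
  have hk : ∀ g, ∃ C, ∀ E ∈ closure (T.energy.group g), ‖(P g).eval E‖ ≤ C := fun g =>
    (T.energy.isBounded_group g).isCompact_closure.exists_bound_of_continuousOn
      (P g).continuous.continuousOn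
  choose C hC using hk
  refine ⟨∑ g, |C g|, fun E => ?_⟩
  rw [Finset.sum_apply]
  refine (Finset.abs_sum_le_sum_abs _ _).trans (Finset.sum_le_sum fun g _ => ?_)
  by_cases hE : E ∈ T.energy.group g
  · rw [indicator_of_mem hE]; exact (hC g E (subset_closure hE)).trans (le_abs_self _)
  · rw [indicator_of_notMem hE]; simp

theorem IsEnergyFE.continuousOn {χ : ℝ → ℝ} (h : T.IsEnergyFE χ) (g : Fin T.energy.numGroups) :
    ContinuousOn χ (T.energy.group g) := by
  obtain ⟨P, -, hP⟩ := h.1 g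
  exact P.continuous.continuousOn.congr hP

theorem IsSpaceFE.eq_sum {φ : Space d → ℝ} (h : T.IsSpaceFE φ) :
    ∃ P : Fin T.numSpace → MvPolynomial (Fin d) ℝ, (∀ k, (P k).totalDegree ≤ T.p) ∧
      φ = ∑ k, (T.elem k).indicator (fun x => MvPolynomial.eval (fun i => x i) (P k)) := by
  choose P hP hPφ using h.1
  exact ⟨P, hP, eq_sum_indicator T.elem_disjoint hPφ h.2⟩

theorem IsSpaceFE.continuousOn {φ : Space d → ℝ} (h : T.IsSpaceFE φ) (k : Fin T.numSpace) :
    ContinuousOn φ (T.elem k) := by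
  obtain ⟨P, -, hP⟩ := h.1 k
  exact (continuous_mvPolynomial_eval P).continuousOn.congr hP

end Mesh

/-- Functions on phase space that are continuously differentiable in space, and that are bounded
over `B` and jointly measurable together with their derivative `μ · ∇ₓ V`. -/
structure IsRegularOver {d : ℕ} (B : Set (Space d)) (V : Phase d → ℝ) : Prop where
  contDiff : ∀ y, ContDiff ℝ 1 fun x => V (x, y)
  measurable : Measurable V
  measurable_deriv : Measurable fun z : Phase d =>
    fderiv ℝ (fun x => V (x, z.2)) z.1 (z.2.1 : Space d)
  bounded : ∃ C, ∀ z : Phase d, z.1 ∈ B → |V z| ≤ C ∧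
    |fderiv ℝ (fun x => V (x, z.2)) z.1 (z.2.1 : Space d)| ≤ C

namespace IsRegularOver

variable {d : ℕ} {B : Set (Space d)} {V W : Phase d → ℝ}

theorem zero : IsRegularOver B (0 : Phase d → ℝ) where
  contDiff y := contDiff_const
  measurable := measurable_zero
  measurable_deriv := by simp
  bounded := ⟨0, by simp⟩

theorem fderiv_add_apply (hV : IsRegularOver B V) (hW : IsRegularOver B W) (z : Phase d) :
    fderiv ℝ (fun x => (V + W) (x, z.2)) z.1 (z.2.1 : Space d)
      = fderiv ℝ (fun x => V (x, z.2)) z.1 (z.2.1 : Space d)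
        + fderiv ℝ (fun x => W (x, z.2)) z.1 (z.2.1 : Space d) := by
  have := fderiv_fun_add (((hV.contDiff z.2).differentiable one_ne_zero) z.1)
    (((hW.contDiff z.2).differentiable one_ne_zero) z.1)
  simp only [Pi.add_apply, this, add_apply]

theorem add (hV : IsRegularOver B V) (hW : IsRegularOver B W) : IsRegularOver B (V + W) where
  contDiff y := (hV.contDiff y).add (hW.contDiff y)
  measurable := hV.measurable.add hW.measurable
  measurable_deriv := by
    simp only [fderiv_add_apply hV hW]
    exact hV.measurable_deriv.add hW.measurable_deriv
  bounded := by
    obtain ⟨C, hC⟩ := hV.bounded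
    obtain ⟨C', hC'⟩ := hW.bounded
    refine ⟨C + C', fun z hz => ⟨?_, ?_⟩⟩
    · exact (abs_add_le _ _).trans (add_le_add (hC z hz).1 (hC' z hz).1)
    · rw [fderiv_add_apply hV hW]
      exact (abs_add_le _ _).trans (add_le_add (hC z hz).2 (hC' z hz).2)

theorem smul (hV : IsRegularOver B V) (c : ℝ) : IsRegularOver B (c • V) := by
  have hder : ∀ z : Phase d, fderiv ℝ (fun x => (c • V) (x, z.2)) z.1 (z.2.1 : Space d)
      = c * fderiv ℝ (fun x => V (x, z.2)) z.1 (z.2.1 : Space d) := by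
    intro z
    have := fderiv_fun_const_smul (((hV.contDiff z.2).differentiable one_ne_zero) z.1) c
    show fderiv ℝ (fun x => c • V (x, z.2)) z.1 (z.2.1 : Space d) = _
    rw [this]; rfl
  refine ⟨fun y => (hV.contDiff y).const_smul c, hV.measurable.const_smul c, ?_, ?_⟩
  · simp only [hder]
    exact hV.measurable_deriv.const_mul c
  · obtain ⟨C, hC⟩ := hV.bounded
    refine ⟨|c| * C, fun z hz => ⟨?_, ?_⟩⟩
    · rw [Pi.smul_apply, smul_eq_mul, abs_mul]
      exact mul_le_mul_of_nonneg_left (hC z hz).1 (abs_nonneg _)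
    · rw [hder, abs_mul]
      exact mul_le_mul_of_nonneg_left (hC z hz).2 (abs_nonneg _)

/-- A `C¹` function of space times a bounded measurable function of angle and energy. -/
theorem mul_const (hB : Bornology.IsBounded B) {P : Space d → ℝ} (hP : ContDiff ℝ 1 P)
    {c : Direction d × ℝ → ℝ} (hc : Measurable c) (hcb : ∃ C, ∀ y, |c y| ≤ C) :
    IsRegularOver B (fun z => P z.1 * c z.2) := by
  have hder : ∀ z : Phase d, fderiv ℝ (fun x => P x * c z.2) z.1 (z.2.1 : Space d)
      = fderiv ℝ P z.1 (z.2.1 : Space d) * c z.2 := by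
    intro z
    rw [fderiv_mul_const ((hP.differentiable one_ne_zero) z.1)]
    simp [mul_comm]
  have hcont : Continuous fun z : Phase d => fderiv ℝ P z.1 (z.2.1 : Space d) :=
    ((hP.continuous_fderiv one_ne_zero).comp continuous_fst).clm_apply
      (continuous_subtype_val.comp (continuous_fst.comp continuous_snd))
  obtain ⟨C, hC⟩ := hcb
  obtain ⟨C1, hC1⟩ := hB.isCompact_closure.exists_bound_of_continuousOn hP.continuous.continuousOn
  obtain ⟨C2, hC2⟩ := hB.isCompact_closure.exists_bound_of_continuousOn
    (hP.continuous_fderiv one_ne_zero).continuousOn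
  refine ⟨fun y => hP.mul (contDiff_const (c := c y)),
    (hP.continuous.measurable.comp measurable_fst).mul (hc.comp measurable_snd), ?_, ?_⟩
  · simp only [hder]
    exact hcont.measurable.mul (hc.comp measurable_snd)
  · refine ⟨max (C1 * C) (C2 * C), fun z hz => ⟨?_, ?_⟩⟩
    · refine le_trans ?_ (le_max_left _ _)
      rw [abs_mul]
      exact mul_le_mul (hC1 _ (subset_closure hz)) (hC _) (abs_nonneg _)
        ((norm_nonneg _).trans (hC1 _ (subset_closure hz)))
    · refine le_trans ?_ (le_max_right _ _)
      rw [hder, abs_mul]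
      refine mul_le_mul ?_ (hC _) (abs_nonneg _)
        ((norm_nonneg _).trans (hC2 _ (subset_closure hz)))
      have h1 := (fderiv ℝ P z.1).le_opNorm (z.2.1 : Space d)
      rw [show ‖(z.2.1 : Space d)‖ = 1 by simp, mul_one] at h1
      exact h1.trans (hC2 _ (subset_closure hz))

end IsRegularOver

namespace Mesh

variable {d : ℕ} {T : Mesh d} {v : Phase d → ℝ}

theorem smul_isSpaceFE {φ : Space d → ℝ} (c : ℝ) (h : T.IsSpaceFE φ) :
    T.IsSpaceFE (fun x => c * φ x) := by
  refine ⟨fun k => ?_, fun x hx => by simp only [h.2 x hx, mul_zero]⟩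
  obtain ⟨P, hP, hPφ⟩ := h.1 k
  exact ⟨c • P, (MvPolynomial.totalDegree_smul_le _ _).trans hP, fun x hx => by
    simp [hPφ x hx, MvPolynomial.smul_eval]⟩

/-- Induction principle for the tensor product space: sums of products. -/
theorem FESpace_induction {p : (Phase d → ℝ) → Prop} (hv : v ∈ T.FESpace) (h0 : p 0)
    (hadd : ∀ v w, p v → p w → p (v + w))
    (hmul : ∀ φ ψ χ, T.IsSpaceFE φ → T.IsAngleFE ψ → T.IsEnergyFE χ →
      p fun z => φ z.1 * ψ z.2.1 * χ z.2.2) : p v := by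
  have : ∀ c : ℝ, p (c • v) := by
    refine Submodule.span_induction (p := fun v _ => ∀ c : ℝ, p (c • v)) ?_ ?_ ?_ ?_ hv
    · rintro v ⟨φ, ψ, χ, hφ, hψ, hχ, rfl⟩ c
      convert! hmul _ ψ χ (smul_isSpaceFE c hφ) hψ hχ using 1
      ext z
      simp [mul_assoc]
    · intro c; rwa [smul_zero]
    · intro v w _ _ hv hw c
      rw [smul_add]; exact hadd _ _ (hv c) (hw c)
    · intro a v _ hv c
      rw [smul_smul]; exact hv _
  simpa using this 1

/-- On the spatial element `k`, a finite element function extends to a function that is continuously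
differentiable in space, and regular over the closure of the domain. -/
theorem exists_regular_extension (hv : v ∈ T.FESpace) (k : Fin T.numSpace) :
    ∃ V, IsRegularOver (closure T.Ω) V ∧ ∀ z : Phase d, z.1 ∈ T.elem k → v z = V z := by
  refine FESpace_induction (p := fun v => ∃ V, IsRegularOver (closure T.Ω) V ∧
    ∀ z : Phase d, z.1 ∈ T.elem k → v z = V z) hv ⟨0, IsRegularOver.zero, fun _ _ => rfl⟩ ?_ ?_
  · rintro v w ⟨V, hV, hVv⟩ ⟨W, hW, hWw⟩
    exact ⟨V + W, hV.add hW, fun z hz => by simp [hVv z hz, hWw z hz]⟩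
  · intro φ ψ χ hφ hψ hχ
    obtain ⟨P, -, hP⟩ := hφ.1 k
    obtain ⟨C1, hC1⟩ := hψ.bounded
    obtain ⟨C2, hC2⟩ := hχ.bounded
    refine ⟨_, IsRegularOver.mul_const T.bounded_Ω.closure (contDiff_mvPolynomial_eval P)
      (c := fun y => ψ y.1 * χ y.2)
      ((hψ.measurable.comp measurable_fst).mul (hχ.measurable.comp measurable_snd))
      ⟨C1 * C2, fun y => ?_⟩, fun z hz => ?_⟩
    · rw [abs_mul]
      exact mul_le_mul (hC1 _) (hC2 _) (abs_nonneg _) ((abs_nonneg _).trans (hC1 y.1))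
    · simp only [hP _ hz, mul_assoc]

theorem apply_eq_zero_of_notMem_elem (hv : v ∈ T.FESpace) {z : Phase d}
    (hz : ∀ k, z.1 ∉ T.elem k) : v z = 0 := by
  refine FESpace_induction (p := fun v => v z = 0) hv rfl ?_ ?_
  · intro v w hv hw; simp [hv, hw]
  · intro φ ψ χ hφ hψ hχ; simp [hφ.2 _ hz]

theorem apply_eq_zero_of_notMem_element (hv : v ∈ T.FESpace) {z : Phase d}
    (hz : ∀ κ, z ∉ T.element κ) : v z = 0 := by
  refine FESpace_induction (p := fun v => v z = 0) hv rfl ?_ ?_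
  · intro v w hv hw; simp [hv, hw]
  · intro φ ψ χ hφ hψ hχ
    by_cases h1 : ∃ k, z.1 ∈ T.elem k
    · by_cases h2 : ∃ k, z.2.1 ∈ (T.cell k).curved
      · by_cases h3 : ∃ g, z.2.2 ∈ T.energy.group g
        · obtain ⟨k, hk⟩ := h1
          obtain ⟨l, hl⟩ := h2
          obtain ⟨g, hg⟩ := h3
          exact absurd (show z ∈ T.element (k, l, g) from ⟨hk, hl, hg⟩) (hz _)
        · push Not at h3; simp [hχ.2 _ h3]
      · push Not at h2; simp [hψ.2 _ h2]
    · push Not at h1; simp [hφ.2 _ h1]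

theorem measurableSet_elem (T : Mesh d) (k : Fin T.numSpace) : MeasurableSet (T.elem k) :=
  (T.elem_polytope k).isOpen.measurableSet

theorem measurableSet_over_elem (T : Mesh d) (k : Fin T.numSpace) :
    MeasurableSet {z : Phase d | z.1 ∈ T.elem k} :=
  measurable_fst (T.measurableSet_elem k)

theorem FE_eq_sum (hv : v ∈ T.FESpace) {V : Fin T.numSpace → Phase d → ℝ}
    (hV : ∀ k, ∀ z : Phase d, z.1 ∈ T.elem k → v z = V k z) :
    v = ∑ k, {z : Phase d | z.1 ∈ T.elem k}.indicator (V k) :=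
  eq_sum_indicator (fun k l hkl => (T.elem_disjoint k l hkl).preimage Prod.fst) hV
    fun _ hz => apply_eq_zero_of_notMem_elem hv hz

theorem FE_measurable (hv : v ∈ T.FESpace) : Measurable v := by
  choose V hV hVv using exists_regular_extension hv
  rw [FE_eq_sum hv hVv, Finset.sum_fn]
  exact Finset.measurable_sum _ fun k _ => (hV k).measurable.indicator (T.measurableSet_over_elem k)

theorem FE_bounded (hv : v ∈ T.FESpace) : ∃ C, ∀ z, |v z| ≤ C := by
  choose V hV hVv using exists_regular_extension hv
  choose C hC using fun k => (hV k).bounded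
  refine ⟨∑ k, |C k|, fun z => ?_⟩
  by_cases hz : ∃ k, z.1 ∈ T.elem k
  · obtain ⟨k, hk⟩ := hz
    rw [hVv k z hk]
    refine (((hC k z (subset_closure (T.elem_subset k hk))).1).trans (le_abs_self _)).trans ?_
    exact Finset.single_le_sum (f := fun k => |C k|) (fun _ _ => abs_nonneg _) (Finset.mem_univ k)
  · push Not at hz
    rw [apply_eq_zero_of_notMem_elem hv hz, abs_zero]
    exact Finset.sum_nonneg fun _ _ => abs_nonneg _

theorem FE_continuousOn (hv : v ∈ T.FESpace) (κ : T.Index) : ContinuousOn v (T.element κ) := by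
  refine FESpace_induction (p := fun v => ContinuousOn v (T.element κ)) hv continuousOn_const ?_ ?_
  · intro v w hv hw; exact hv.add hw
  · intro φ ψ χ hφ hψ hχ
    refine ContinuousOn.mul (ContinuousOn.mul ?_ ?_) ?_
    · exact (hφ.continuousOn κ.1).comp continuousOn_fst fun z hz => hz.1
    · exact (hψ.continuousOn κ.2.1).comp (continuous_fst.comp continuous_snd).continuousOn
        fun z hz => hz.2.1
    · exact (hχ.continuousOn κ.2.2).comp (continuous_snd.comp continuous_snd).continuousOn
        fun z hz => hz.2.2

/-- A finite element function that vanishes almost everywhere vanishes identically. -/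
theorem FE_eq_zero_of_ae (hv : v ∈ T.FESpace) (h : ∀ᵐ z ∂T.phaseMeasure, v z = 0) : v = 0 := by
  ext z
  by_contra hz
  have hz : v z ≠ 0 := hz
  obtain ⟨κ, hκ⟩ : ∃ κ, z ∈ T.element κ := by
    by_contra! hn
    exact hz (apply_eq_zero_of_notMem_element hv hn)
  obtain ⟨hk, hl, hg⟩ := hκ
  have h1 : ∀ᶠ w in 𝓝[T.element κ] z, v w ≠ 0 :=
    (FE_continuousOn hv κ z ⟨hk, hl, hg⟩).eventually_ne hz
  obtain ⟨O, hO, hOs⟩ := mem_nhdsWithin_iff_exists_mem_nhds_inter.1 h1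
  obtain ⟨A, hA, O', hO', hAO⟩ := mem_nhds_prod_iff.1 hO
  obtain ⟨B, hB, C, hC, hBC⟩ := mem_nhds_prod_iff.1 hO'
  have hsub : (T.elem κ.1 ∩ A) ×ˢ ((T.cell κ.2.1).curved ∩ B) ×ˢ (T.energy.group κ.2.2 ∩ C)
      ⊆ {w | v w = 0}ᶜ := by
    rintro w ⟨hw1, hw2, hw3⟩
    exact hOs ⟨hAO ⟨hw1.2, hBC ⟨hw2.2, hw3.2⟩⟩, hw1.1, hw2.1, hw3.1⟩
  have h0 := measure_mono_null hsub (ae_iff.1 h : T.phaseMeasure {w | v w = 0}ᶜ = 0)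
  rw [phaseMeasure, angleEnergyMeasure, Measure.prod_prod, Measure.prod_prod] at h0
  have hp1 : 0 < (volume.restrict T.Ω) (T.elem κ.1 ∩ A) := by
    rw [Measure.restrict_eq_self _ (inter_subset_left.trans (T.elem_subset _))]
    exact Measure.measure_pos_of_mem_nhds _
      (Filter.inter_mem ((T.elem_polytope κ.1).isOpen.mem_nhds hk) hA)
  have hp2 : 0 < sphereMeasure d ((T.cell κ.2.1).curved ∩ B) := by
    exact Measure.measure_pos_of_mem_nhds _
      (Filter.inter_mem ((T.cell κ.2.1).isOpen_curved.mem_nhds hl) hB)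
  have hp3 := T.energy.measure_group_inter_pos hg hC
  exact (ENNReal.mul_pos hp1.ne' (ENNReal.mul_pos hp2.ne' hp3.ne').ne').ne' h0

/-! ### Finite dimension of the finite element space -/

/-- Functions that are piecewise the image of a finite-dimensional space form a finite-dimensional
space. -/
theorem exists_fg_of_piecewise {X M ι : Type*} [Fintype ι] [AddCommGroup M] [Module ℝ M]
    {W : Submodule ℝ M} (hW : W.FG) (E : ι → M →ₗ[ℝ] (X → ℝ)) :
    ∃ A : Submodule ℝ (X → ℝ), A.FG ∧ ∀ P : ι → M, (∀ k, P k ∈ W) → ∑ k, E k (P k) ∈ A :=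
  ⟨⨆ k, W.map (E k), Submodule.fg_iSup _ fun _ => hW.map _, fun _ hP =>
    Submodule.sum_mem _ fun k _ => Submodule.mem_iSup_of_mem k (Submodule.mem_map_of_mem (hP k))⟩

/-- Restriction to `S` of the pull-back by `e`, as a linear map. -/
noncomputable def indicatorPull {X M : Type*} [AddCommGroup M] [Module ℝ M] (S : Set X)
    (e : X → M →ₗ[ℝ] ℝ) : M →ₗ[ℝ] (X → ℝ) where
  toFun P := S.indicator fun x => e x P
  map_add' P Q := by
    ext x; by_cases hx : x ∈ S <;> simp [hx]
  map_smul' c P := by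
    ext x; by_cases hx : x ∈ S <;> simp [hx]

theorem fg_mvPolynomial (d n : ℕ) : ∃ W : Submodule ℝ (MvPolynomial (Fin d) ℝ), W.FG ∧
    ∀ P : MvPolynomial (Fin d) ℝ, (∀ j, P.degreeOf j ≤ n) → P ∈ W := by
  set S : Set (Fin d →₀ ℕ) := Iic (Finsupp.equivFunOnFinite.symm fun _ => n) with hS
  refine ⟨MvPolynomial.restrictSupport ℝ S, ?_, fun P hP => ?_⟩
  · rw [MvPolynomial.restrictSupport_eq_span]
    exact Submodule.fg_span ((Set.finite_Iic _).image _)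
  · rw [MvPolynomial.mem_restrictSupport_iff]
    intro s hs j
    exact MvPolynomial.degreeOf_le_iff.1 (hP j) s hs

theorem fg_polynomial (n : ℕ) : ∃ W : Submodule ℝ (Polynomial ℝ), W.FG ∧
    ∀ P : Polynomial ℝ, P.natDegree ≤ n → P ∈ W := by
  classical
  refine ⟨Polynomial.degreeLT ℝ (n + 1), ?_, fun P hP => ?_⟩
  · rw [Polynomial.degreeLT_eq_span_X_pow]
    exact Submodule.fg_span (Finset.finite_toSet _)
  · rw [Polynomial.mem_degreeLT]
    exact (Polynomial.degree_le_natDegree).trans_lt (by exact_mod_cast Nat.lt_succ_of_le hP)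

/-- The tensor product space is contained in the pointwise product of three finite-dimensional
spaces of functions. -/
theorem FESpace_fg (T : Mesh d) : T.FESpace.FG := by
  obtain ⟨W1, hW1, hW1'⟩ := fg_mvPolynomial d T.p
  obtain ⟨W2, hW2, hW2'⟩ := fg_mvPolynomial d T.q
  obtain ⟨W3, hW3, hW3'⟩ := fg_polynomial T.energy.degree
  obtain ⟨A1, hA1, hA1'⟩ := exists_fg_of_piecewise hW1 fun k : Fin T.numSpace =>
    indicatorPull (T.elem k) fun x => (MvPolynomial.aeval fun i => x i).toLinearMap
  obtain ⟨A2, hA2, hA2'⟩ := exists_fg_of_piecewise hW2 fun k : Fin T.numAngle =>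
    indicatorPull (T.cell k).curved fun ω =>
      (MvPolynomial.aeval fun i => cubePull (T.cell k).axis ω i).toLinearMap
  obtain ⟨A3, hA3, hA3'⟩ := exists_fg_of_piecewise hW3 fun g : Fin T.energy.numGroups =>
    indicatorPull (T.energy.group g) fun E => (Polynomial.aeval E).toLinearMap
  have hfg : (A1.map (LinearMap.funLeft ℝ ℝ (Prod.fst : Phase d → _)) *
      A2.map (LinearMap.funLeft ℝ ℝ fun z : Phase d => z.2.1) *
      A3.map (LinearMap.funLeft ℝ ℝ fun z : Phase d => z.2.2)).FG :=
    ((hA1.map _).mul (hA2.map _)).mul (hA3.map _)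
  refine Submodule.FG.of_le hfg (Submodule.span_le.2 ?_)
  rintro v ⟨φ, ψ, χ, hφ, hψ, hχ, rfl⟩
  refine Submodule.mul_mem_mul (Submodule.mul_mem_mul ?_ ?_) ?_
  · refine Submodule.mem_map_of_mem (f := LinearMap.funLeft ℝ ℝ (Prod.fst : Phase d → _)) ?_
    obtain ⟨P, hP, rfl⟩ := hφ.eq_sum
    exact hA1' P fun k => hW1' _ fun j => (MvPolynomial.degreeOf_le_totalDegree _ _).trans (hP k)
  · refine Submodule.mem_map_of_mem (f := LinearMap.funLeft ℝ ℝ fun z : Phase d => z.2.1) ?_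
    obtain ⟨P, hP, rfl⟩ := hψ.eq_sum
    exact hA2' P fun k => hW2' _ (hP k)
  · refine Submodule.mem_map_of_mem (f := LinearMap.funLeft ℝ ℝ fun z : Phase d => z.2.2) ?_
    obtain ⟨P, hP, rfl⟩ := hχ.eq_sum
    exact hA3' P fun k => hW3' _ (hP k)

end Mesh

/-! ### Interfaces between elements -/

section Neighbours

variable {d : ℕ} {K L : Set (Space d)} {x n n' : Space d}

/-- Disjoint sets have opposite normals at common face points. -/
theorem IsOutwardNormal.eq_neg_of_disjoint (h : IsOutwardNormal K x n)
    (h' : IsOutwardNormal L x n') (hd : Disjoint K L) : n' = -n := by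
  by_contra hne
  have hlt : -1 < ⟪n, n'⟫ := by
    have h1 : ⟪n', -n⟫ < 1 :=
      (inner_lt_one_iff_real_of_norm_eq_one h'.1 (by rw [norm_neg, h.1])).2 hne
    rw [inner_neg_right, real_inner_comm] at h1
    linarith
  have hc : Filter.Tendsto (fun ε : ℝ => x - ε • (n + n')) (𝓝[>] 0) (𝓝 x) := by
    have : Continuous fun ε : ℝ => x - ε • (n + n') := by fun_prop
    simpa using (this.tendsto 0).mono_left nhdsWithin_le_nhds
  obtain ⟨ε, ⟨h2, h3⟩, hε⟩ := ((hc.eventually (h.2.and h'.2)).and self_mem_nhdsWithin).exists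
  have hε : 0 < ε := hε
  have h4 := real_inner_comm n n'
  simp only [sub_sub_cancel_left, inner_neg_right, inner_smul_right, inner_add_right,
    real_inner_self_eq_norm_sq, h.1, h'.1] at h2 h3
  refine Set.disjoint_left.1 hd (h2.2 ?_) (h3.2 ?_)
  · nlinarith
  · rw [h4]; nlinarith

/-- Near a common face point of two disjoint sets there is no room for a third one. -/
theorem IsOutwardNormal.eventually_notMem {M : Set (Space d)} (h : IsOutwardNormal K x n)
    (h' : IsOutwardNormal L x n') (hd : Disjoint K L) (hM : IsOpen M) (hKM : Disjoint K M)
    (hLM : Disjoint L M) : ∀ᶠ y in 𝓝 x, y ∉ M := by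
  have hn := h.eq_neg_of_disjoint h' hd
  filter_upwards [h.2.eventually_nhds, h'.2.eventually_nhds] with y hy hy' hyM
  have h0 : ∀ w, (w ∈ K ↔ ⟪n, w - x⟫ < 0) → (w ∈ L ↔ ⟪n', w - x⟫ < 0) → w ∈ M →
      ⟪n, w - x⟫ = 0 := by
    intro w hw hw' hwM
    rw [hn, inner_neg_left, neg_lt_zero] at hw'
    refine le_antisymm (not_lt.1 fun hpos => ?_) (not_lt.1 fun hneg => ?_)
    · exact Set.disjoint_left.1 hLM (hw'.2 hpos) hwM
    · exact Set.disjoint_left.1 hKM (hw.2 hneg) hwM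
  have hc : Filter.Tendsto (fun ε : ℝ => y + ε • n) (𝓝[>] 0) (𝓝 y) := by
    have : Continuous fun ε : ℝ => y + ε • n := by fun_prop
    simpa using (this.tendsto 0).mono_left nhdsWithin_le_nhds
  obtain ⟨ε, ⟨⟨h1, h2⟩, h3⟩, hε⟩ := ((hc.eventually ((hy.and hy').and
    (hM.eventually_mem hyM))).and self_mem_nhdsWithin).exists
  have hε : 0 < ε := hε
  have h4 := h0 _ h1 h2 h3
  have h5 := h0 y hy.self_of_nhds hy'.self_of_nhds hyM
  rw [show y + ε • n - x = (y - x) + ε • n by abel, inner_add_right, h5, inner_smul_right,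
    real_inner_self_eq_norm_sq, h.1] at h4
  linarith

end Neighbours

namespace Mesh

variable {d : ℕ} {T : Mesh d}

theorem isOpen_elem (T : Mesh d) (k : Fin T.numSpace) : IsOpen (T.elem k) :=
  (T.elem_polytope k).isOpen

theorem faces_subset_closure (T : Mesh d) (k : Fin T.numSpace) :
    faces (T.elem k) ⊆ closure T.Ω :=
  (faces_subset_frontier (T.isOpen_elem k)).trans
    (frontier_subset_closure.trans (closure_mono (T.elem_subset k)))

theorem eq_neg_normal {k l : Fin T.numSpace} (hkl : k ≠ l) {x : Space d}
    (hk : x ∈ faces (T.elem k)) (hl : x ∈ faces (T.elem l)) :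
    normal (T.elem l) x = -normal (T.elem k) x :=
  (isOutwardNormal_normal hk).eq_neg_of_disjoint (isOutwardNormal_normal hl)
    (T.elem_disjoint k l hkl)

theorem eventually_notMem_elem {k l j : Fin T.numSpace} (hkl : k ≠ l) (hjk : j ≠ k) (hjl : j ≠ l)
    {x : Space d} (hk : x ∈ faces (T.elem k)) (hl : x ∈ faces (T.elem l)) :
    ∀ᶠ y in 𝓝 x, y ∉ T.elem j :=
  (isOutwardNormal_normal hk).eventually_notMem (isOutwardNormal_normal hl)
    (T.elem_disjoint k l hkl) (T.isOpen_elem j) (T.elem_disjoint k j hjk.symm)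
    (T.elem_disjoint l j hjl.symm)

/-- At most two elements meet at a face point. -/
theorem notMem_faces_third {k l j : Fin T.numSpace} (hkl : k ≠ l) (hjk : j ≠ k) (hjl : j ≠ l)
    {x : Space d} (hk : x ∈ faces (T.elem k)) (hl : x ∈ faces (T.elem l)) :
    x ∉ faces (T.elem j) := fun hj => by
  obtain ⟨y, hy, hy'⟩ := ((mem_closure_iff_frequently.1
    (isOutwardNormal_normal hj).mem_closure).and_eventually
    (eventually_notMem_elem hkl hjk hjl hk hl)).exists
  exact hy' hy

/-! ### Traces -/

/-- A family of extensions of the restrictions of `v` to the spatial elements. -/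
def IsRep (T : Mesh d) (v : Phase d → ℝ) (V : Fin T.numSpace → Phase d → ℝ) : Prop :=
  ∀ k, IsRegularOver (closure T.Ω) (V k) ∧ ∀ z : Phase d, z.1 ∈ T.elem k → v z = V k z

theorem exists_isRep {v : Phase d → ℝ} (hv : v ∈ T.FESpace) : ∃ V, T.IsRep v V := by
  choose V hV using exists_regular_extension hv
  exact ⟨V, hV⟩

variable {v w : Phase d → ℝ} {V W : Fin T.numSpace → Phase d → ℝ}

theorem IsRep.add (hv : T.IsRep v V) (hw : T.IsRep w W) : T.IsRep (v + w) (V + W) := fun k =>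
  ⟨(hv k).1.add (hw k).1, fun z hz => by
    rw [Pi.add_apply, (hv k).2 z hz, (hw k).2 z hz]; rfl⟩

theorem IsRep.smul (hv : T.IsRep v V) (c : ℝ) : T.IsRep (c • v) (c • V) := fun k =>
  ⟨(hv k).1.smul c, fun z hz => by rw [Pi.smul_apply, (hv k).2 z hz]; rfl⟩

/-- The set of phase points over the faces of an element. -/
def overFaces (T : Mesh d) (k : Fin T.numSpace) : Set (Phase d) := {z | z.1 ∈ faces (T.elem k)}

theorem measurableSet_overFaces (T : Mesh d) (k : Fin T.numSpace) :
    MeasurableSet (T.overFaces k) :=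
  measurable_fst (measurableSet_faces (T.isOpen_elem k))

theorem measurableSet_boundary (T : Mesh d) : MeasurableSet T.boundary :=
  measurable_fst isClosed_frontier.measurableSet

theorem measurable_flux (T : Mesh d) (k : Fin T.numSpace) : Measurable (T.flux k) := by
  unfold flux
  exact (measurable_subtype_coe.comp (measurable_fst.comp measurable_snd)).inner
    ((measurable_normal (T.isOpen_elem k)).comp measurable_fst)

theorem abs_flux_le_one (T : Mesh d) (k : Fin T.numSpace) (z : Phase d) : |T.flux k z| ≤ 1 := by
  refine (abs_real_inner_le_norm _ _).trans ?_
  rw [show ‖(z.2.1 : Space d)‖ = 1 by simp, one_mul]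
  exact norm_normal_le_one _ _

theorem measurableSet_inflow (T : Mesh d) (k : Fin T.numSpace) : MeasurableSet (T.inflow k) :=
  (T.measurableSet_overFaces k).inter (T.measurable_flux k measurableSet_Iio)

theorem measurableSet_outflow (T : Mesh d) (k : Fin T.numSpace) : MeasurableSet (T.outflow k) :=
  (T.measurableSet_overFaces k).inter (T.measurable_flux k measurableSet_Ici)

theorem inflow_subset (T : Mesh d) (k : Fin T.numSpace) : T.inflow k ⊆ T.overFaces k :=
  fun _ h => h.1

theorem outflow_subset (T : Mesh d) (k : Fin T.numSpace) : T.outflow k ⊆ T.overFaces k :=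
  fun _ h => h.1

theorem traceInt_eq (hv : T.IsRep v V) {k : Fin T.numSpace} {z : Phase d}
    (hz : z ∈ T.overFaces k) : T.traceInt k v z = V k z := by
  refine extendFrom_eq (isOutwardNormal_normal hz).mem_closure ?_
  refine Filter.Tendsto.congr' ?_ (((hv k).1.contDiff z.2).continuous.continuousAt.mono_left
    nhdsWithin_le_nhds)
  filter_upwards [self_mem_nhdsWithin] with x hx
  exact ((hv k).2 (x, z.2) hx).symm

theorem traceExt_eq (hv : T.IsRep v V) {k l : Fin T.numSpace} (hkl : k ≠ l) {z : Phase d}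
    (hk : z ∈ T.overFaces k) (hl : z ∈ T.overFaces l) : T.traceExt k v z = V l z := by
  refine extendFrom_eq (closure_mono (subset_biUnion_of_mem (u := T.elem) (x := l) hkl.symm)
    (isOutwardNormal_normal hl).mem_closure) ?_
  refine Filter.Tendsto.congr' ?_ (((hv l).1.contDiff z.2).continuous.continuousAt.mono_left
    nhdsWithin_le_nhds)
  have h1 : ∀ᶠ x in 𝓝 z.1, ∀ j, j ≠ k → j ≠ l → x ∉ T.elem j := by
    refine Filter.eventually_all.2 fun j => ?_
    by_cases hjk : j = k
    · exact Filter.Eventually.of_forall fun _ h => absurd hjk h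
    by_cases hjl : j = l
    · exact Filter.Eventually.of_forall fun _ _ h => absurd hjl h
    filter_upwards [eventually_notMem_elem hkl hjk hjl hk hl] with x hx _ _ using hx
  filter_upwards [self_mem_nhdsWithin, h1.filter_mono nhdsWithin_le_nhds] with x hx hx1
  obtain ⟨j, hj, hxj⟩ := mem_iUnion₂.1 hx
  by_cases hjl : j = l
  · subst hjl; exact ((hv j).2 (x, z.2) hxj).symm
  · exact absurd hxj (hx1 j hj hjl)

open Classical in
/-- A measurable expression for the exterior trace: the extension from the neighbouring element. -/
noncomputable def extTrace (T : Mesh d) (V : Fin T.numSpace → Phase d → ℝ) (k : Fin T.numSpace)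
    (z : Phase d) : ℝ :=
  ∑ l, if l ≠ k then (T.overFaces l).indicator (V l) z else 0

theorem extTrace_eq {k l : Fin T.numSpace} (hkl : k ≠ l) {z : Phase d}
    (hk : z ∈ T.overFaces k) (hl : z ∈ T.overFaces l) : T.extTrace V k z = V l z := by
  rw [extTrace, Finset.sum_eq_single l]
  · rw [if_pos hkl.symm, indicator_of_mem hl]
  · intro j _ hjl
    split_ifs with hjk
    · have h1 : z ∉ T.overFaces j := notMem_faces_third hkl hjk hjl hk hl
      rw [indicator_of_notMem h1]
    · rfl
  · simp

theorem measurable_extTrace (hv : T.IsRep v V) (k : Fin T.numSpace) :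
    Measurable (T.extTrace V k) := by
  unfold extTrace
  refine Finset.measurable_sum _ fun l _ => ?_
  by_cases hlk : l = k
  · simp only [hlk, ne_eq, not_true_eq_false, if_false]; exact measurable_const
  · simp only [hlk, ne_eq, not_false_eq_true, if_true]
    exact (hv l).1.measurable.indicator (T.measurableSet_overFaces l)

/-- A common bound for the extensions and their derivatives over the spatial domain. -/
theorem IsRep.exists_bound (hv : T.IsRep v V) : ∃ C, 0 ≤ C ∧ ∀ k, ∀ z : Phase d,
    z.1 ∈ closure T.Ω → |V k z| ≤ C ∧
      |fderiv ℝ (fun x => V k (x, z.2)) z.1 (z.2.1 : Space d)| ≤ C := by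
  choose C hC using fun k => (hv k).1.bounded
  have hle : ∀ k, C k ≤ ∑ k, |C k| := fun k => (le_abs_self _).trans
    (Finset.single_le_sum (f := fun k => |C k|) (fun _ _ => abs_nonneg _) (Finset.mem_univ k))
  exact ⟨∑ k, |C k|, Finset.sum_nonneg fun _ _ => abs_nonneg _, fun k z hz =>
    ⟨((hC k z hz).1).trans (hle k), ((hC k z hz).2).trans (hle k)⟩⟩

theorem extTrace_bounded (hv : T.IsRep v V) (k : Fin T.numSpace) :
    ∃ C, ∀ z, |T.extTrace V k z| ≤ C := by
  obtain ⟨C, hC0, hC⟩ := hv.exists_bound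
  refine ⟨∑ l : Fin T.numSpace, C, fun z => ?_⟩
  refine (Finset.abs_sum_le_sum_abs _ _).trans (Finset.sum_le_sum fun l _ => ?_)
  split_ifs
  · by_cases hz : z ∈ T.overFaces l
    · rw [indicator_of_mem hz]
      exact (hC l z (T.faces_subset_closure l hz)).1
    · rw [indicator_of_notMem hz, abs_zero]; exact hC0
  · rw [abs_zero]; exact hC0

theorem extTrace_add (V W : Fin T.numSpace → Phase d → ℝ) (k : Fin T.numSpace) (z : Phase d) :
    T.extTrace (V + W) k z = T.extTrace V k z + T.extTrace W k z := by
  rw [extTrace, extTrace, extTrace, ← Finset.sum_add_distrib]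
  refine Finset.sum_congr rfl fun l _ => ?_
  split_ifs
  · by_cases hz : z ∈ T.overFaces l <;> simp [hz]
  · simp

theorem extTrace_smul (c : ℝ) (V : Fin T.numSpace → Phase d → ℝ) (k : Fin T.numSpace)
    (z : Phase d) : T.extTrace (c • V) k z = c * T.extTrace V k z := by
  rw [extTrace, extTrace, Finset.mul_sum]
  refine Finset.sum_congr rfl fun l _ => ?_
  split_ifs
  · by_cases hz : z ∈ T.overFaces l <;> simp [hz]
  · simp

end Mesh

/-! ### The measure on the mesh skeleton -/

namespace Mesh

/-- The measure `ds dμ dE` over the union of all faces. -/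
noncomputable def skeletonMeasure {d : ℕ} (T : Mesh d) : Measure (Phase d) :=
  ((μHE[d - 1] : Measure (Space d)).restrict (⋃ k, faces (T.elem k))).prod T.angleEnergyMeasure

variable {m : ℕ} {T : Mesh (m + 1)}

instance (T : Mesh (m + 1)) : IsFiniteMeasure
    ((μHE[m + 1 - 1] : Measure (Space (m + 1))).restrict (⋃ k, faces (T.elem k))) := by
  obtain ⟨H, hH, -, hfr⟩ := exists_arrangement T.elem_polytope
  refine isFiniteMeasure_restrict.2 (ne_of_lt ?_)
  refine (measure_iUnion_fintype_le _ _).trans_lt (ENNReal.sum_lt_top.2 fun k _ => ?_)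
  exact measure_faces_lt_top (T.isOpen_elem k) (T.elem_polytope k).bounded hH (hfr k)

instance (T : Mesh (m + 1)) : IsFiniteMeasure T.skeletonMeasure := by
  unfold skeletonMeasure; infer_instance

theorem faceMeasure_eq_restrict (T : Mesh (m + 1)) (k : Fin T.numSpace) :
    T.faceMeasure k = T.skeletonMeasure.restrict (T.overFaces k) := by
  have h1 : T.overFaces k = faces (T.elem k) ×ˢ (univ : Set (Direction (m + 1) × ℝ)) := by
    ext z; simp [overFaces]
  rw [faceMeasure, skeletonMeasure, h1, ← Measure.prod_restrict, Measure.restrict_univ,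
    Measure.restrict_restrict (measurableSet_faces (T.isOpen_elem k)),
    inter_eq_self_of_subset_left (subset_iUnion (fun k => faces (T.elem k)) k)]

theorem faceMeasure_restrict (T : Mesh (m + 1)) {k : Fin T.numSpace} {S : Set (Phase (m + 1))}
    (hS : MeasurableSet S) (hSk : S ⊆ T.overFaces k) :
    (T.faceMeasure k).restrict S = T.skeletonMeasure.restrict S := by
  rw [faceMeasure_eq_restrict, Measure.restrict_restrict hS, inter_eq_self_of_subset_left hSk]

/-- Almost every face point inside the domain belongs to the faces of a second element. -/
theorem ae_exists_neighbour (T : Mesh (m + 1)) : ∀ᵐ z ∂T.skeletonMeasure, ∀ k,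
    z ∈ T.overFaces k → z ∉ T.boundary → ∃ l, l ≠ k ∧ z ∈ T.overFaces l := by
  obtain ⟨H, hH, hinj, hfr⟩ := exists_arrangement T.elem_polytope
  have key : ∀ᵐ x ∂(μHE[m] : Measure (Space (m + 1))), ∀ k, x ∈ faces (T.elem k) →
      x ∉ frontier T.Ω → ∃ l, l ≠ k ∧ x ∈ faces (T.elem l) := by
    filter_upwards [ae_notMem_others hH hinj] with x hx k hk hxΩ
    by_contra! hno
    have hn := isOutwardNormal_normal hk
    have hkf := faces_subset_frontier (T.isOpen_elem k) hk
    obtain ⟨h, hh, hxh⟩ := mem_iUnion₂.1 (hfr k hkf)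
    have hxmem : x ∈ T.Ω := by
      by_contra h0
      exact hxΩ (by rw [T.isOpen_Ω.frontier_eq]; exact ⟨T.faces_subset_closure k hk, h0⟩)
    have hempty : ∀ᶠ y in 𝓝 x, ∀ l, l ≠ k → y ∉ T.elem l := by
      refine Filter.eventually_all.2 fun l => ?_
      by_cases hlk : l = k
      · exact Filter.Eventually.of_forall fun _ h => absurd hlk h
      have hcase := local_structure (x := x) (T.isOpen_elem l) (T.elem_polytope l).regular (hH h hh)
        ((eventually_mem_plane_of_notMem_others (hfr l) fun j hj hjh => hx h hh hxh j hj hjh).mono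
        fun z hz hzf => by
          have h1 : ⟪h.1, z⟫ = h.2 := hz hzf
          have h2 : ⟪h.1, x⟫ = h.2 := hxh
          rw [inner_sub_right, h1, h2, sub_self])
      rcases hcase with hc | hc | hc | hc
      · exact hc.mono fun y hy _ => hy
      · obtain ⟨y, hy, hy'⟩ :=
          ((mem_closure_iff_frequently.1 hn.mem_closure).and_eventually hc).exists
        exact absurd hy' (Set.disjoint_left.1 (T.elem_disjoint k l (Ne.symm hlk)) hy)
      · exact absurd ⟨_, hc⟩ (hno l hlk)
      · exact absurd ⟨_, hc⟩ (hno l hlk)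
    -- The outer side of the face is not covered by the closures of the elements.
    have hc : Filter.Tendsto (fun ε : ℝ => x + ε • normal (T.elem k) x) (𝓝[>] 0) (𝓝 x) := by
      have : Continuous fun ε : ℝ => x + ε • normal (T.elem k) x := by fun_prop
      simpa using (this.tendsto 0).mono_left nhdsWithin_le_nhds
    obtain ⟨ε, ⟨⟨h1, h2⟩, h3⟩, hε⟩ := ((hc.eventually ((hempty.eventually_nhds.and
      hn.2.eventually_nhds).and (T.isOpen_Ω.eventually_mem hxmem))).and self_mem_nhdsWithin).exists
    have hε : 0 < ε := hε
    have h4 : x + ε • normal (T.elem k) x ∈ ⋃ l, closure (T.elem l) := by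
      rw [← T.elem_cover]; exact subset_closure h3
    obtain ⟨l, hl⟩ := mem_iUnion.1 h4
    by_cases hlk : l = k
    · subst hlk
      have hpos : ∀ᶠ y in 𝓝 (x + ε • normal (T.elem l) x), 0 < ⟪normal (T.elem l) x, y - x⟫ := by
        refine (by fun_prop : Continuous fun y =>
          ⟪normal (T.elem l) x, y - x⟫).continuousAt.eventually (lt_mem_nhds ?_)
        simp only [add_sub_cancel_left, inner_smul_right, real_inner_self_eq_norm_sq, hn.1]
        linarith
      obtain ⟨y, hy, hy1, hy2⟩ :=
        ((mem_closure_iff_frequently.1 hl).and_eventually (h2.and hpos)).exists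
      exact absurd (hy1.1 hy) (not_lt.2 hy2.le)
    · obtain ⟨y, hy, hy'⟩ := ((mem_closure_iff_frequently.1 hl).and_eventually h1).exists
      exact hy' l hlk hy
  have key' : ∀ᵐ x ∂((μHE[m + 1 - 1] : Measure (Space (m + 1))).restrict
      (⋃ k, faces (T.elem k))), ∀ k, x ∈ faces (T.elem k) →
      x ∉ frontier T.Ω → ∃ l, l ≠ k ∧ x ∈ faces (T.elem l) := ae_restrict_of_ae key
  exact Measure.quasiMeasurePreserving_fst.ae key'

theorem ae_traceExt_eq {v : Phase (m + 1) → ℝ} {V : Fin T.numSpace → Phase (m + 1) → ℝ}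
    (hv : T.IsRep v V) (k : Fin T.numSpace) : ∀ᵐ z ∂T.skeletonMeasure,
      z ∈ T.inflow k \ T.boundary → T.traceExt k v z = T.extTrace V k z := by
  filter_upwards [T.ae_exists_neighbour] with z hz hzk
  obtain ⟨l, hlk, hzl⟩ := hz k hzk.1.1 hzk.2
  rw [traceExt_eq hv hlk.symm hzk.1.1 hzl, extTrace_eq hlk.symm hzk.1.1 hzl]

theorem integrableOn_skeleton {f : Phase (m + 1) → ℝ} {S : Set (Phase (m + 1))}
    (hS : MeasurableSet S) (hf : Measurable f) (hb : ∃ C, ∀ z ∈ S, |f z| ≤ C) :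
    IntegrableOn f S T.skeletonMeasure := by
  obtain ⟨C, hC⟩ := hb
  exact Measure.integrableOn_of_bounded (M := C) (measure_ne_top _ _) hf.aestronglyMeasurable
    ((ae_restrict_iff' hS).2 (Filter.Eventually.of_forall hC))

end Mesh

/-! ### The transport form and the load functional -/

theorem integrable_mul_of_bounded {X : Type*} [MeasurableSpace X] {μ : Measure X} {f g : X → ℝ}
    (hf : Integrable f μ) (hg : AEStronglyMeasurable g μ) (hb : ∃ C, ∀ᵐ x ∂μ, |g x| ≤ C) :
    Integrable (fun x => f x * g x) μ := by
  obtain ⟨C, hC⟩ := hb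
  exact hf.mul_bdd hg hC

namespace Mesh

variable {d : ℕ}

theorem volume_Ω_lt_top (T : Mesh d) : volume T.Ω < ⊤ := T.bounded_Ω.measure_lt_top

instance (T : Mesh d) : IsFiniteMeasure (volume.restrict T.Ω) :=
  isFiniteMeasure_restrict.2 T.volume_Ω_lt_top.ne

instance (T : Mesh d) : IsFiniteMeasure T.phaseMeasure := by
  unfold phaseMeasure; infer_instance

theorem phaseMeasure_restrict_elem (T : Mesh d) (k : Fin T.numSpace) :
    T.phaseMeasure.restrict {z : Phase d | z.1 ∈ T.elem k}
      = (volume.restrict (T.elem k)).prod T.angleEnergyMeasure := by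
  have h1 : {z : Phase d | z.1 ∈ T.elem k}
      = T.elem k ×ˢ (univ : Set (Direction d × ℝ)) := by ext z; simp
  rw [phaseMeasure, h1, ← Measure.prod_restrict, Measure.restrict_univ,
    Measure.restrict_restrict (T.measurableSet_elem k),
    inter_eq_self_of_subset_left (T.elem_subset k)]

theorem mem_closure_of_mem_elem (T : Mesh d) {k : Fin T.numSpace} {z : Phase d}
    (hz : z.1 ∈ T.elem k) : z.1 ∈ closure T.Ω := subset_closure (T.elem_subset k hz)

end Mesh

namespace Data

variable {d : ℕ} {D : Data d} {T : Mesh d}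

theorem IsAdmissible.integrable_β (hD : D.IsAdmissible T) : Integrable (D.β T) T.phaseMeasure :=
  hD.θ_integrable.integral_prod_left

end Data

namespace Data

variable {m : ℕ} (D : Data (m + 1)) (T : Mesh (m + 1))

/-- The transport form in terms of extensions `W k`, `V k` from the elements: all traces are
replaced by measurable functions. -/
noncomputable def aRep (W V : Fin T.numSpace → Phase (m + 1) → ℝ) : ℝ :=
  ∑ k : Fin T.numSpace,
    ((∫ z in {z : Phase (m + 1) | z.1 ∈ T.elem k},
        (-(W k z * fderiv ℝ (fun x => V k (x, z.2)) z.1 (z.2.1 : Space (m + 1)))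
          + (D.α z.1 z.2.2 + D.β T z) * (W k z * V k z)) ∂T.phaseMeasure)
      + (∫ z in T.outflow k, |T.flux k z| * W k z * V k z ∂T.skeletonMeasure)
      - (∫ z in T.inflow k \ T.boundary,
          |T.flux k z| * T.extTrace W k z * V k z ∂T.skeletonMeasure))

/-- The load functional in terms of extensions from the elements. -/
noncomputable def ℓRep (V : Fin T.numSpace → Phase (m + 1) → ℝ) : ℝ :=
  ∑ k : Fin T.numSpace,
    ((∫ z in {z : Phase (m + 1) | z.1 ∈ T.elem k}, D.f z * V k z ∂T.phaseMeasure)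
      + (∫ z in T.inflow k ∩ T.boundary, |T.flux k z| * D.gD z * V k z ∂T.skeletonMeasure))

variable {D T} {v w : Phase (m + 1) → ℝ} {V W U : Fin T.numSpace → Phase (m + 1) → ℝ}

/-- The exterior trace occurs only on interior faces, where almost every point has a neighbouring
element; there `extTrace` computes it. -/
theorem a_eq_aRep (hw : T.IsRep w W) (hv : T.IsRep v V) : D.a T w v = D.aRep T W V := by
  refine Finset.sum_congr rfl fun k _ => ?_
  congr 1
  · congr 1
    · refine setIntegral_congr_fun (T.measurableSet_over_elem k) fun z hz => ?_
      have h1 : (fun x => v (x, z.2)) =ᶠ[𝓝 z.1] fun x => V k (x, z.2) := by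
        filter_upwards [(T.isOpen_elem k).mem_nhds hz] with x hx
        exact (hv k).2 (x, z.2) hx
      simp only [h1.fderiv_eq, (hw k).2 z hz, (hv k).2 z hz, mul_assoc]
    · rw [T.faceMeasure_restrict (T.measurableSet_outflow k) (T.outflow_subset k)]
      refine setIntegral_congr_fun (T.measurableSet_outflow k) fun z hz => ?_
      simp only [Mesh.traceInt_eq hw (T.outflow_subset k hz),
        Mesh.traceInt_eq hv (T.outflow_subset k hz)]
  · have hm := (T.measurableSet_inflow k).diff T.measurableSet_boundary
    rw [T.faceMeasure_restrict hm (sdiff_subset.trans (T.inflow_subset k))]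
    refine setIntegral_congr_ae hm ?_
    filter_upwards [Mesh.ae_traceExt_eq hw k] with z hz hzk
    rw [hz hzk, Mesh.traceInt_eq hv (T.inflow_subset k hzk.1)]

theorem ℓ_eq_ℓRep (hv : T.IsRep v V) : D.ℓ T v = D.ℓRep T V := by
  refine Finset.sum_congr rfl fun k _ => ?_
  congr 1
  · refine setIntegral_congr_fun (T.measurableSet_over_elem k) fun z hz => ?_
    simp only [(hv k).2 z hz]
  · have hm := (T.measurableSet_inflow k).inter T.measurableSet_boundary
    rw [T.faceMeasure_restrict hm (inter_subset_left.trans (T.inflow_subset k))]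
    refine setIntegral_congr_fun hm fun z hz => ?_
    simp only [Mesh.traceInt_eq hv (T.inflow_subset k hz.1)]

theorem integrableOn_elem (hw : T.IsRep w W) (hv : T.IsRep v V) (k : Fin T.numSpace)
    {c : Phase (m + 1) → ℝ} (hc : Integrable c T.phaseMeasure) :
    IntegrableOn (fun z => c z * (W k z * V k z)) {z | z.1 ∈ T.elem k} T.phaseMeasure := by
  obtain ⟨C, hC0, hC⟩ := hw.exists_bound
  obtain ⟨C', hC0', hC'⟩ := hv.exists_bound
  refine integrable_mul_of_bounded hc.integrableOn
    ((hw k).1.measurable.mul (hv k).1.measurable).aestronglyMeasurable ⟨C * C', ?_⟩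
  filter_upwards [ae_restrict_mem (T.measurableSet_over_elem k)] with z hz
  have hz' := T.mem_closure_of_mem_elem hz
  rw [abs_mul]
  exact mul_le_mul (hC k z hz').1 (hC' k z hz').1 (abs_nonneg _) hC0

theorem integrableOn_elem_deriv (hw : T.IsRep w W) (hv : T.IsRep v V) (k : Fin T.numSpace) :
    IntegrableOn (fun z => W k z * fderiv ℝ (fun x => V k (x, z.2)) z.1 (z.2.1 : Space (m + 1)))
      {z | z.1 ∈ T.elem k} T.phaseMeasure := by
  obtain ⟨C, hC0, hC⟩ := hw.exists_bound
  obtain ⟨C', hC0', hC'⟩ := hv.exists_bound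
  refine Measure.integrableOn_of_bounded (M := C * C') (measure_ne_top _ _)
    ((hw k).1.measurable.mul (hv k).1.measurable_deriv).aestronglyMeasurable ?_
  filter_upwards [ae_restrict_mem (T.measurableSet_over_elem k)] with z hz
  have hz' := T.mem_closure_of_mem_elem hz
  rw [norm_mul]
  exact mul_le_mul (hC k z hz').1 (hC' k z hz').2 (abs_nonneg _) hC0

theorem integrableOn_surface {S : Set (Phase (m + 1))} {k : Fin T.numSpace}
    (hS : MeasurableSet S) (hSk : S ⊆ T.overFaces k) {g : Phase (m + 1) → ℝ} (hg : Measurable g)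
    (hgb : ∃ C, ∀ z ∈ T.overFaces k, |g z| ≤ C) (hv : T.IsRep v V) :
    IntegrableOn (fun z => |T.flux k z| * g z * V k z) S T.skeletonMeasure := by
  obtain ⟨C, hC⟩ := hgb
  obtain ⟨C', hC0', hC'⟩ := hv.exists_bound
  refine Mesh.integrableOn_skeleton hS
    (((T.measurable_flux k).abs.mul hg).mul (hv k).1.measurable) ⟨C * C', fun z hz => ?_⟩
  have h1 := T.abs_flux_le_one k z
  have h2 := hC z (hSk hz)
  rw [abs_mul, abs_mul, abs_abs]
  refine mul_le_mul ?_ (hC' k z (T.faces_subset_closure k (hSk hz))).1 (abs_nonneg _)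
    ((abs_nonneg _).trans h2)
  nlinarith [abs_nonneg (g z), abs_nonneg (T.flux k z)]

theorem IsRep_bound_overFaces (hw : T.IsRep w W) (k : Fin T.numSpace) :
    ∃ C, ∀ z ∈ T.overFaces k, |W k z| ≤ C := by
  obtain ⟨C, -, hC⟩ := hw.exists_bound
  exact ⟨C, fun z hz => (hC k z (T.faces_subset_closure k hz)).1⟩

theorem integrableOn_vol (hD : D.IsAdmissible T) (hw : T.IsRep w W) (hv : T.IsRep v V)
    (k : Fin T.numSpace) : IntegrableOn (fun z =>
        -(W k z * fderiv ℝ (fun x => V k (x, z.2)) z.1 (z.2.1 : Space (m + 1)))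
          + (D.α z.1 z.2.2 + D.β T z) * (W k z * V k z))
      {z | z.1 ∈ T.elem k} T.phaseMeasure :=
  (integrableOn_elem_deriv hw hv k).neg.add
    (integrableOn_elem hw hv k (hD.α_integrable.add hD.integrable_β))

theorem integrableOn_out (hw : T.IsRep w W) (hv : T.IsRep v V) (k : Fin T.numSpace) :
    IntegrableOn (fun z => |T.flux k z| * W k z * V k z) (T.outflow k) T.skeletonMeasure :=
  integrableOn_surface (T.measurableSet_outflow k) (T.outflow_subset k) (hw k).1.measurable
    (IsRep_bound_overFaces hw k) hv

theorem integrableOn_in (hw : T.IsRep w W) (hv : T.IsRep v V) (k : Fin T.numSpace) :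
    IntegrableOn (fun z => |T.flux k z| * T.extTrace W k z * V k z) (T.inflow k \ T.boundary)
      T.skeletonMeasure := by
  obtain ⟨C, hC⟩ := Mesh.extTrace_bounded hw k
  exact integrableOn_surface ((T.measurableSet_inflow k).diff T.measurableSet_boundary)
    (sdiff_subset.trans (T.inflow_subset k)) (Mesh.measurable_extTrace hw k)
    ⟨C, fun z _ => hC z⟩ hv

theorem integral_add_const_mul {X : Type*} [MeasurableSpace X] {μ : Measure X} {f g : X → ℝ}
    (hf : Integrable f μ) (hg : Integrable g μ) (c : ℝ) :
    ∫ x, f x + c * g x ∂μ = ∫ x, f x ∂μ + c * ∫ x, g x ∂μ := by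
  rw [integral_add hf (hg.const_mul c), integral_const_mul]

theorem fderiv_add_smul_apply {B : Set (Space (m + 1))} {V U : Phase (m + 1) → ℝ}
    (hV : IsRegularOver B V) (hU : IsRegularOver B U) (c : ℝ) (z : Phase (m + 1)) :
    fderiv ℝ (fun x => (V + c • U) (x, z.2)) z.1 (z.2.1 : Space (m + 1))
      = fderiv ℝ (fun x => V (x, z.2)) z.1 (z.2.1 : Space (m + 1))
        + c * fderiv ℝ (fun x => U (x, z.2)) z.1 (z.2.1 : Space (m + 1)) := by
  rw [hV.fderiv_add_apply (hU.smul c)]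
  congr 1
  have := fderiv_fun_const_smul (((hU.contDiff z.2).differentiable one_ne_zero) z.1) c
  show fderiv ℝ (fun x => c • U (x, z.2)) z.1 (z.2.1 : Space (m + 1)) = _
  rw [this]; rfl

/-- Linearity of the transport form in the second argument. -/
theorem aRep_right {u : Phase (m + 1) → ℝ} (hD : D.IsAdmissible T) (hw : T.IsRep w W)
    (hv : T.IsRep v V) (hu : T.IsRep u U) (c : ℝ) :
    D.aRep T W (V + c • U) = D.aRep T W V + c * D.aRep T W U := by
  unfold aRep
  rw [Finset.mul_sum, ← Finset.sum_add_distrib]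
  refine Finset.sum_congr rfl fun k _ => ?_
  have h1 := integral_add_const_mul (integrableOn_vol hD hw hv k) (integrableOn_vol hD hw hu k) c
  have h2 := integral_add_const_mul (integrableOn_out hw hv k) (integrableOn_out hw hu k) c
  have h3 := integral_add_const_mul (integrableOn_in hw hv k) (integrableOn_in hw hu k) c
  have e1 : ∀ z, (V + c • U) k z = V k z + c * U k z := fun z => rfl
  have e2 : ∀ z : Phase (m + 1), fderiv ℝ (fun x => V k (x, z.2) + c * U k (x, z.2)) z.1
      (z.2.1 : Space (m + 1)) = _ := fun z => fderiv_add_smul_apply (hv k).1 (hu k).1 c z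
  simp only [e1, e2]
  rw [mul_sub, mul_add]
  calc _ = _ := by
        refine congrArg₂ (· - ·) (congrArg₂ (· + ·) ((integral_congr_ae
          (Filter.Eventually.of_forall fun z => ?_)).trans h1) ((integral_congr_ae
          (Filter.Eventually.of_forall fun z => ?_)).trans h2)) ((integral_congr_ae
          (Filter.Eventually.of_forall fun z => ?_)).trans h3)
        all_goals (beta_reduce; ring)
    _ = _ := by ring

/-- Linearity of the transport form in the first argument. -/
theorem aRep_left {u : Phase (m + 1) → ℝ} (hD : D.IsAdmissible T) (hw : T.IsRep w W)
    (hv : T.IsRep v V) (hu : T.IsRep u U) (c : ℝ) :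
    D.aRep T (W + c • U) V = D.aRep T W V + c * D.aRep T U V := by
  unfold aRep
  rw [Finset.mul_sum, ← Finset.sum_add_distrib]
  refine Finset.sum_congr rfl fun k _ => ?_
  have h1 := integral_add_const_mul (integrableOn_vol hD hw hv k) (integrableOn_vol hD hu hv k) c
  have h2 := integral_add_const_mul (integrableOn_out hw hv k) (integrableOn_out hu hv k) c
  have h3 := integral_add_const_mul (integrableOn_in hw hv k) (integrableOn_in hu hv k) c
  have e1 : ∀ z, (W + c • U) k z = W k z + c * U k z := fun z => rfl
  simp only [e1, Mesh.extTrace_add, Mesh.extTrace_smul]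
  rw [mul_sub, mul_add]
  calc _ = _ := by
        refine congrArg₂ (· - ·) (congrArg₂ (· + ·) ((integral_congr_ae
          (Filter.Eventually.of_forall fun z => ?_)).trans h1) ((integral_congr_ae
          (Filter.Eventually.of_forall fun z => ?_)).trans h2)) ((integral_congr_ae
          (Filter.Eventually.of_forall fun z => ?_)).trans h3)
        all_goals (beta_reduce; ring)
    _ = _ := by ring

theorem ℓRep_right {u : Phase (m + 1) → ℝ} (hD : D.IsAdmissible T)
    (hv : T.IsRep v V) (hu : T.IsRep u U) (c : ℝ) :
    D.ℓRep T (V + c • U) = D.ℓRep T V + c * D.ℓRep T U := by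
  have hvol : ∀ {v V}, T.IsRep v V → ∀ k,
      IntegrableOn (fun z => D.f z * V k z) {z | z.1 ∈ T.elem k} T.phaseMeasure := by
    intro v V hv k
    obtain ⟨C, hC0, hC⟩ := hv.exists_bound
    refine integrable_mul_of_bounded hD.f_integrable.integrableOn
      (hv k).1.measurable.aestronglyMeasurable ⟨C, ?_⟩
    filter_upwards [ae_restrict_mem (T.measurableSet_over_elem k)] with z hz
    exact (hC k z (T.mem_closure_of_mem_elem hz)).1
  have hbd : ∀ {v V}, T.IsRep v V → ∀ k, IntegrableOn (fun z => |T.flux k z| * D.gD z * V k z)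
      (T.inflow k ∩ T.boundary) T.skeletonMeasure := by
    intro v V hv k
    obtain ⟨C, hC0, hC⟩ := hv.exists_bound
    have hm := (T.measurableSet_inflow k).inter T.measurableSet_boundary
    have h1 := hD.gD_integrable k
    rw [IntegrableOn, T.faceMeasure_restrict hm (inter_subset_left.trans (T.inflow_subset k))] at h1
    refine integrable_mul_of_bounded h1 (hv k).1.measurable.aestronglyMeasurable ⟨C, ?_⟩
    filter_upwards [ae_restrict_mem hm] with z hz
    exact (hC k z (T.faces_subset_closure k (T.inflow_subset k hz.1))).1
  unfold ℓRep
  rw [Finset.mul_sum, ← Finset.sum_add_distrib]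
  refine Finset.sum_congr rfl fun k _ => ?_
  have h1 := integral_add_const_mul (hvol hv k) (hvol hu k) c
  have h2 := integral_add_const_mul (hbd hv k) (hbd hu k) c
  have e1 : ∀ z, (V + c • U) k z = V k z + c * U k z := fun z => rfl
  simp only [e1]
  rw [mul_add]
  calc _ = _ := by
        refine congrArg₂ (· + ·) ((integral_congr_ae
          (Filter.Eventually.of_forall fun z => ?_)).trans h1) ((integral_congr_ae
          (Filter.Eventually.of_forall fun z => ?_)).trans h2)
        all_goals ring
    _ = _ := by ring

/-! ### Integration by parts -/

/-- The divergence theorem applied to `v²` on one element, integrated over angle and energy. -/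
theorem integral_mul_deriv (hv : T.IsRep v V) (k : Fin T.numSpace) :
    ∫ z in {z : Phase (m + 1) | z.1 ∈ T.elem k},
        V k z * fderiv ℝ (fun x => V k (x, z.2)) z.1 (z.2.1 : Space (m + 1)) ∂T.phaseMeasure
      = 1 / 2 * ∫ z in T.overFaces k, T.flux k z * V k z ^ 2 ∂T.skeletonMeasure := by
  obtain ⟨H, hH, hinj, hfr⟩ := exists_arrangement T.elem_polytope
  have hint1 := integrableOn_elem_deriv hv hv k
  rw [IntegrableOn, T.phaseMeasure_restrict_elem k] at hint1
  have hint2 : IntegrableOn (fun z => T.flux k z * V k z ^ 2) (T.overFaces k)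
      T.skeletonMeasure := by
    obtain ⟨C, hC0, hC⟩ := hv.exists_bound
    refine Mesh.integrableOn_skeleton (T.measurableSet_overFaces k)
      ((T.measurable_flux k).mul ((hv k).1.measurable.pow_const 2)) ⟨C ^ 2, fun z hz => ?_⟩
    have h1 := T.abs_flux_le_one k z
    have h2 := (hC k z (T.faces_subset_closure k hz)).1
    rw [abs_mul, abs_pow]
    have h3 : |V k z| ^ 2 ≤ C ^ 2 := pow_le_pow_left₀ (abs_nonneg _) h2 2
    nlinarith [abs_nonneg (T.flux k z), pow_nonneg (abs_nonneg (V k z)) 2]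
  rw [IntegrableOn, ← T.faceMeasure_eq_restrict k, Mesh.faceMeasure] at hint2
  rw [T.phaseMeasure_restrict_elem k, ← T.faceMeasure_eq_restrict k, Mesh.faceMeasure,
    integral_prod_symm _ hint1]
  have : SFinite ((μHE[m + 1 - 1] : Measure (Space (m + 1))).restrict (faces (T.elem k))) := by
    have : IsFiniteMeasure
        ((μHE[m + 1 - 1] : Measure (Space (m + 1))).restrict (faces (T.elem k))) :=
      isFiniteMeasure_restrict.2
        (measure_faces_lt_top (T.isOpen_elem k) (T.elem_polytope k).bounded hH (hfr k)).ne
    infer_instance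
  rw [integral_prod_symm _ hint2, ← integral_const_mul]
  refine integral_congr_ae (Filter.Eventually.of_forall fun y => ?_)
  have hcd : ContDiff ℝ 1 fun x => V k (x, y) := (hv k).1.contDiff y
  have h1 := integral_fderiv_eq_integral_faces (T.isOpen_elem k) (T.elem_polytope k).bounded
    (T.elem_polytope k).regular hH hinj (hfr k) (y.1 : Space (m + 1)) (hcd.pow 2)
  have h2 : ∀ x, fderiv ℝ (fun x => V k (x, y) ^ 2) x (y.1 : Space (m + 1))
      = 2 * (V k (x, y) * fderiv ℝ (fun x => V k (x, y)) x (y.1 : Space (m + 1))) := by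
    intro x
    have h3 := ((hcd.differentiable one_ne_zero x).hasFDerivAt.pow 2).fderiv
    rw [h3]
    simp; ring
  simp only [h2] at h1
  rw [integral_const_mul] at h1
  show ∫ x in T.elem k, V k (x, y) * fderiv ℝ (fun x => V k (x, y)) x (y.1 : Space (m + 1))
    = 1 / 2 * ∫ x in faces (T.elem k),
      ⟪(y.1 : Space (m + 1)), normal (T.elem k) x⟫ * V k (x, y) ^ 2 ∂μHE[m]
  linarith [h1]

end Data

namespace Data

variable {m : ℕ} {D : Data (m + 1)} {T : Mesh (m + 1)}
variable {v w : Phase (m + 1) → ℝ} {V W : Fin T.numSpace → Phase (m + 1) → ℝ}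

open Classical in
/-- The density, on an interior face, of the outflow of `v²` from the element `k` minus the inflow
of the squared exterior trace. -/
noncomputable def exchange (T : Mesh (m + 1)) (V : Fin T.numSpace → Phase (m + 1) → ℝ)
    (k : Fin T.numSpace) (z : Phase (m + 1)) : ℝ :=
  if z ∈ T.overFaces k ∧ z ∉ T.boundary then
    |T.flux k z| * (if 0 ≤ T.flux k z then V k z ^ 2 else -T.extTrace V k z ^ 2) else 0

theorem flux_eq_neg {k l : Fin T.numSpace} (hkl : k ≠ l) {z : Phase (m + 1)}
    (hk : z ∈ T.overFaces k) (hl : z ∈ T.overFaces l) : T.flux l z = -T.flux k z := by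
  rw [Mesh.flux, Mesh.flux, Mesh.eq_neg_normal hkl hk hl, inner_neg_right]

/-- What leaves an element through an interior face enters its neighbour, since the fluxes of the
two elements are opposite and the exterior trace of one is the interior trace of the other. -/
theorem sum_exchange_eq_zero (V : Fin T.numSpace → Phase (m + 1) → ℝ) :
    ∀ᵐ z ∂T.skeletonMeasure, ∑ k, exchange T V k z = 0 := by
  filter_upwards [T.ae_exists_neighbour] with z hz
  by_cases hb : z ∈ T.boundary
  · exact Finset.sum_eq_zero fun k _ => if_neg fun h => h.2 hb
  by_cases hex : ∃ k, z ∈ T.overFaces k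
  · obtain ⟨k, hk⟩ := hex
    obtain ⟨l, hlk, hl⟩ := hz k hk hb
    rw [Finset.sum_eq_add k l hlk.symm]
    · have ek : exchange T V k z = |T.flux k z| *
          (if 0 ≤ T.flux k z then V k z ^ 2 else -T.extTrace V k z ^ 2) := if_pos ⟨hk, hb⟩
      have el : exchange T V l z = |T.flux l z| *
          (if 0 ≤ T.flux l z then V l z ^ 2 else -T.extTrace V l z ^ 2) := if_pos ⟨hl, hb⟩
      rw [ek, el, flux_eq_neg hlk.symm hk hl, Mesh.extTrace_eq hlk.symm hk hl,
        Mesh.extTrace_eq hlk hl hk, abs_neg]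
      rcases lt_trichotomy (T.flux k z) 0 with h | h | h
      · rw [if_neg (not_le.2 h), if_pos (by linarith)]; ring
      · simp [h]
      · rw [if_pos h.le, if_neg (by linarith)]; ring
    · intro j _ hj
      exact if_neg fun h => Mesh.notMem_faces_third hlk.symm hj.1 hj.2 hk hl h.1
    · simp
    · simp
  · push Not at hex
    exact Finset.sum_eq_zero fun k _ => if_neg fun h => hex k h.1

theorem integral_combination {X : Type*} [MeasurableSpace X] {μ : Measure X}
    {p o i r b : X → ℝ} (hp : Integrable p μ) (ho : Integrable o μ) (hi : Integrable i μ)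
    (hr : Integrable r μ) (hb : Integrable b μ) :
    ∫ x, (-(1 / 2) * p x + o x - i x - (1 / 2) * (r x + b x)) ∂μ
      = -(1 / 2) * (∫ x, p x ∂μ) + (∫ x, o x ∂μ) - (∫ x, i x ∂μ)
        - (1 / 2) * ((∫ x, r x ∂μ) + ∫ x, b x ∂μ) := by
  have h1 : Integrable (fun x => -(1 / 2) * p x + o x) μ := (hp.const_mul _).add ho
  have h2 : Integrable (fun x => -(1 / 2) * p x + o x - i x) μ := h1.sub hi
  have h3 : Integrable (fun x => (1 / 2) * (r x + b x)) μ := (hr.add hb).const_mul _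
  rw [integral_sub h2 h3, integral_sub h1 hi, integral_add (hp.const_mul _) ho,
    integral_const_mul, integral_const_mul, integral_add hr hb]

/-- **Surface terms of the transport form.** After integration by parts, they are half the sum of
the squared jumps and boundary values. -/
theorem surface_identity (hv : T.IsRep v V) :
    ∑ k, (-(1 / 2) * (∫ z in T.overFaces k, T.flux k z * V k z ^ 2 ∂T.skeletonMeasure)
      + (∫ z in T.outflow k, |T.flux k z| * V k z * V k z ∂T.skeletonMeasure)
      - (∫ z in T.inflow k \ T.boundary,
          |T.flux k z| * T.extTrace V k z * V k z ∂T.skeletonMeasure))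
    = (1 / 2) * ∑ k, ((∫ z in T.inflow k \ T.boundary,
          |T.flux k z| * (V k z - T.extTrace V k z) ^ 2 ∂T.skeletonMeasure)
        + ∫ z in T.overFaces k ∩ T.boundary, |T.flux k z| * V k z ^ 2 ∂T.skeletonMeasure) := by
  have mO := T.measurableSet_outflow
  have mI := fun k => (T.measurableSet_inflow k).diff T.measurableSet_boundary
  have mZ := T.measurableSet_overFaces
  have mB := fun k => (mZ k).inter T.measurableSet_boundary
  obtain ⟨C, hC0, hC⟩ := hv.exists_bound
  have hV2 : ∀ k, ∀ z ∈ T.overFaces k, |V k z ^ 2| ≤ C ^ 2 := fun k z hz => by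
    rw [abs_pow]
    exact pow_le_pow_left₀ (abs_nonneg _) (hC k z (T.faces_subset_closure k hz)).1 2
  have hflux : ∀ k z (a : ℝ), |T.flux k z * a| ≤ |a| := fun k z a => by
    rw [abs_mul]
    exact mul_le_of_le_one_left (abs_nonneg _) (T.abs_flux_le_one k z)
  have hflux' : ∀ k z (a : ℝ), |(|T.flux k z| * a)| ≤ |a| := fun k z a => by
    rw [abs_mul, abs_abs]
    exact mul_le_of_le_one_left (abs_nonneg _) (T.abs_flux_le_one k z)
  have ip : ∀ k, IntegrableOn (fun z => T.flux k z * V k z ^ 2) (T.overFaces k)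
      T.skeletonMeasure := fun k => Mesh.integrableOn_skeleton (mZ k)
    ((T.measurable_flux k).mul ((hv k).1.measurable.pow_const 2))
    ⟨C ^ 2, fun z hz => (hflux k z _).trans (hV2 k z hz)⟩
  have io := fun k => integrableOn_out hv hv k
  have ii := fun k => integrableOn_in hv hv k
  have ir : ∀ k, IntegrableOn (fun z => |T.flux k z| * (V k z - T.extTrace V k z) ^ 2)
      (T.inflow k \ T.boundary) T.skeletonMeasure := by
    intro k
    obtain ⟨C', hC'⟩ := Mesh.extTrace_bounded hv k
    refine Mesh.integrableOn_skeleton (mI k) ((T.measurable_flux k).abs.mul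
      (((hv k).1.measurable.sub (Mesh.measurable_extTrace hv k)).pow_const 2))
      ⟨(C + C') ^ 2, fun z hz => (hflux' k z _).trans ?_⟩
    rw [abs_pow]
    refine pow_le_pow_left₀ (abs_nonneg _) ((abs_sub _ _).trans (add_le_add ?_ (hC' z))) 2
    exact (hC k z (T.faces_subset_closure k hz.1.1)).1
  have ib : ∀ k, IntegrableOn (fun z => |T.flux k z| * V k z ^ 2) (T.overFaces k ∩ T.boundary)
      T.skeletonMeasure := fun k => Mesh.integrableOn_skeleton (mB k)
    ((T.measurable_flux k).abs.mul ((hv k).1.measurable.pow_const 2))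
    ⟨C ^ 2, fun z hz => (hflux' k z _).trans (hV2 k z hz.1)⟩
  have jp := fun k => (ip k).integrable_indicator (mZ k)
  have jo := fun k => (io k).integrable_indicator (mO k)
  have ji := fun k => (ii k).integrable_indicator (mI k)
  have jr := fun k => (ir k).integrable_indicator (mI k)
  have jb := fun k => (ib k).integrable_indicator (mB k)
  -- Pointwise, the difference of the two sides is half the exchange on interior faces; on boundary
  -- faces it vanishes.
  have hpt : ∀ k z, -(1 / 2) * (T.overFaces k).indicator (fun z => T.flux k z * V k z ^ 2) z
      + (T.outflow k).indicator (fun z => |T.flux k z| * V k z * V k z) z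
      - (T.inflow k \ T.boundary).indicator
          (fun z => |T.flux k z| * T.extTrace V k z * V k z) z
      - (1 / 2) * ((T.inflow k \ T.boundary).indicator
          (fun z => |T.flux k z| * (V k z - T.extTrace V k z) ^ 2) z
        + (T.overFaces k ∩ T.boundary).indicator (fun z => |T.flux k z| * V k z ^ 2) z)
      = (1 / 2) * exchange T V k z := by
    intro k z
    have hIn : z ∈ T.inflow k ↔ z ∈ T.overFaces k ∧ T.flux k z < 0 := Iff.rfl
    have hOut : z ∈ T.outflow k ↔ z ∈ T.overFaces k ∧ 0 ≤ T.flux k z := Iff.rfl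
    rw [exchange]
    classical
    simp only [Set.indicator_apply, mem_sdiff, mem_inter_iff, hIn, hOut]
    by_cases hz : z ∈ T.overFaces k
    · by_cases hb : z ∈ T.boundary
      · rcases lt_or_ge (T.flux k z) 0 with h | h
        · simp [hz, hb, h, abs_of_neg h, not_le.2 h]
        · simp [hz, hb, h, abs_of_nonneg h, not_lt.2 h]; ring
      · rcases lt_or_ge (T.flux k z) 0 with h | h
        · simp [hz, hb, h, abs_of_neg h, not_le.2 h]; ring
        · simp [hz, hb, h, abs_of_nonneg h, not_lt.2 h]; ring
    · simp [hz]
  have hzero : ∫ z, ∑ k, (1 / 2) * exchange T V k z ∂T.skeletonMeasure = 0 := by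
    rw [← integral_zero (Phase (m + 1)) ℝ (μ := T.skeletonMeasure)]
    refine integral_congr_ae ?_
    filter_upwards [sum_exchange_eq_zero V] with z hz
    rw [← Finset.mul_sum, hz, mul_zero]
  rw [integral_finsetSum] at hzero
  · rw [← sub_eq_zero, Finset.mul_sum, ← Finset.sum_sub_distrib, ← hzero]
    refine Finset.sum_congr rfl fun k _ => ?_
    rw [← integral_indicator (mZ k), ← integral_indicator (mO k), ← integral_indicator (mI k),
      ← integral_indicator (mI k), ← integral_indicator (mB k),
      ← integral_combination (jp k) (jo k) (ji k) (jr k) (jb k)]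
    exact integral_congr_ae (Filter.Eventually.of_forall fun z => hpt k z)
  · intro k _
    refine (((((jp k).const_mul (-(1 / 2))).add (jo k)).sub (ji k)).sub
      (((jr k).add (jb k)).const_mul (1 / 2))).congr (Filter.Eventually.of_forall fun z => ?_)
    exact hpt k z

/-- The contribution of jumps and boundary values to the square of the energy norm. -/
noncomputable def jumpTerm (T : Mesh (m + 1)) (v : Phase (m + 1) → ℝ) : ℝ :=
  ∑ k : Fin T.numSpace, ((∫ z in T.inflow k \ T.boundary,
      |T.flux k z| * (T.traceInt k v z - T.traceExt k v z) ^ 2 ∂T.faceMeasure k)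
    + (∫ z in {z : Phase (m + 1) | z.1 ∈ faces (T.elem k)} ∩ T.boundary,
      |T.flux k z| * T.traceInt k v z ^ 2 ∂T.faceMeasure k))

theorem jumpTerm_nonneg (T : Mesh (m + 1)) (v : Phase (m + 1) → ℝ) : 0 ≤ jumpTerm T v :=
  Finset.sum_nonneg fun _ _ => add_nonneg (integral_nonneg fun _ => by positivity)
    (integral_nonneg fun _ => by positivity)

theorem jumpTerm_eq (hv : T.IsRep v V) : jumpTerm T v
    = ∑ k, ((∫ z in T.inflow k \ T.boundary,
          |T.flux k z| * (V k z - T.extTrace V k z) ^ 2 ∂T.skeletonMeasure)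
        + ∫ z in T.overFaces k ∩ T.boundary, |T.flux k z| * V k z ^ 2 ∂T.skeletonMeasure) := by
  refine Finset.sum_congr rfl fun k _ => ?_
  congr 1
  · have hm := (T.measurableSet_inflow k).diff T.measurableSet_boundary
    rw [T.faceMeasure_restrict hm (sdiff_subset.trans (T.inflow_subset k))]
    refine setIntegral_congr_ae hm ?_
    filter_upwards [Mesh.ae_traceExt_eq hv k] with z hz hzk
    rw [hz hzk, Mesh.traceInt_eq hv (T.inflow_subset k hzk.1)]
  · have hm := (T.measurableSet_overFaces k).inter T.measurableSet_boundary
    show ∫ z in T.overFaces k ∩ T.boundary, _ ∂_ = _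
    rw [T.faceMeasure_restrict hm inter_subset_left]
    refine setIntegral_congr_fun hm fun z hz => ?_
    simp only [Mesh.traceInt_eq hv hz.1]

theorem integral_FE_eq_sum (hv : v ∈ T.FESpace) {c : Phase (m + 1) → ℝ}
    (hc : Integrable c T.phaseMeasure) :
    ∑ k, ∫ z in {z : Phase (m + 1) | z.1 ∈ T.elem k}, c z * v z ^ 2 ∂T.phaseMeasure
      = ∫ z, c z * v z ^ 2 ∂T.phaseMeasure := by
  obtain ⟨C, hC⟩ := Mesh.FE_bounded hv
  have hint : Integrable (fun z => c z * v z ^ 2) T.phaseMeasure :=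
    integrable_mul_of_bounded hc ((Mesh.FE_measurable hv).pow_const 2).aestronglyMeasurable
      ⟨C ^ 2, Filter.Eventually.of_forall fun z => by
        rw [abs_pow]; exact pow_le_pow_left₀ (abs_nonneg _) (hC z) 2⟩
  rw [← integral_iUnion_fintype T.measurableSet_over_elem
    (fun k l hkl => (T.elem_disjoint k l hkl).preimage Prod.fst) fun k => hint.integrableOn]
  refine setIntegral_eq_integral_of_forall_compl_eq_zero fun z hz => ?_
  rw [Mesh.apply_eq_zero_of_notMem_elem hv fun k hk => hz (mem_iUnion.2 ⟨k, hk⟩)]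
  simp

/-- The transport form on the diagonal. -/
theorem a_self (hD : D.IsAdmissible T) (hv : v ∈ T.FESpace) :
    D.a T v v = (∫ z, (D.α z.1 z.2.2 + D.β T z) * v z ^ 2 ∂T.phaseMeasure)
      + (1 / 2) * jumpTerm T v := by
  obtain ⟨V, hV⟩ := Mesh.exists_isRep hv
  have hc : Integrable (fun z : Phase (m + 1) => D.α z.1 z.2.2 + D.β T z) T.phaseMeasure :=
    hD.α_integrable.add hD.integrable_β
  rw [a_eq_aRep hV hV, jumpTerm_eq hV, ← surface_identity hV, ← integral_FE_eq_sum hv hc,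
    ← Finset.sum_add_distrib, aRep]
  refine Finset.sum_congr rfl fun k _ => ?_
  have h0 := integral_add_const_mul (integrableOn_elem hV hV k hc)
    (integrableOn_elem_deriv hV hV k) (-1)
  rw [integral_mul_deriv hV k] at h0
  have h1 : ∫ z in {z : Phase (m + 1) | z.1 ∈ T.elem k},
      (D.α z.1 z.2.2 + D.β T z) * v z ^ 2 ∂T.phaseMeasure
      = ∫ z in {z : Phase (m + 1) | z.1 ∈ T.elem k},
        (D.α z.1 z.2.2 + D.β T z) * (V k z * V k z) ∂T.phaseMeasure :=
    setIntegral_congr_fun (T.measurableSet_over_elem k) fun z hz => by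
      simp only [(hV k).2 z hz]; ring
  have h2 : ∫ z in {z : Phase (m + 1) | z.1 ∈ T.elem k},
      (-(V k z * fderiv ℝ (fun x => V k (x, z.2)) z.1 (z.2.1 : Space (m + 1)))
        + (D.α z.1 z.2.2 + D.β T z) * (V k z * V k z)) ∂T.phaseMeasure = _ :=
    Eq.trans (integral_congr_ae (Filter.Eventually.of_forall fun z => by beta_reduce; ring)) h0
  rw [h1, h2]
  ring

end Data

/-! ### Scattering -/

section Exchange

variable {X Y : Type*} [MeasurableSpace X] [MeasurableSpace Y] {μ : Measure X} {ν : Measure Y}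
  [SFinite μ] [SFinite ν]

/-- The interchange `((x, y), y') ↦ ((x, y'), y)` of the states before and after a collision. -/
theorem measurePreserving_exchange : MeasurePreserving
    (fun w : (X × Y) × Y => ((w.1.1, w.2), w.1.2)) ((μ.prod ν).prod ν) ((μ.prod ν).prod ν) :=
  ((measurePreserving_prodAssoc μ ν ν).symm.comp
    ((MeasurePreserving.id μ).prod (Measure.measurePreserving_swap (μ := ν) (ν := ν)))).comp
    (measurePreserving_prodAssoc μ ν ν)

variable {F : (X × Y) × Y → ℝ} {v w u : X × Y → ℝ}

theorem integrable_exchange (hF : Integrable F ((μ.prod ν).prod ν)) :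
    Integrable (fun p : (X × Y) × Y => F ((p.1.1, p.2), p.1.2)) ((μ.prod ν).prod ν) :=
  measurePreserving_exchange.integrable_comp_of_integrable hF

theorem integral_exchange (hF : Integrable F ((μ.prod ν).prod ν)) :
    ∫ p, F ((p.1.1, p.2), p.1.2) ∂((μ.prod ν).prod ν) = ∫ p, F p ∂((μ.prod ν).prod ν) := by
  have h := (measurePreserving_exchange (μ := μ) (ν := ν))
  have h1 := integral_map h.measurable.aemeasurable (f := F)
    (by rw [h.map_eq]; exact hF.aestronglyMeasurable)
  rw [h.map_eq] at h1
  exact h1.symm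

theorem integrable_kernel_mul (hF : Integrable F ((μ.prod ν).prod ν)) (hw : Measurable w)
    (hwb : ∃ C, ∀ z, |w z| ≤ C) (hv : Measurable v) (hvb : ∃ C, ∀ z, |v z| ≤ C) :
    Integrable (fun p : (X × Y) × Y =>
      F ((p.1.1, p.2), p.1.2) * (w (p.1.1, p.2) * v p.1)) ((μ.prod ν).prod ν) := by
  obtain ⟨C, hC⟩ := hwb
  obtain ⟨C', hC'⟩ := hvb
  refine integrable_mul_of_bounded (integrable_exchange hF)
    (by fun_prop : Measurable _).aestronglyMeasurable
    ⟨C * C', Filter.Eventually.of_forall fun p => ?_⟩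
  rw [abs_mul]
  exact mul_le_mul (hC _) (hC' _) (abs_nonneg _) ((abs_nonneg _).trans (hC p.1))

theorem integral_scatter_eq (hF : Integrable F ((μ.prod ν).prod ν)) (hw : Measurable w)
    (hwb : ∃ C, ∀ z, |w z| ≤ C) (hv : Measurable v) (hvb : ∃ C, ∀ z, |v z| ≤ C) :
    ∫ z, (∫ y, F ((z.1, y), z.2) * w (z.1, y) ∂ν) * v z ∂(μ.prod ν)
      = ∫ p, F ((p.1.1, p.2), p.1.2) * (w (p.1.1, p.2) * v p.1) ∂((μ.prod ν).prod ν) := by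
  rw [integral_prod _ (integrable_kernel_mul hF hw hwb hv hvb)]
  refine integral_congr_ae (Filter.Eventually.of_forall fun z => ?_)
  beta_reduce
  rw [← integral_mul_const]
  simp only [mul_assoc]

/-- **Young's inequality for scattering.** Scattering is dominated by the average of the losses
`∫ F(x, y, y') dy'` and the gains `∫ F(x, y', y) dy'`: apply `v v' ≤ (v² + v'²) / 2` under the
integral and interchange `y` and `y'` in one of the two terms. -/
theorem integral_scatter_self_le (hF : Integrable F ((μ.prod ν).prod ν))
    (hF0 : ∀ᵐ p ∂((μ.prod ν).prod ν), 0 ≤ F p) (hv : Measurable v) (hvb : ∃ C, ∀ z, |v z| ≤ C) :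
    ∫ z, (∫ y, F ((z.1, y), z.2) * v (z.1, y) ∂ν) * v z ∂(μ.prod ν)
      ≤ (1 / 2) * ((∫ z, (∫ y, F (z, y) ∂ν) * v z ^ 2 ∂(μ.prod ν))
        + ∫ z, (∫ y, F ((z.1, y), z.2) ∂ν) * v z ^ 2 ∂(μ.prod ν)) := by
  have hbd : ∃ C, ∀ z, |v z ^ 2| ≤ C := by
    obtain ⟨C, hC⟩ := hvb
    exact ⟨C ^ 2, fun z => by rw [abs_pow]; exact pow_le_pow_left₀ (abs_nonneg _) (hC z) 2⟩
  obtain ⟨C, hC⟩ := hbd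
  have i1 : Integrable (fun p : (X × Y) × Y => F p * v p.1 ^ 2) ((μ.prod ν).prod ν) :=
    integrable_mul_of_bounded hF (by fun_prop : Measurable _).aestronglyMeasurable
      ⟨C, Filter.Eventually.of_forall fun p => hC p.1⟩
  have i1' := integrable_exchange i1
  have i2 : Integrable (fun p : (X × Y) × Y => F ((p.1.1, p.2), p.1.2) * v p.1 ^ 2)
      ((μ.prod ν).prod ν) :=
    integrable_mul_of_bounded (integrable_exchange hF)
      (by fun_prop : Measurable _).aestronglyMeasurable
      ⟨C, Filter.Eventually.of_forall fun p => hC p.1⟩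
  have e1 : ∫ z, (∫ y, F (z, y) ∂ν) * v z ^ 2 ∂(μ.prod ν)
      = ∫ p, F ((p.1.1, p.2), p.1.2) * v (p.1.1, p.2) ^ 2 ∂((μ.prod ν).prod ν) := by
    rw [integral_exchange i1, integral_prod _ i1]
    simp only [integral_mul_const]
  have e2 : ∫ z, (∫ y, F ((z.1, y), z.2) ∂ν) * v z ^ 2 ∂(μ.prod ν)
      = ∫ p, F ((p.1.1, p.2), p.1.2) * v p.1 ^ 2 ∂((μ.prod ν).prod ν) := by
    rw [integral_prod _ i2]
    simp only [integral_mul_const]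
  rw [integral_scatter_eq hF hv hvb hv hvb, e1, e2, ← integral_add i1' i2, ← integral_const_mul]
  refine integral_mono_ae (integrable_kernel_mul hF hv hvb hv hvb) ((i1'.add i2).const_mul _) ?_
  filter_upwards [measurePreserving_exchange.quasiMeasurePreserving.ae hF0] with p hp
  nlinarith [mul_nonneg hp (sq_nonneg (v (p.1.1, p.2) - v p.1))]

end Exchange

namespace Mesh

variable {m : ℕ} (T : Mesh (m + 1))

theorem ae_mem_domain : ∀ᵐ z ∂T.phaseMeasure, z ∈ T.domain := by
  have h1 : ∀ᵐ x ∂(volume.restrict T.Ω), x ∈ T.Ω := ae_restrict_mem T.isOpen_Ω.measurableSet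
  have h2 := T.energy.ae_mem_domain
  have h1' := Measure.quasiMeasurePreserving_fst (μ := volume.restrict T.Ω)
    (ν := T.angleEnergyMeasure) |>.ae h1
  have h2' := (Measure.quasiMeasurePreserving_snd (μ := sphereMeasure (m + 1))
    (ν := T.energy.measure)).comp (Measure.quasiMeasurePreserving_snd
      (μ := volume.restrict T.Ω) (ν := T.angleEnergyMeasure)) |>.ae h2
  filter_upwards [h1', h2'] with z hz hz'
  exact ⟨hz, mem_univ _, hz'⟩

theorem restrict_domain : T.phaseMeasure.restrict T.domain = T.phaseMeasure :=
  Measure.restrict_eq_self_of_ae_mem T.ae_mem_domain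

end Mesh

namespace Data

variable {m : ℕ} {D : Data (m + 1)} {T : Mesh (m + 1)} {v w u : Phase (m + 1) → ℝ}

theorem IsAdmissible.integrable_γ (hD : D.IsAdmissible T) : Integrable (D.γ T) T.phaseMeasure :=
  (integrable_exchange hD.θ_integrable).integral_prod_left

theorem IsAdmissible.integrable_αbar (hD : D.IsAdmissible T) :
    Integrable (D.αbar T) T.phaseMeasure :=
  hD.α_integrable.add ((hD.integrable_β.sub hD.integrable_γ).const_mul _)

theorem s_eq (hD : D.IsAdmissible T) (hw : w ∈ T.FESpace) (hv : v ∈ T.FESpace) :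
    D.s T w v = ∫ p, D.θ p.1.1 ⟪(p.2.1 : Space (m + 1)), (p.1.2.1 : Space (m + 1))⟫ p.2.2 p.1.2.2
      * (w (p.1.1, p.2) * v p.1) ∂(T.phaseMeasure.prod T.angleEnergyMeasure) :=
  integral_scatter_eq hD.θ_integrable (Mesh.FE_measurable hw) (Mesh.FE_bounded hw)
    (Mesh.FE_measurable hv) (Mesh.FE_bounded hv)

theorem integrable_s (hD : D.IsAdmissible T) (hw : w ∈ T.FESpace) (hv : v ∈ T.FESpace) :
    Integrable (fun p : Phase (m + 1) × (Direction (m + 1) × ℝ) =>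
      D.θ p.1.1 ⟪(p.2.1 : Space (m + 1)), (p.1.2.1 : Space (m + 1))⟫ p.2.2 p.1.2.2
      * (w (p.1.1, p.2) * v p.1)) (T.phaseMeasure.prod T.angleEnergyMeasure) :=
  integrable_kernel_mul hD.θ_integrable (Mesh.FE_measurable hw) (Mesh.FE_bounded hw)
    (Mesh.FE_measurable hv) (Mesh.FE_bounded hv)

theorem s_right (hD : D.IsAdmissible T) (hw : w ∈ T.FESpace) (hv : v ∈ T.FESpace)
    (hu : u ∈ T.FESpace) (c : ℝ) : D.s T w (v + c • u) = D.s T w v + c * D.s T w u := by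
  rw [s_eq hD hw hv, s_eq hD hw hu, s_eq hD hw (add_mem hv (Submodule.smul_mem _ c hu)),
    ← integral_add_const_mul (integrable_s hD hw hv) (integrable_s hD hw hu)]
  refine integral_congr_ae (Filter.Eventually.of_forall fun p => ?_)
  simp only [Pi.add_apply, Pi.smul_apply, smul_eq_mul]
  ring

theorem s_left (hD : D.IsAdmissible T) (hw : w ∈ T.FESpace) (hv : v ∈ T.FESpace)
    (hu : u ∈ T.FESpace) (c : ℝ) : D.s T (w + c • u) v = D.s T w v + c * D.s T u v := by
  rw [s_eq hD hw hv, s_eq hD hu hv, s_eq hD (add_mem hw (Submodule.smul_mem _ c hu)) hv,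
    ← integral_add_const_mul (integrable_s hD hw hv) (integrable_s hD hu hv)]
  refine integral_congr_ae (Filter.Eventually.of_forall fun p => ?_)
  simp only [Pi.add_apply, Pi.smul_apply, smul_eq_mul]
  ring

theorem a_right (hD : D.IsAdmissible T) (hw : w ∈ T.FESpace) (hv : v ∈ T.FESpace)
    (hu : u ∈ T.FESpace) (c : ℝ) : D.a T w (v + c • u) = D.a T w v + c * D.a T w u := by
  obtain ⟨W, hW⟩ := Mesh.exists_isRep hw
  obtain ⟨V, hV⟩ := Mesh.exists_isRep hv
  obtain ⟨U, hU⟩ := Mesh.exists_isRep hu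
  rw [a_eq_aRep hW hV, a_eq_aRep hW hU, a_eq_aRep hW (hV.add (hU.smul c)),
    aRep_right hD hW hV hU]

theorem a_left (hD : D.IsAdmissible T) (hw : w ∈ T.FESpace) (hv : v ∈ T.FESpace)
    (hu : u ∈ T.FESpace) (c : ℝ) : D.a T (w + c • u) v = D.a T w v + c * D.a T u v := by
  obtain ⟨W, hW⟩ := Mesh.exists_isRep hw
  obtain ⟨V, hV⟩ := Mesh.exists_isRep hv
  obtain ⟨U, hU⟩ := Mesh.exists_isRep hu
  rw [a_eq_aRep hW hV, a_eq_aRep hU hV, a_eq_aRep (hW.add (hU.smul c)) hV,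
    aRep_left hD hW hV hU]

theorem ℓ_right (hD : D.IsAdmissible T) (hv : v ∈ T.FESpace) (hu : u ∈ T.FESpace) (c : ℝ) :
    D.ℓ T (v + c • u) = D.ℓ T v + c * D.ℓ T u := by
  obtain ⟨V, hV⟩ := Mesh.exists_isRep hv
  obtain ⟨U, hU⟩ := Mesh.exists_isRep hu
  rw [ℓ_eq_ℓRep hV, ℓ_eq_ℓRep hU, ℓ_eq_ℓRep (hV.add (hU.smul c)), ℓRep_right hD hV hU]

theorem residual_right (hD : D.IsAdmissible T) (hw : w ∈ T.FESpace) (hv : v ∈ T.FESpace)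
    (hu : u ∈ T.FESpace) (c : ℝ) :
    D.residual T w (v + c • u) = D.residual T w v + c * D.residual T w u := by
  unfold residual
  rw [ℓ_right hD hv hu, a_right hD hw hv hu, s_right hD hw hv hu]
  ring

theorem ae_θ_nonneg (hD : D.IsAdmissible T) :
    ∀ᵐ p : Phase (m + 1) × (Direction (m + 1) × ℝ) ∂(T.phaseMeasure.prod T.angleEnergyMeasure),
      0 ≤ D.θ p.1.1 ⟪(p.1.2.1 : Space (m + 1)), (p.2.1 : Space (m + 1))⟫ p.1.2.2 p.2.2 := by
  have h1 := (Measure.quasiMeasurePreserving_fst (μ := T.phaseMeasure)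
    (ν := T.angleEnergyMeasure)).ae T.ae_mem_domain
  have h2 := (Measure.quasiMeasurePreserving_snd (μ := sphereMeasure (m + 1))
    (ν := T.energy.measure)).comp (Measure.quasiMeasurePreserving_snd
      (μ := T.phaseMeasure) (ν := T.angleEnergyMeasure)) |>.ae T.energy.ae_mem_domain
  filter_upwards [h1, h2] with p hp hp'
  refine hD.θ_nonneg _ hp.1 _ ?_ _ hp.2.2 _ hp'
  have h3 := abs_real_inner_le_norm (p.1.2.1 : Space (m + 1)) (p.2.1 : Space (m + 1))
  rw [norm_eq_of_mem_sphere, norm_eq_of_mem_sphere, mul_one] at h3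
  exact abs_le.1 h3

theorem integrable_mul_FE {c : Phase (m + 1) → ℝ} (hc : Integrable c T.phaseMeasure)
    (hw : w ∈ T.FESpace) (hv : v ∈ T.FESpace) :
    Integrable (fun z => c z * (w z * v z)) T.phaseMeasure := by
  obtain ⟨C, hC⟩ := Mesh.FE_bounded hw
  obtain ⟨C', hC'⟩ := Mesh.FE_bounded hv
  refine integrable_mul_of_bounded hc
    ((Mesh.FE_measurable hw).mul (Mesh.FE_measurable hv)).aestronglyMeasurable
    ⟨C * C', Filter.Eventually.of_forall fun z => ?_⟩
  rw [abs_mul]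
  exact mul_le_mul (hC _) (hC' _) (abs_nonneg _) ((abs_nonneg _).trans (hC z))

/-- **Coercivity** of the transport form minus the scattering form. Scattering costs at most
`(β + γ) / 2`, which leaves `α + β - (β + γ) / 2 = ᾱ` of the reaction term. -/
theorem coercive (hD : D.IsAdmissible T) (hv : v ∈ T.FESpace) :
    (∫ z, D.αbar T z * v z ^ 2 ∂T.phaseMeasure) + (1 / 2) * jumpTerm T v
      ≤ D.a T v v - D.s T v v := by
  have hs : D.s T v v ≤ (1 / 2) * ((∫ z, D.β T z * v z ^ 2 ∂T.phaseMeasure)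
      + ∫ z, D.γ T z * v z ^ 2 ∂T.phaseMeasure) :=
    integral_scatter_self_le hD.θ_integrable (ae_θ_nonneg hD)
      (Mesh.FE_measurable hv) (Mesh.FE_bounded hv)
  have iα := integrable_mul_FE hD.α_integrable hv hv
  have iβ := integrable_mul_FE hD.integrable_β hv hv
  have iγ := integrable_mul_FE hD.integrable_γ hv hv
  simp only [← pow_two] at iα iβ iγ
  have h1 : ∫ z, (D.α z.1 z.2.2 + D.β T z) * v z ^ 2 ∂T.phaseMeasure
      = (∫ z, D.α z.1 z.2.2 * v z ^ 2 ∂T.phaseMeasure)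
        + ∫ z, D.β T z * v z ^ 2 ∂T.phaseMeasure := by
    rw [← integral_add iα iβ]
    simp only [add_mul]
  have h2 : ∫ z, D.αbar T z * v z ^ 2 ∂T.phaseMeasure
      = (∫ z, D.α z.1 z.2.2 * v z ^ 2 ∂T.phaseMeasure)
        + (1 / 2) * ((∫ z, D.β T z * v z ^ 2 ∂T.phaseMeasure)
          - ∫ z, D.γ T z * v z ^ 2 ∂T.phaseMeasure) := by
    have iβγ : Integrable (fun z => D.β T z * v z ^ 2 - D.γ T z * v z ^ 2) T.phaseMeasure :=
      iβ.sub iγ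
    rw [← integral_sub iβ iγ, ← integral_add_const_mul iα iβγ]
    refine integral_congr_ae (Filter.Eventually.of_forall fun z => ?_)
    simp only [αbar]
    ring
  rw [a_self hD hv, h1, h2]
  linarith

end Data

/-! ### The Riesz representation of the residual and the error bound -/

namespace Mesh

variable {m : ℕ} (T : Mesh (m + 1))

theorem measurableSet_element (κ : T.Index) : MeasurableSet (T.element κ) :=
  (T.measurableSet_elem κ.1).prod ((T.cell κ.2.1).measurableSet_curved.prod
    (T.energy.measurableSet_group κ.2.2))

theorem pairwise_disjoint_element : Pairwise (Function.onFun Disjoint T.element) := by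
  rintro ⟨k, l, g⟩ ⟨k', l', g'⟩ hne
  rw [Function.onFun, element, element, disjoint_prod, disjoint_prod]
  by_cases hk : k = k'
  · by_cases hl : l = l'
    · refine Or.inr (Or.inr (T.energy.disjoint_group g g' ?_))
      rintro rfl
      exact hne (by rw [hk, hl])
    · exact Or.inr (Or.inl (T.disjoint_curved l l' hl))
  · exact Or.inl (T.elem_disjoint k k' hk)

end Mesh

namespace Data

variable {m : ℕ} {D : Data (m + 1)} {T : Mesh (m + 1)} {v w r u : Phase (m + 1) → ℝ}

theorem IsAdmissible.ae_αbar_pos (hD : D.IsAdmissible T) :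
    ∀ᵐ z ∂T.phaseMeasure, 0 < D.αbar T z := by
  obtain ⟨α₀, h0, h⟩ := hD.αbar_pos
  filter_upwards [h] with z hz
  exact h0.trans_le hz

theorem l2Norm_sq (hD : D.IsAdmissible T) (A : Set (Phase (m + 1))) (v : Phase (m + 1) → ℝ) :
    T.l2Norm A (fun z => √(D.αbar T z) * v z) ^ 2
      = ∫ z in A, D.αbar T z * v z ^ 2 ∂T.phaseMeasure := by
  rw [Mesh.l2Norm, Real.sq_sqrt (integral_nonneg fun z => by positivity)]
  refine integral_congr_ae ?_
  filter_upwards [ae_restrict_of_ae hD.ae_αbar_pos] with z hz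
  rw [mul_pow, Real.sq_sqrt hz.le]

theorem dgNorm_sq (hD : D.IsAdmissible T) (v : Phase (m + 1) → ℝ) :
    D.dgNorm T v ^ 2 = (∫ z, D.αbar T z * v z ^ 2 ∂T.phaseMeasure) + (1 / 2) * jumpTerm T v := by
  have h := jumpTerm_nonneg T v
  rw [jumpTerm] at h ⊢
  rw [dgNorm, Real.sq_sqrt (by positivity), l2Norm_sq hD, T.restrict_domain]

/-- The weighted inner product `(ᾱ r, v)` on the finite element space. -/
noncomputable def weightedInner (hD : D.IsAdmissible T) :
    T.FESpace →ₗ[ℝ] T.FESpace →ₗ[ℝ] ℝ :=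
  LinearMap.mk₂ ℝ (fun r v => ∫ z, D.αbar T z * (r.1 z * v.1 z) ∂T.phaseMeasure)
    (fun r r' v => by
      rw [← integral_add (integrable_mul_FE hD.integrable_αbar r.2 v.2)
        (integrable_mul_FE hD.integrable_αbar r'.2 v.2)]
      refine integral_congr_ae (Filter.Eventually.of_forall fun z => ?_)
      simp only [Submodule.coe_add, Pi.add_apply]
      ring)
    (fun c r v => by
      rw [smul_eq_mul, ← integral_const_mul]
      refine integral_congr_ae (Filter.Eventually.of_forall fun z => ?_)
      simp only [Submodule.coe_smul, Pi.smul_apply, smul_eq_mul]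
      ring)
    (fun r v v' => by
      rw [← integral_add (integrable_mul_FE hD.integrable_αbar r.2 v.2)
        (integrable_mul_FE hD.integrable_αbar r.2 v'.2)]
      refine integral_congr_ae (Filter.Eventually.of_forall fun z => ?_)
      simp only [Submodule.coe_add, Pi.add_apply]
      ring)
    (fun c r v => by
      rw [smul_eq_mul, ← integral_const_mul]
      refine integral_congr_ae (Filter.Eventually.of_forall fun z => ?_)
      simp only [Submodule.coe_smul, Pi.smul_apply, smul_eq_mul]
      ring)

theorem weightedInner_apply (hD : D.IsAdmissible T) (r v : T.FESpace) :
    weightedInner hD r v = ∫ z in T.domain, D.αbar T z * r.1 z * v.1 z ∂T.phaseMeasure := by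
  rw [T.restrict_domain]
  simp only [mul_assoc]
  rfl

/-- The form `(ᾱ r, r)` is definite: `ᾱ` is positive, and a finite element function that vanishes
almost everywhere is zero. -/
theorem weightedInner_injective (hD : D.IsAdmissible T) :
    Function.Injective (weightedInner hD) := by
  rw [injective_iff_map_eq_zero]
  intro r hr
  have h0 : ∫ z, D.αbar T z * (r.1 z * r.1 z) ∂T.phaseMeasure = 0 :=
    congrArg (fun L => L r) hr
  have hpos : ∀ᵐ z ∂T.phaseMeasure, 0 ≤ D.αbar T z * (r.1 z * r.1 z) := by
    filter_upwards [hD.ae_αbar_pos] with z hz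
    exact mul_nonneg hz.le (mul_self_nonneg _)
  have h1 := (integral_eq_zero_iff_of_nonneg_ae hpos
    (integrable_mul_FE hD.integrable_αbar r.2 r.2)).1 h0
  refine Subtype.ext (Mesh.FE_eq_zero_of_ae r.2 ?_)
  filter_upwards [h1, hD.ae_αbar_pos] with z hz hz'
  simpa [hz'.ne'] using hz

theorem weightedInner_bijective (hD : D.IsAdmissible T) :
    Function.Bijective (weightedInner hD) := by
  have : Module.Finite ℝ T.FESpace := Module.Finite.iff_fg.2 T.FESpace_fg
  refine ⟨weightedInner_injective hD, ?_⟩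
  exact (LinearMap.injective_iff_surjective_of_finrank_eq_finrank
    (Subspace.dual_finrank_eq (K := ℝ) (V := T.FESpace)).symm).1 (weightedInner_injective hD)

/-- The residual as a linear functional on the finite element space. -/
noncomputable def residualFunctional (hD : D.IsAdmissible T) (hw : w ∈ T.FESpace) :
    T.FESpace →ₗ[ℝ] ℝ where
  toFun v := D.residual T w v
  map_add' v v' := by
    simpa using residual_right hD hw v.2 v'.2 1
  map_smul' c v := by
    have h0 := residual_right hD hw (zero_mem _) (zero_mem _) 1
    have h1 := residual_right hD hw (zero_mem _) v.2 c
    simp only [smul_zero, add_zero, one_mul, left_eq_add] at h0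
    simpa [h0] using h1

theorem existsUnique_isResidualRep (hD : D.IsAdmissible T) (hw : w ∈ T.FESpace) :
    ∃! r, D.IsResidualRep T w r := by
  obtain ⟨r, hr, huniq⟩ := (weightedInner_bijective hD).existsUnique (residualFunctional hD hw)
  have key : ∀ r : T.FESpace,
      D.IsResidualRep T w r ↔ weightedInner hD r = residualFunctional hD hw := by
    refine fun r => ⟨fun h => LinearMap.ext fun v => ?_, fun h => ⟨r.2, fun v hv => ?_⟩⟩
    · rw [weightedInner_apply]; exact h.2 v.1 v.2
    · rw [← weightedInner_apply hD r ⟨v, hv⟩, h]; rfl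
  refine ⟨r, (key r).2 hr, fun r' hr' => ?_⟩
  exact congrArg Subtype.val (huniq ⟨r', hr'.1⟩ ((key ⟨r', hr'.1⟩).1 hr'))

theorem memLp_sqrt_mul (hD : D.IsAdmissible T) (hr : r ∈ T.FESpace) :
    MemLp (fun z => √(D.αbar T z) * r z) 2 T.phaseMeasure := by
  have hm : AEStronglyMeasurable (fun z => √(D.αbar T z) * r z) T.phaseMeasure :=
    (Real.continuous_sqrt.comp_aestronglyMeasurable
      hD.integrable_αbar.aestronglyMeasurable).mul (Mesh.FE_measurable hr).aestronglyMeasurable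
  rw [memLp_two_iff_integrable_sq hm]
  refine (integrable_mul_FE hD.integrable_αbar hr hr).congr ?_
  filter_upwards [hD.ae_αbar_pos] with z hz
  rw [mul_pow, Real.sq_sqrt hz.le, pow_two]

/-- Finite element functions vanish off the elements, so that the local norms add up to the global
one. -/
theorem sum_η_sq (hD : D.IsAdmissible T) (hr : r ∈ T.FESpace) :
    ∑ κ : T.Index, D.η T r κ ^ 2 = T.l2Norm T.domain (fun z => √(D.αbar T z) * r z) ^ 2 := by
  have hint := integrable_mul_FE hD.integrable_αbar hr hr
  simp only [← pow_two] at hint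
  simp only [η, l2Norm_sq hD]
  rw [← integral_iUnion_fintype T.measurableSet_element T.pairwise_disjoint_element
    fun κ => hint.integrableOn, T.restrict_domain]
  refine setIntegral_eq_integral_of_forall_compl_eq_zero fun z hz => ?_
  rw [Mesh.apply_eq_zero_of_notMem_element hr fun κ hκ => hz (mem_iUnion.2 ⟨κ, hκ⟩)]
  simp

/-- Galerkin orthogonality: the residual of `w`, evaluated at the error `u - w`, is the
transport-scattering form of the error with itself. -/
theorem residual_error (hD : D.IsAdmissible T) (hu : D.IsDGSolution T u) (hw : w ∈ T.FESpace) :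
    D.residual T w (u - w) = D.a T (u - w) (u - w) - D.s T (u - w) (u - w) := by
  have he : u - w ∈ T.FESpace := sub_mem hu.1 hw
  have h1 := hu.2 _ he
  have h2 := a_left hD hu.1 he hw (-1)
  have h3 := s_left hD hu.1 he hw (-1)
  rw [neg_one_smul, ← sub_eq_add_neg] at h2 h3
  rw [residual, h2, h3]
  linarith

/-- The energy norm of the error is bounded by the weighted norm of the residual: coercivity gives
`|||e|||² ≤ (ᾱ r, e)`, and `(ᾱ r, e) ≤ (‖√ᾱ r‖² + ‖√ᾱ e‖²) / 2 ≤ (‖√ᾱ r‖² + |||e|||²) / 2`. -/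
theorem dgNorm_error_le (hD : D.IsAdmissible T) (hu : D.IsDGSolution T u) (hw : w ∈ T.FESpace)
    (hr : D.IsResidualRep T w r) :
    D.dgNorm T (u - w) ≤ T.l2Norm T.domain (fun z => √(D.αbar T z) * r z) := by
  have he : u - w ∈ T.FESpace := sub_mem hu.1 hw
  refine le_of_sq_le_sq ?_ (Real.sqrt_nonneg _)
  have hα := hD.integrable_αbar
  have irr := integrable_mul_FE hα hr.1 hr.1
  have iee := integrable_mul_FE hα he he
  have h1 := coercive hD he
  rw [← dgNorm_sq hD, ← residual_error hD hu hw, ← hr.2 _ he, T.restrict_domain] at h1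
  have h2 : ∫ z, D.αbar T z * r z * (u - w) z ∂T.phaseMeasure
      ≤ (1 / 2) * ((∫ z, D.αbar T z * r z ^ 2 ∂T.phaseMeasure)
        + ∫ z, D.αbar T z * (u - w) z ^ 2 ∂T.phaseMeasure) := by
    simp only [pow_two, mul_assoc]
    rw [← integral_add irr iee, ← integral_const_mul]
    refine integral_mono_ae (integrable_mul_FE hα hr.1 he) ((irr.add iee).const_mul _) ?_
    filter_upwards [hD.ae_αbar_pos] with z hz
    nlinarith [mul_nonneg hz.le (sq_nonneg (r z - (u - w) z))]
  have h3 := dgNorm_sq hD (T := T) (u - w)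
  have h4 := jumpTerm_nonneg T (u - w)
  rw [l2Norm_sq hD, T.restrict_domain]
  linarith

end Data

end LBTE

theorem mainTheorem2 {d : ℕ} (hd : d = 2 ∨ d = 3) (T : LBTE.Mesh d) (D : LBTE.Data d)
    (hD : D.IsAdmissible T) (u uhat : LBTE.Phase d → ℝ) (hu : D.IsDGSolution T u)
    (huhat : uhat ∈ T.FESpace) :
    (∃! r : LBTE.Phase d → ℝ, D.IsResidualRep T uhat r) ∧
    ∀ r : LBTE.Phase d → ℝ, D.IsResidualRep T uhat r →
      MemLp (fun z => √(D.αbar T z) * r z) 2 T.phaseMeasure ∧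
      D.dgNorm T (u - uhat) ≤ √(∑ κ : T.Index, D.η T r κ ^ 2) ∧
      √(∑ κ : T.Index, D.η T r κ ^ 2)
        = T.l2Norm T.domain (fun z => √(D.αbar T z) * r z) := by
  obtain ⟨m, rfl⟩ : ∃ m, d = m + 1 := ⟨d - 1, by omega⟩
  refine ⟨LBTE.Data.existsUnique_isResidualRep hD huhat, fun r hr => ?_⟩
  have hη : √(∑ κ : T.Index, D.η T r κ ^ 2)
      = T.l2Norm T.domain (fun z => √(D.αbar T z) * r z) := by
    rw [LBTE.Data.sum_η_sq hD hr.1]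
    exact Real.sqrt_sq (Real.sqrt_nonneg _)
  exact ⟨LBTE.Data.memLp_sqrt_mul hD hr.1,
    (LBTE.Data.dgNorm_error_le hD hu huhat hr).trans_eq hη.symm, hη⟩
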